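/- A polytope is the convex hull of finitely many points in some $\mathbb{R}^n$; its size is the number of its facets. A polytope $Q \subseteq \mathbb{R}^{n}$ is an extension of a polytope $P \subseteq \mathbb{R}^d$ ($n \ge d$) if the orthogonal projection of $Q$ onto the first $d$ coordinates equals $P$; it is a minimum size extension if no extension of $P$ (in any dimension) has fewer facets. Let $P \subseteq \mathbb{R}^2$ be a convex heptagon, that is, a polytope with exactly seven vertices, and write $\overline{uv}$ for the line through two distinct points $u, v$. Suppose that $P$ is in general position, meaning: 1. there are no four pairwise distinct vertices $u_1,\dots,u_4$ of $P$ such that the lines $\overline{u_1u_2}$ and $\overline{u_3u_4}$ are parallel; 2. there are no six pairwise distinct vertices $u_1,\dots,u_6$ of $P$ such that the lines $\overline{u_1u_2}$, $\overline{u_3u_4}$, $\overline{u_5u_6}$ have a common point; 3. there are no seven pairwise distinct vertices $u_1,\dots,u_7$ of $P$ such that the three intersection points $\overline{u_1u_2}\cap\overline{u_3u_4}$, $\overline{u_2u_5}\cap\overline{u_4u_6}$ and $\overline{u_3u_7}\cap\overline{u_1u_5}$ lie on one line. Then every minimum size extension $Q$ of $P$ has exactly $6$ facets, and it has a vertex that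 is not projected onto a vertex of $P$. -/

import Mathlib

/-- A polytope in `ℝⁿ` is the convex hull of a finite set of points. -/
def IsPolytope {n : ℕ} (Q : Set (Fin n → ℝ)) : Prop :=
  ∃ S : Set (Fin n → ℝ), S.Finite ∧ Q = convexHull ℝ S

/-- The vertices of a polytope are its extreme points. -/
def vertices {n : ℕ} (Q : Set (Fin n → ℝ)) : Set (Fin n → ℝ) :=
  Q.extremePoints ℝ

/-- A facet of `Q` is a nonempty face (the set of maximizers over `Q` of a linear functional) whose
dimension is one less than the dimension of `Q`. -/
def IsFacet {n : ℕ} (Q F : Set (Fin n → ℝ)) : Prop :=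
  F.Nonempty ∧ IsExposed ℝ Q F ∧
    Module.finrank ℝ (vectorSpan ℝ F) + 1 = Module.finrank ℝ (vectorSpan ℝ Q)

/-- The size of a polytope is the number of its facets. -/
noncomputable def polytopeSize {n : ℕ} (Q : Set (Fin n → ℝ)) : ℕ∞ :=
  {F | IsFacet Q F}.encard

/-- The orthogonal projection `ℝᵈ⁺ᵏ → ℝᵈ` onto the first `d` coordinates. -/
def firstCoords (d k : ℕ) (x : Fin (d + k) → ℝ) : Fin d → ℝ :=
  fun i => x (Fin.castAdd k i)

/-- The polytope `Q ⊆ ℝᵈ⁺ᵏ` is an extension of `P ⊆ ℝᵈ` if it is projected onto `P`. -/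
def IsExtension {d k : ℕ} (Q : Set (Fin (d + k) → ℝ)) (P : Set (Fin d → ℝ)) : Prop :=
  IsPolytope Q ∧ firstCoords d k '' Q = P

/-- An extension of `P` of minimum size among all extensions of `P`, in all dimensions. -/
def IsMinimumSizeExtension {d k : ℕ} (Q : Set (Fin (d + k) → ℝ)) (P : Set (Fin d → ℝ)) : Prop :=
  IsExtension Q P ∧
    ∀ (l : ℕ) (R : Set (Fin (d + l) → ℝ)), IsExtension R P → polytopeSize Q ≤ polytopeSize R

/-- A convex heptagon: a polytope in the plane with exactly seven vertices. -/
def IsConvexHeptagon (P : Set (Fin 2 → ℝ)) : Prop :=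
  IsPolytope P ∧ (vertices P).ncard = 7

/-- No two lines through disjoint pairs of vertices are parallel. -/
def NoParallelLines (P : Set (Fin 2 → ℝ)) : Prop :=
  ¬ ∃ u : Fin 4 → (Fin 2 → ℝ), Function.Injective u ∧ (∀ i, u i ∈ vertices P) ∧
    line[ℝ, u 0, u 1].Parallel line[ℝ, u 2, u 3]

/-- No three lines through disjoint pairs of vertices have a common point. -/
def NoConcurrentLines (P : Set (Fin 2 → ℝ)) : Prop :=
  ¬ ∃ u : Fin 6 → (Fin 2 → ℝ), Function.Injective u ∧ (∀ i, u i ∈ vertices P) ∧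
    ∃ p, p ∈ line[ℝ, u 0, u 1] ∧ p ∈ line[ℝ, u 2, u 3] ∧ p ∈ line[ℝ, u 4, u 5]

/-- There are no seven pairwise distinct vertices `u₁, …, u₇` (here indexed `0, …, 6`) such that
the intersection points `u₁u₂ ∩ u₃u₄`, `u₂u₅ ∩ u₄u₆` and `u₃u₇ ∩ u₁u₅` lie on one line. -/
def NoSpecialCollinearity (P : Set (Fin 2 → ℝ)) : Prop :=
  ¬ ∃ u : Fin 7 → (Fin 2 → ℝ), Function.Injective u ∧ (∀ i, u i ∈ vertices P) ∧
    ∃ p q r : Fin 2 → ℝ,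
      (p ∈ line[ℝ, u 0, u 1] ∧ p ∈ line[ℝ, u 2, u 3]) ∧
      (q ∈ line[ℝ, u 1, u 4] ∧ q ∈ line[ℝ, u 3, u 5]) ∧
      (r ∈ line[ℝ, u 2, u 6] ∧ r ∈ line[ℝ, u 0, u 4]) ∧
      Collinear ℝ {p, q, r}

/-- The general-position assumption on a convex heptagon. -/
def InGeneralPosition (P : Set (Fin 2 → ℝ)) : Prop :=
  NoParallelLines P ∧ NoConcurrentLines P ∧ NoSpecialCollinearity P

/-!
The values of the facet inequalities of an extension `Q` on the cone over `Q` form the nonnegative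
part of a subspace `K ⊆ ℝ^ι`, where `ι` is the set of facets, and the extreme rays of this cone are
the vertices of `Q`. The projection maps it onto the cone over the heptagon, which forces
`dim K ≥ 4` when there are at most six facets. After adding coordinates up to six, `K` is then
given by two linear equations: it is the space of linear dependencies of six vectors
`lam i • (1, t i)` in the plane. Its extreme rays are supported on the minimal subfamilies with a
positive dependency, hence are determined by the signs of the `lam i` and the order of the `t i`.

For fewer than six facets, an added coordinate accounts for one of at most seven rays, too few for
the seven vertices. For six facets, suppose that every vertex of `Q` lies over a vertex of the
heptagon. Up to symmetry, either there are at most six rays, or the rays contain those of the cone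
over a triangular prism, a cube or a product of two triangles. Eliminating a facet from two rays
turns these patterns into incidences between lines through vertices of the heptagon: parallel or
concurrent lines, or the special collinearity.

Six facets suffice. For a suitable labelling of the vertices `q 0, …, q 6`, lifting `q 2` and `q 5`
out of the plane gives a polytope with six facets, provided two inequalities between products of
triangle areas hold. If they held for no rotation of the labels, the second one would fail for all
seven, and the product of the seven failures would contradict the three-term Grassmann–Plücker
relation.
-/

/-! ### Plane geometry -/

/-- Twice the signed area of the triangle `a b c`; it is positive when the triangle is
counterclockwise and zero when the three points are collinear. -/
def orient (a b c : Fin 2 → ℝ) : ℝ :=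
  (b 0 - a 0) * (c 1 - a 1) - (b 1 - a 1) * (c 0 - a 0)

section Orient

variable (a b c d x : Fin 2 → ℝ)

theorem orient_rotate : orient b c a = orient a b c := by
  unfold orient; ring

theorem orient_swap : orient a c b = -orient a b c := by
  unfold orient; ring

@[simp]
theorem orient_self_left : orient a a b = 0 := by
  unfold orient; ring

@[simp]
theorem orient_self_right : orient a b b = 0 := by
  unfold orient; ring

@[simp]
theorem orient_self_outer : orient a b a = 0 := by
  unfold orient; ring

theorem orient_add_orient_add_orient :
    orient b c x + orient c a x + orient a b x = orient a b c := by
  unfold orient; ring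

theorem orient_barycentric :
    orient b c x • a + orient c a x • b + orient a b x • c = orient a b c • x := by
  ext l
  fin_cases l <;> simp [orient] <;> ring

theorem orient_mul_orient :
    orient x a c * orient x b d = orient x a b * orient x c d + orient x a d * orient x b c := by
  unfold orient; ring

variable {a b c d x}

theorem collinear_of_orient_eq_zero (h : orient a b c = 0) : Collinear ℝ {a, b, c} := by
  rcases eq_or_ne a b with rfl | hab
  · simpa using collinear_pair ℝ a c
  obtain ⟨i, hi⟩ : ∃ i, b i - a i ≠ 0 := by
    by_contra! hcon
    exact hab (funext fun i => (sub_eq_zero.1 (hcon i)).symm)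
  rw [collinear_iff_of_mem (p₀ := a) (by simp)]
  refine ⟨b - a, ?_⟩
  simp only [Set.mem_insert_iff, Set.mem_singleton_iff, forall_eq_or_imp, forall_eq]
  refine ⟨⟨0, by simp⟩, ⟨1, by simp⟩, (c i - a i) / (b i - a i), ?_⟩
  unfold orient at h
  ext l
  simp only [vadd_eq_add, Pi.add_apply, Pi.smul_apply, Pi.sub_apply, smul_eq_mul]
  rw [div_mul_eq_mul_div, ← sub_eq_iff_eq_add, eq_div_iff hi]
  fin_cases i <;> fin_cases l <;> simp only [Fin.zero_eta, Fin.mk_one] <;> linarith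

theorem mem_convexHull_of_orient_nonneg (h : 0 < orient a b c) (hc : 0 ≤ orient a b x)
    (ha : 0 ≤ orient b c x) (hb : 0 ≤ orient c a x) : x ∈ convexHull ℝ {a, b, c} := by
  have hmem : ∀ i, ![a, b, c] i ∈ convexHull ℝ {a, b, c} := by
    intro i
    fin_cases i <;> exact subset_convexHull ℝ _ (by simp)
  have := (convex_convexHull ℝ {a, b, c}).sum_mem (t := Finset.univ)
    (w := (orient a b c)⁻¹ • ![orient b c x, orient c a x, orient a b x]) (z := ![a, b, c])
    (fun i _ => ?_) ?_ fun i _ => hmem i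
  · have hsum : ∑ i, ((orient a b c)⁻¹ • ![orient b c x, orient c a x, orient a b x]) i •
        ![a, b, c] i = (orient a b c)⁻¹ • orient a b c • x := by
      rw [← orient_barycentric]
      simp [Fin.sum_univ_three, mul_smul]
    rwa [hsum, inv_smul_smul₀ h.ne'] at this
  · fin_cases i
    exacts [mul_nonneg (inv_nonneg.2 h.le) ha, mul_nonneg (inv_nonneg.2 h.le) hb,
      mul_nonneg (inv_nonneg.2 h.le) hc]
  · simp [Fin.sum_univ_three, ← mul_add, orient_add_orient_add_orient, h.ne']

end Orient

theorem mem_of_mem_extremePoints_of_mem_convexHull {E : Type*} [AddCommGroup E] [Module ℝ E]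
    {P S : Set E} {x : E} (hP : Convex ℝ P) (hS : S ⊆ P) (hx : x ∈ P.extremePoints ℝ)
    (hxS : x ∈ convexHull ℝ S) : x ∈ S :=
  extremePoints_convexHull_subset <|
    inter_extremePoints_subset_extremePoints_of_subset (convexHull_min hS hP) ⟨hxS, hx⟩

theorem orient_ne_zero_of_mem_extremePoints {P : Set (Fin 2 → ℝ)} {a b c : Fin 2 → ℝ}
    (hP : Convex ℝ P) (ha : a ∈ P.extremePoints ℝ) (hb : b ∈ P.extremePoints ℝ)
    (hc : c ∈ P.extremePoints ℝ) (hab : a ≠ b) (hac : a ≠ c) (hbc : b ≠ c) :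
    orient a b c ≠ 0 := by
  have not_wbtw : ∀ x ∈ P, ∀ y ∈ P.extremePoints ℝ, ∀ z ∈ P, y ≠ x → y ≠ z → ¬ Wbtw ℝ x y z := by
    intro x hx y hy z hz hyx hyz h
    have := mem_of_mem_extremePoints_of_mem_convexHull hP (Set.pair_subset hx hz) hy
      (by rwa [convexHull_pair, mem_segment_iff_wbtw])
    simp_all
  intro h
  rcases (collinear_of_orient_eq_zero h).wbtw_or_wbtw_or_wbtw with h | h | h
  · exact not_wbtw a ha.1 b hb c hc.1 hab.symm hbc h
  · exact not_wbtw b hb.1 c hc a ha.1 hbc.symm hac.symm h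
  · exact not_wbtw c hc.1 a ha b hb.1 hac hab h

theorem exists_generic_combination {ι 𝕜 : Type*} [Finite ι] [Field 𝕜] [Infinite 𝕜] (α β : ι → 𝕜) :
    ∃ τ : 𝕜, ∀ i, α i + τ * β i = 0 → α i = 0 ∧ β i = 0 := by
  obtain ⟨τ, hτ⟩ := (Set.finite_range fun i => -α i / β i).exists_notMem
  refine ⟨τ, fun i hi => ?_⟩
  by_cases hβ : β i = 0
  · simp_all
  · exact absurd ⟨i, by rw [div_eq_iff hβ]; linear_combination -hi⟩ hτ

theorem exists_enum_strictMono {α β : Type*} [LinearOrder β] {n : ℕ} {S : Set α} {g : α → β}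
    (hfin : S.Finite) (hcard : S.ncard = n) (hg : Set.InjOn g S) :
    ∃ q : Fin n → α, Set.range q = S ∧ StrictMono (g ∘ q) := by
  have : Finite S := hfin
  let e : Fin n ≃ S := (Finite.equivFinOfCardEq hcard).symm
  let σ := Tuple.sort fun i => g (e i)
  refine ⟨fun i => e (σ i), ?_,
    (Tuple.monotone_sort fun i => g (e i)).strictMono_of_injective fun i j h => ?_⟩
  · exact ((σ.trans e).surjective.range_comp Subtype.val).trans Subtype.range_coe
  · exact σ.injective (e.injective (Subtype.ext (hg (e _).2 (e _).2 h)))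

theorem exists_lt_combination {V : Set (Fin 2 → ℝ)} (hfin : V.Finite) (hne : V.Nonempty) :
    ∃ a ∈ V, ∃ τ : ℝ, ∀ b ∈ V, b ≠ a → a 0 + τ * a 1 < b 0 + τ * b 1 := by
  have : Finite V := hfin
  obtain ⟨τ, hτ⟩ := exists_generic_combination (fun x : V × V => x.1.1 0 - x.2.1 0)
    fun x : V × V => x.1.1 1 - x.2.1 1
  obtain ⟨a, ha, hmin⟩ := Set.exists_min_image V (fun x => x 0 + τ * x 1) hfin hne
  refine ⟨a, ha, τ, fun b hb hba => (hmin b hb).lt_of_ne fun h => hba ?_⟩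
  have := hτ (⟨b, hb⟩, ⟨a, ha⟩) (by linear_combination -h)
  ext i
  fin_cases i
  exacts [sub_eq_zero.1 this.1, sub_eq_zero.1 this.2]

/-- The points `p 0, p 1, …` are in counterclockwise convex position. -/
def IsCounterclockwise {n : ℕ} (p : Fin n → Fin 2 → ℝ) : Prop :=
  ∀ ⦃i j k⦄, i < j → j < k → 0 < orient (p i) (p j) (p k)

theorem orient_pos_of_mem_extremePoints {P : Set (Fin 2 → ℝ)} {a b c d : Fin 2 → ℝ}
    (hP : Convex ℝ P) (ha : a ∈ P) (hb : b ∈ P) (hc : c ∈ P.extremePoints ℝ) (hd : d ∈ P)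
    (habc : 0 < orient a b c) (hacd : 0 < orient a c d) (habd : 0 < orient a b d) :
    0 < orient b c d := by
  by_contra! h
  have hmem : c ∈ convexHull ℝ {a, b, d} := by
    refine mem_convexHull_of_orient_nonneg habd habc.le ?_ ?_
    · rwa [orient_swap, Left.nonneg_neg_iff]
    · rw [← orient_rotate]
      exact hacd.le
  rcases mem_of_mem_extremePoints_of_mem_convexHull hP (by grind) hc hmem with rfl | rfl | rfl <;>
    simp_all

/-- The vertices other than `a`, an extreme vertex for a generic linear form, are sorted by the
slope at which they are seen from `a`. -/
theorem exists_isCounterclockwise {P : Set (Fin 2 → ℝ)} {n : ℕ} (hP : Convex ℝ P)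
    (hcard : (P.extremePoints ℝ).ncard = n + 1) :
    ∃ p : Fin (n + 1) → Fin 2 → ℝ, Set.range p = P.extremePoints ℝ ∧ IsCounterclockwise p := by
  have hfin : (P.extremePoints ℝ).Finite := Set.finite_of_ncard_ne_zero (by omega)
  obtain ⟨a, ha, τ, hlt⟩ := exists_lt_combination hfin (Set.nonempty_of_ncard_ne_zero (by omega))
  let f : (Fin 2 → ℝ) → ℝ := fun x => x 0 + τ * x 1
  let slope : (Fin 2 → ℝ) → ℝ := fun b => (b 1 - a 1) / (f b - f a)
  let S := P.extremePoints ℝ \ {a}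
  have hpos : ∀ b ∈ S, 0 < f b - f a := fun b hb => sub_pos.2 (hlt b hb.1 hb.2)
  have horient : ∀ b ∈ S, ∀ c ∈ S,
      orient a b c = (f b - f a) * (f c - f a) * (slope c - slope b) := by
    intro b hb c hc
    simp only [slope]
    field_simp [(hpos b hb).ne', (hpos c hc).ne']
    simp only [orient, f]
    ring
  have hinj : Set.InjOn slope S := by
    intro b hb c hc hbc
    by_contra hne
    refine orient_ne_zero_of_mem_extremePoints hP ha hb.1 hc.1 (Ne.symm hb.2) (Ne.symm hc.2) hne ?_
    rw [horient b hb c hc, hbc, sub_self, mul_zero]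
  obtain ⟨q, hqS, hq⟩ := exists_enum_strictMono (hfin.subset Set.sdiff_subset)
    (Nat.succ_injective ((Set.ncard_sdiff_singleton_add_one ha hfin).trans hcard)) hinj
  have hmem : ∀ i, q i ∈ S := fun i => hqS.subset (Set.mem_range_self i)
  have hfan : ∀ ⦃i j⦄, i < j → 0 < orient a (q i) (q j) := by
    intro i j hij
    rw [horient _ (hmem i) _ (hmem j)]
    exact mul_pos (mul_pos (hpos _ (hmem i)) (hpos _ (hmem j))) (sub_pos.2 (hq hij))
  refine ⟨Fin.cons a q, ?_, fun i j k hij hjk => ?_⟩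
  · rw [Fin.range_cons, hqS, Set.insert_sdiff_singleton, Set.insert_eq_of_mem ha]
  obtain ⟨j, rfl⟩ := Fin.exists_succ_eq.2 (Fin.ne_zero_of_lt hij)
  obtain ⟨k, rfl⟩ := Fin.exists_succ_eq.2 (Fin.ne_zero_of_lt hjk)
  rw [Fin.succ_lt_succ_iff] at hjk
  induction i using Fin.cases with
  | zero => simpa using hfan hjk
  | succ i =>
    rw [Fin.succ_lt_succ_iff] at hij
    exact orient_pos_of_mem_extremePoints hP ha.1 (hmem i).1.1 (hmem j).1 (hmem k).1.1
      (hfan hij) (hfan hjk) (hfan (hij.trans hjk))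

theorem IsCounterclockwise.shift {n : ℕ} {p : Fin (n + 1) → Fin 2 → ℝ} (hp : IsCounterclockwise p)
    (s : Fin (n + 1)) : IsCounterclockwise fun i => p (s + i) := by
  intro i j k hij hjk
  have hcases : (s + i < s + j ∧ s + j < s + k) ∨ (s + j < s + k ∧ s + k < s + i) ∨
      (s + k < s + i ∧ s + i < s + j) := by
    simp only [Fin.lt_def, Fin.val_add_eq_ite] at *
    grind
  rcases hcases with h | h | h
  · exact hp h.1 h.2
  · rw [← orient_rotate]
    exact hp h.1 h.2
  · rw [← orient_rotate, ← orient_rotate]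
    exact hp h.1 h.2

theorem IsCounterclockwise.mem_convexHull {n : ℕ} {p : Fin (n + 3) → Fin 2 → ℝ}
    (hp : IsCounterclockwise p) {x : Fin 2 → ℝ} (hx : ∀ i, 0 ≤ orient (p i) (p (i + 1)) x) :
    x ∈ convexHull ℝ (Set.range p) := by
  have fan : ∀ i : Fin (n + 1), 0 ≤ orient (p 0) (p i.castSucc.succ) x →
      orient (p 0) (p i.succ.succ) x ≤ 0 → x ∈ convexHull ℝ (Set.range p) := by
    intro i hi hi'
    refine convexHull_mono (s := {p 0, p i.castSucc.succ, p i.succ.succ}) (by grind) <|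
      mem_convexHull_of_orient_nonneg (hp (by simp) (by simp)) hi ?_ ?_
    · have := hx i.succ.castSucc
      rwa [Fin.coeSucc_eq_succ, ← Fin.succ_castSucc] at this
    · rwa [← orient_rotate, orient_swap, Left.nonneg_neg_iff]
  by_contra hmem
  have hpos : ∀ i : Fin (n + 2), 0 ≤ orient (p 0) (p i.succ) x := by
    intro i
    induction i using Fin.induction with
    | zero => simpa using hx 0
    | succ i ih => exact le_of_not_ge fun h => hmem (fan i ih h)
  refine hmem (fan (Fin.last n) (hpos _) ?_)
  have := hx (Fin.last (n + 2))
  rwa [Fin.last_add_one, ← orient_rotate, orient_swap, Left.nonneg_neg_iff] at this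

/-! ### Polyhedra given by inequalities -/

section Polyhedron

open Filter Topology

variable {ι E : Type*} [AddCommGroup E] [Module ℝ E] (s : ι → E →ᵃ[ℝ] ℝ)

theorem convex_setOf_forall_nonneg : Convex ℝ {x | ∀ i, 0 ≤ s i x} := by
  rw [Set.ofPred_forall]
  exact convex_iInter fun i => (convex_Ici (0 : ℝ)).affine_preimage (s i)

theorem mem_openSegment_lineMap {x y : E} {δ : ℝ} (hδ : 1 < δ) :
    x ∈ openSegment ℝ y (AffineMap.lineMap y x δ) := by
  have hδ0 : δ ≠ 0 := by positivity
  refine ⟨1 - δ⁻¹, δ⁻¹, by simp [inv_lt_one_of_one_lt₀ hδ], by positivity, by ring, ?_⟩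
  rw [AffineMap.lineMap_apply_module]
  match_scalars <;> field_simp
  ring

variable {s} [Finite ι]

theorem exists_one_lt_forall_lineMap_nonneg {x y : E} (hx : ∀ i, 0 ≤ s i x)
    (hxy : ∀ i, s i x = 0 → s i y = 0) :
    ∃ δ > (1 : ℝ), ∀ i, 0 ≤ s i (AffineMap.lineMap y x δ) := by
  have hev : ∀ᶠ δ in 𝓝[>] (1 : ℝ), ∀ i, 0 ≤ s i (AffineMap.lineMap y x δ) := by
    rw [eventually_all]
    intro i
    simp only [AffineMap.apply_lineMap]
    obtain h | h := (hx i).eq_or_lt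
    · simp [← h, hxy i h.symm]
    · have hlim : Tendsto (AffineMap.lineMap (s i y) (s i x)) (𝓝[>] (1 : ℝ)) (𝓝 (s i x)) :=
        (AffineMap.lineMap_continuous.tendsto' 1 _ (by simp)).mono_left nhdsWithin_le_nhds
      exact (hlim.eventually_const_lt h).mono fun _ => le_of_lt
  obtain ⟨δ, hδ, hδ1⟩ := (hev.and self_mem_nhdsWithin).exists
  exact ⟨δ, hδ1, hδ⟩

theorem finite_extremePoints_setOf_forall_nonneg :
    ({x | ∀ i, 0 ≤ s i x}.extremePoints ℝ).Finite := by
  refine .of_finite_image (f := fun x => {i | s i x = 0}) (Set.toFinite _) fun x hx y hy hxy => ?_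
  obtain ⟨δ, hδ, hmem⟩ :=
    exists_one_lt_forall_lineMap_nonneg hx.1 fun i => (Set.ext_iff.1 hxy i).1
  exact ((mem_extremePoints.1 hx).2 y hy.1 _ hmem (mem_openSegment_lineMap hδ)).1.symm

theorem exists_forall_eq_zero_imp_forall_eq_zero {F : Set E} (hF : Convex ℝ F)
    (hne : F.Nonempty) (hs : ∀ x ∈ F, ∀ i, 0 ≤ s i x) :
    ∃ f ∈ F, ∀ i, s i f = 0 → ∀ x ∈ F, s i x = 0 := by
  classical
  have := Fintype.ofFinite ι
  suffices ∀ I : Finset ι, ∃ f ∈ F, ∀ i ∈ I, s i f = 0 → ∀ x ∈ F, s i x = 0 by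
    simpa using this Finset.univ
  intro I
  induction I using Finset.induction_on with
  | empty => exact ⟨hne.some, hne.some_mem, by simp⟩
  | insert i I _ ih =>
    obtain ⟨f, hf, hfI⟩ := ih
    by_cases hi : ∀ x ∈ F, s i x = 0
    · exact ⟨f, hf, Finset.forall_mem_insert _ _ _ |>.2 ⟨fun _ => hi, hfI⟩⟩
    · push Not at hi
      obtain ⟨g, hg, hgi⟩ := hi
      have hmid : ∀ j, s j (midpoint ℝ f g) = 0 → s j f = 0 ∧ s j g = 0 := by
        intro j hj
        rw [AffineMap.map_midpoint, midpoint_eq_smul_add, smul_eq_zero_iff_right (by simp)] at hj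
        exact (add_eq_zero_iff_of_nonneg (hs f hf j) (hs g hg j)).1 hj
      refine ⟨midpoint ℝ f g, hF.midpoint_mem hf hg, ?_⟩
      rw [Finset.forall_mem_insert]
      exact ⟨fun h => absurd (hmid i h).2 hgi, fun j hj h => hfI j hj (hmid j h).1⟩

theorem exists_eq_zero_on_of_isExtreme {F : Set E} (hF : Convex ℝ F) (hne : F.Nonempty)
    (hext : IsExtreme ℝ {x | ∀ i, 0 ≤ s i x} F) (hproper : F ≠ {x | ∀ i, 0 ≤ s i x}) :
    ∃ i, (∀ x ∈ F, s i x = 0) ∧ ∃ x, (∀ j, 0 ≤ s j x) ∧ s i x ≠ 0 := by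
  obtain ⟨f, hf, hfF⟩ := exists_forall_eq_zero_imp_forall_eq_zero hF hne hext.subset
  obtain ⟨q, hq, hqF⟩ := Set.exists_of_ssubset (hext.subset.ssubset_of_ne hproper)
  by_contra! hcon
  obtain ⟨δ, hδ, hmem⟩ := exists_one_lt_forall_lineMap_nonneg (hext.subset hf)
    fun i hi => hcon i (hfF i hi) q hq
  exact hqF (hext.left_mem_of_mem_openSegment hq hmem hf (mem_openSegment_lineMap hδ))

end Polyhedron

theorem subset_of_isExposed_of_vectorSpan_le {E : Type*} [AddCommGroup E] [Module ℝ E]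
    [TopologicalSpace E] {F G Q : Set E} (hF : IsExposed ℝ Q F) (hne : F.Nonempty) (hFG : F ⊆ G)
    (hGQ : G ⊆ Q) (hspan : vectorSpan ℝ G ≤ vectorSpan ℝ F) : G ⊆ F := by
  obtain ⟨l, rfl⟩ := hF hne
  obtain ⟨f, hf⟩ := hne
  have hker : vectorSpan ℝ {x ∈ Q | ∀ y ∈ Q, l y ≤ l x} ≤ l.toLinearMap.ker := by
    rw [vectorSpan, Submodule.span_le]
    rintro _ ⟨x, hx, y, hy, rfl⟩
    simp [le_antisymm (hx.2 y hy.1) (hy.2 x hx.1)]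
  intro x hx
  have hlx : l x = l f := by
    simpa [sub_eq_zero] using hker (hspan (vsub_mem_vectorSpan ℝ hx (hFG hf)))
  exact ⟨hGQ hx, fun y hy => (hf.2 y hy).trans_eq hlx.symm⟩

theorem vectorSpan_lt_of_eq_zero {k E : Type*} [Field k] [AddCommGroup E] [Module k E]
    {G Q : Set E} {f : E →ᵃ[k] k} {x y : E} (hGQ : G ⊆ Q) (hG : ∀ x ∈ G, f x = 0) (hx : x ∈ G)
    (hy : y ∈ Q) (hfy : f y ≠ 0) : vectorSpan k G < vectorSpan k Q := by
  refine (vectorSpan_mono k hGQ).lt_of_ne fun h => hfy ?_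
  have hker : vectorSpan k G ≤ f.linear.ker := by
    rw [vectorSpan, Submodule.span_le]
    rintro _ ⟨u, hu, v, hv, rfl⟩
    rw [SetLike.mem_coe, LinearMap.mem_ker, AffineMap.linearMap_vsub, hG u hu, hG v hv, vsub_self]
  have hyx := hker (h ▸ vsub_mem_vectorSpan k hy (hGQ hx))
  rwa [LinearMap.mem_ker, AffineMap.linearMap_vsub, hG x hx, vsub_eq_sub, sub_zero] at hyx

section Facet

variable {ι : Type*} {n : ℕ} {Q F : Set (Fin n → ℝ)}

theorem IsFacet.ne (hF : IsFacet Q F) : F ≠ Q := by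
  rintro rfl
  exact absurd hF.2.2 (by simp)

theorem IsFacet.exists_eq_sep [Finite ι] {s : ι → (Fin n → ℝ) →ᵃ[ℝ] ℝ}
    (hF : IsFacet {x | ∀ i, 0 ≤ s i x} F) :
    ∃ i, F = {x | (∀ j, 0 ≤ s j x) ∧ s i x = 0} := by
  obtain ⟨hne, hexp, hrank⟩ := id hF
  have hFc : Convex ℝ F := hexp.convex (convex_setOf_forall_nonneg s)
  obtain ⟨i, hi, y, hy, hiy⟩ := exists_eq_zero_on_of_isExtreme hFc hne hexp.isExtreme hF.ne
  refine ⟨i, ?_⟩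
  set G := {x | (∀ j, 0 ≤ s j x) ∧ s i x = 0}
  have hFG : F ⊆ G := fun x hx => ⟨hexp.subset hx, hi x hx⟩
  have hGQ : G ⊆ {x | ∀ i, 0 ≤ s i x} := fun x hx => hx.1
  have hlt := Submodule.finrank_lt_finrank_of_lt
    (vectorSpan_lt_of_eq_zero hGQ (fun x hx => hx.2) (hFG hne.some_mem) hy hiy)
  have hspan : vectorSpan ℝ F = vectorSpan ℝ G :=
    Submodule.eq_of_le_of_finrank_le (vectorSpan_mono ℝ hFG) (by lia)
  exact hFG.antisymm (subset_of_isExposed_of_vectorSpan_le hexp hne hFG hGQ hspan.ge)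

theorem polytopeSize_setOf_forall_nonneg_le (s : ι → (Fin n → ℝ) →ᵃ[ℝ] ℝ) [Finite ι] :
    polytopeSize {x | ∀ i, 0 ≤ s i x} ≤ Nat.card ι := by
  have hsub : {F | IsFacet {x | ∀ i, 0 ≤ s i x} F} ⊆
      (fun i => {x | (∀ j, 0 ≤ s j x) ∧ s i x = 0}) '' (Set.univ : Set ι) := by
    intro F hF
    obtain ⟨i, hi⟩ := hF.exists_eq_sep
    exact ⟨i, trivial, hi.symm⟩
  calc
    polytopeSize {x | ∀ i, 0 ≤ s i x} ≤ _ := Set.encard_le_encard hsub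
    _ ≤ (Set.univ : Set ι).encard := Set.encard_image_le _ _
    _ = Nat.card ι := by rw [Set.encard_univ, ENat.card_eq_coe_natCard]

theorem isPolytope_setOf_forall_nonneg {s : ι → (Fin n → ℝ) →ᵃ[ℝ] ℝ} [Finite ι]
    (hb : Bornology.IsBounded {x | ∀ i, 0 ≤ s i x}) : IsPolytope {x | ∀ i, 0 ≤ s i x} := by
  have hclosed : IsClosed {x | ∀ i, 0 ≤ s i x} := by
    rw [Set.ofPred_forall]
    exact isClosed_iInter fun i => isClosed_Ici.preimage (s i).continuous_of_finiteDimensional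
  have hfin := finite_extremePoints_setOf_forall_nonneg (s := s)
  have hKM := closure_convexHull_extremePoints (Metric.isCompact_of_isClosed_isBounded hclosed hb)
    (convex_setOf_forall_nonneg s)
  rw [(hfin.isCompact_convexHull ℝ).isClosed.closure_eq] at hKM
  exact ⟨_, hfin, hKM.symm⟩

theorem IsPolytope.convex (hQ : IsPolytope Q) : Convex ℝ Q := by
  obtain ⟨S, -, rfl⟩ := hQ
  exact convex_convexHull ℝ S

theorem IsPolytope.isCompact (hQ : IsPolytope Q) : IsCompact Q := by
  obtain ⟨S, hS, rfl⟩ := hQ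
  exact hS.isCompact_convexHull ℝ

theorem IsPolytope.finite_vertices (hQ : IsPolytope Q) : (vertices Q).Finite := by
  obtain ⟨S, hS, rfl⟩ := hQ
  exact hS.subset extremePoints_convexHull_subset

theorem IsPolytope.convexHull_vertices (hQ : IsPolytope Q) : convexHull ℝ (vertices Q) = Q := by
  have hKM : closure (convexHull ℝ (vertices Q)) = Q :=
    closure_convexHull_extremePoints hQ.isCompact hQ.convex
  rwa [(hQ.finite_vertices.isCompact_convexHull ℝ).isClosed.closure_eq] at hKM

end Facet

/-! ### An extension with six facets -/

section Bracket

variable {n : ℕ}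

/-- The bracket `[i j k]` of three points of a configuration in the plane. -/
abbrev bracket (p : Fin n → Fin 2 → ℝ) (i j k : Fin n) : ℝ :=
  orient (p i) (p j) (p k)

theorem IsCounterclockwise.bracket_nonneg {p : Fin n → Fin 2 → ℝ} (hp : IsCounterclockwise p)
    {i j k : Fin n} (h : i ≤ j ∧ j ≤ k ∨ j ≤ k ∧ k ≤ i ∨ k ≤ i ∧ i ≤ j) :
    0 ≤ bracket p i j k := by
  have hle : ∀ {i j k}, i ≤ j → j ≤ k → 0 ≤ bracket p i j k := by
    intro i j k hij hjk
    rcases hij.eq_or_lt with rfl | hij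
    · simp
    rcases hjk.eq_or_lt with rfl | hjk
    · simp
    exact (hp hij hjk).le
  rcases h with h | h | h
  · exact hle h.1 h.2
  · rw [bracket, ← orient_rotate]
    exact hle h.1 h.2
  · rw [bracket, ← orient_rotate, ← orient_rotate]
    exact hle h.1 h.2

/-- The product of the brackets obtained from `[i j k]` by rotating the cyclic order. -/
noncomputable def cyclicProduct (p : Fin (n + 1) → Fin 2 → ℝ) (i j k : Fin (n + 1)) : ℝ :=
  ∏ s, bracket p (s + i) (s + j) (s + k)

variable {p : Fin (n + 1) → Fin 2 → ℝ} {i j k i' j' k' a b c a' b' c' : Fin (n + 1)}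

theorem cyclicProduct_rotate : cyclicProduct p j k i = cyclicProduct p i j k :=
  Finset.prod_congr rfl fun _ _ => orient_rotate _ _ _

theorem cyclicProduct_add (s : Fin (n + 1)) :
    cyclicProduct p (s + i) (s + j) (s + k) = cyclicProduct p i j k := by
  simp only [cyclicProduct, ← add_assoc]
  exact Fintype.prod_equiv (Equiv.addRight s) _ _ fun _ => rfl

theorem IsCounterclockwise.cyclicProduct_pos (hp : IsCounterclockwise p) (hij : i < j)
    (hjk : j < k) : 0 < cyclicProduct p i j k :=
  Finset.prod_pos fun s _ => hp.shift s hij hjk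

theorem IsCounterclockwise.cyclicProduct_mul_lt (hp : IsCounterclockwise p) (hij : i < j)
    (hjk : j < k) (hij' : i' < j') (hjk' : j' < k')
    (h : ∀ s, bracket p (s + i) (s + j) (s + k) * bracket p (s + i') (s + j') (s + k') <
      bracket p (s + a) (s + b) (s + c) * bracket p (s + a') (s + b') (s + c')) :
    cyclicProduct p i j k * cyclicProduct p i' j' k' <
      cyclicProduct p a b c * cyclicProduct p a' b' c' := by
  simp only [cyclicProduct, ← Finset.prod_mul_distrib]
  exact Finset.prod_lt_prod_of_nonempty
    (fun s _ => mul_pos (hp.shift s hij hjk) (hp.shift s hij' hjk')) (fun s _ => h s)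
    Finset.univ_nonempty

end Bracket

section HeptagonLift

variable {q : Fin 7 → Fin 2 → ℝ}

/-- The condition on a cyclic order of seven points under which `heptagonLift` is an extension of
their convex hull. -/
def IsLiftable (q : Fin 7 → Fin 2 → ℝ) : Prop :=
  bracket q 0 5 6 * bracket q 2 3 4 ≤ bracket q 0 2 6 * bracket q 3 4 5 ∧
    bracket q 0 1 2 * bracket q 3 4 5 ≤ bracket q 0 1 5 * bracket q 2 3 4

theorem IsCounterclockwise.bracket_mul_le_of_bracket_mul_lt (hq : IsCounterclockwise q)
    (h : bracket q 0 1 5 * bracket q 2 3 4 < bracket q 0 1 2 * bracket q 3 4 5) :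
    bracket q (4 + 0) (4 + 5) (4 + 6) * bracket q (4 + 2) (4 + 3) (4 + 4) ≤
      bracket q (4 + 0) (4 + 2) (4 + 6) * bracket q (4 + 3) (4 + 4) (4 + 5) := by
  suffices bracket q 2 3 4 * bracket q 0 1 6 ≤ bracket q 3 4 6 * bracket q 0 1 2 by
    convert! this using 2
    exacts [(orient_rotate _ _ _).symm, (orient_rotate _ _ _).symm, orient_rotate _ _ _]
  by_contra! h'
  have h012 : 0 < bracket q 0 1 2 := hq (by decide) (by decide)
  have h234 : 0 < bracket q 2 3 4 := hq (by decide) (by decide)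
  have h345 : 0 < bracket q 3 4 5 := hq (by decide) (by decide)
  have h016 : 0 < bracket q 0 1 6 := hq (by decide) (by decide)
  have h015 : 0 < bracket q 0 1 5 := hq (by decide) (by decide)
  have h045 : 0 < bracket q 0 4 5 := hq (by decide) (by decide)
  have h046 : 0 < bracket q 0 4 6 := hq (by decide) (by decide)
  have h346 : 0 < bracket q 3 4 6 := hq (by decide) (by decide)
  have h456 : 0 < bracket q 4 5 6 := hq (by decide) (by decide)
  have h034 : 0 < bracket q 0 3 4 := hq (by decide) (by decide)
  have h014 : 0 < bracket q 0 1 4 := hq (by decide) (by decide)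
  have h056 : 0 < bracket q 0 5 6 := hq (by decide) (by decide)
  have plücker₄ : bracket q 0 4 5 * bracket q 3 4 6 =
      bracket q 4 5 6 * bracket q 0 3 4 + bracket q 3 4 5 * bracket q 0 4 6 := by
    unfold bracket orient; ring
  have plücker₀ : bracket q 0 1 5 * bracket q 0 4 6 =
      bracket q 0 1 4 * bracket q 0 5 6 + bracket q 0 1 6 * bracket q 0 4 5 :=
    orient_mul_orient _ _ _ _ _
  have hlt₁ : bracket q 3 4 6 * bracket q 0 1 5 < bracket q 3 4 5 * bracket q 0 1 6 := by
    refine lt_of_mul_lt_mul_right (a := bracket q 0 1 2 * bracket q 2 3 4) ?_ (by positivity)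
    linarith [mul_lt_mul'' h' h (by positivity) (by positivity)]
  have hlt₂ : bracket q 3 4 5 * bracket q 0 1 6 < bracket q 3 4 6 * bracket q 0 1 5 := by
    refine lt_of_mul_lt_mul_right (a := bracket q 0 4 6 * bracket q 0 4 5) ?_ (by positivity)
    have h₄ : bracket q 3 4 5 * bracket q 0 4 6 < bracket q 0 4 5 * bracket q 3 4 6 := by
      rw [plücker₄]; exact lt_add_of_pos_left _ (by positivity)
    have h₀ : bracket q 0 1 6 * bracket q 0 4 5 < bracket q 0 1 5 * bracket q 0 4 6 := by
      rw [plücker₀]; exact lt_add_of_pos_left _ (by positivity)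
    linarith [mul_lt_mul'' h₄ h₀ (by positivity) (by positivity)]
  exact hlt₁.not_gt hlt₂

theorem cyclicProduct_234 : cyclicProduct q 2 3 4 = cyclicProduct q 0 1 2 :=
  cyclicProduct_add (i := 0) (j := 1) (k := 2) 2

theorem cyclicProduct_345 : cyclicProduct q 3 4 5 = cyclicProduct q 0 1 2 :=
  cyclicProduct_add (i := 0) (j := 1) (k := 2) 3

theorem cyclicProduct_056 : cyclicProduct q 0 5 6 = cyclicProduct q 0 1 2 :=
  (cyclicProduct_add (i := 2) (j := 0) (k := 1) 5).trans cyclicProduct_rotate.symm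

theorem cyclicProduct_025 : cyclicProduct q 0 2 5 = cyclicProduct q 0 2 4 :=
  (cyclicProduct_add (i := 2) (j := 4) (k := 0) 5).trans cyclicProduct_rotate

theorem cyclicProduct_035 : cyclicProduct q 0 3 5 = cyclicProduct q 0 2 4 :=
  (cyclicProduct_add (i := 4) (j := 0) (k := 2) 3).trans cyclicProduct_rotate.symm

theorem cyclicProduct_046 : cyclicProduct q 0 4 6 = cyclicProduct q 0 1 5 :=
  (cyclicProduct_add (i := 1) (j := 5) (k := 0) 6).trans cyclicProduct_rotate

theorem cyclicProduct_026 : cyclicProduct q 0 2 6 = cyclicProduct q 0 1 3 :=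
  (cyclicProduct_add (i := 1) (j := 3) (k := 0) 6).trans cyclicProduct_rotate

theorem IsCounterclockwise.exists_shift_bracket_mul_le_left (hq : IsCounterclockwise q) :
    ∃ s, bracket q (s + 0) (s + 5) (s + 6) * bracket q (s + 2) (s + 3) (s + 4) ≤
      bracket q (s + 0) (s + 2) (s + 6) * bracket q (s + 3) (s + 4) (s + 5) := by
  by_contra! hlt
  have h013 : cyclicProduct q 0 1 3 < cyclicProduct q 0 1 2 := by
    have := hq.cyclicProduct_mul_lt (by decide) (by decide) (by decide) (by decide) hlt
    rw [cyclicProduct_234, cyclicProduct_345, cyclicProduct_026, cyclicProduct_056] at this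
    exact lt_of_mul_lt_mul_right this (hq.cyclicProduct_pos (by decide) (by decide)).le
  have h012 : cyclicProduct q 0 1 2 < cyclicProduct q 0 1 3 := by
    have := hq.cyclicProduct_mul_lt (i := 0) (j := 1) (k := 2) (i' := 0) (j' := 3) (k' := 5)
      (a := 0) (b := 1) (c := 3) (a' := 0) (b' := 2) (c' := 5) (by decide) (by decide) (by decide)
      (by decide) fun s => by
        rw [bracket, bracket, bracket, bracket, orient_mul_orient _ (q (s + 2))]
        exact lt_add_of_pos_right _ (mul_pos (hq.shift s (by decide) (by decide))
          (hq.shift s (by decide) (by decide)))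
    rw [cyclicProduct_035, cyclicProduct_025] at this
    exact lt_of_mul_lt_mul_right this (hq.cyclicProduct_pos (by decide) (by decide)).le
  exact h013.not_gt h012

theorem IsCounterclockwise.exists_shift_bracket_mul_le_right (hq : IsCounterclockwise q) :
    ∃ s, bracket q (s + 0) (s + 1) (s + 2) * bracket q (s + 3) (s + 4) (s + 5) ≤
      bracket q (s + 0) (s + 1) (s + 5) * bracket q (s + 2) (s + 3) (s + 4) := by
  by_contra! hlt
  have h015 : cyclicProduct q 0 1 5 < cyclicProduct q 0 1 2 := by
    have := hq.cyclicProduct_mul_lt (by decide) (by decide) (by decide) (by decide) hlt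
    rw [cyclicProduct_234, cyclicProduct_345] at this
    exact lt_of_mul_lt_mul_right this (hq.cyclicProduct_pos (by decide) (by decide)).le
  have h012 : cyclicProduct q 0 1 2 < cyclicProduct q 0 1 5 := by
    have := hq.cyclicProduct_mul_lt (i := 0) (j := 5) (k := 6) (i' := 0) (j' := 2) (k' := 4)
      (a := 0) (b := 4) (c := 6) (a' := 0) (b' := 2) (c' := 5) (by decide) (by decide) (by decide)
      (by decide) fun s => by
        rw [mul_comm (bracket q _ (s + 4) _), bracket, bracket, bracket, bracket,
          orient_mul_orient _ (q (s + 4)), mul_comm]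
        exact lt_add_of_pos_right _ (mul_pos (hq.shift s (by decide) (by decide))
          (hq.shift s (by decide) (by decide)))
    rw [cyclicProduct_025, cyclicProduct_056, cyclicProduct_046] at this
    exact lt_of_mul_lt_mul_right this (hq.cyclicProduct_pos (by decide) (by decide)).le
  exact h015.not_gt h012

/-- If no rotation is liftable, then the second inequality fails for all seven rotations, because
its failure passes from a rotation by `s` to the rotation by `s + 4`. -/
theorem IsCounterclockwise.exists_shift_isLiftable (hq : IsCounterclockwise q) :
    ∃ s, IsLiftable fun i => q (s + i) := by
  by_contra! hnot
  have hright_of_left : ∀ s,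
      bracket q (s + 0) (s + 5) (s + 6) * bracket q (s + 2) (s + 3) (s + 4) ≤
        bracket q (s + 0) (s + 2) (s + 6) * bracket q (s + 3) (s + 4) (s + 5) →
      bracket q (s + 0) (s + 1) (s + 5) * bracket q (s + 2) (s + 3) (s + 4) <
        bracket q (s + 0) (s + 1) (s + 2) * bracket q (s + 3) (s + 4) (s + 5) :=
    fun s h => not_le.1 fun h' => hnot s ⟨h, h'⟩
  obtain ⟨s₀, hs₀⟩ := hq.exists_shift_bracket_mul_le_left
  have hwalk : ∀ n : ℕ, ∀ s, s = s₀ + n • 4 →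
      bracket q (s + 0) (s + 5) (s + 6) * bracket q (s + 2) (s + 3) (s + 4) ≤
        bracket q (s + 0) (s + 2) (s + 6) * bracket q (s + 3) (s + 4) (s + 5) := by
    intro n
    induction n with
    | zero => rintro s rfl; simpa using hs₀
    | succ n ih =>
      rintro s rfl
      rw [succ_nsmul, ← add_assoc]
      have h := (hq.shift _).bracket_mul_le_of_bracket_mul_lt (hright_of_left _ (ih _ rfl))
      simpa only [add_assoc] using h
  obtain ⟨s, hs⟩ := hq.exists_shift_bracket_mul_le_right
  have hmod : ∀ s s₀ : Fin 7, s = s₀ + ((s - s₀) * 2).val • 4 := by decide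
  exact (hright_of_left s (hwalk _ s (hmod s s₀))).not_ge hs

/-- The affine form `μ [a b ·] + ν h` on `ℝ² × ℝ`, where `h` is the last coordinate. -/
noncomputable def liftedForm (a b : Fin 2 → ℝ) (μ ν : ℝ) : (Fin (2 + 1) → ℝ) →ᵃ[ℝ] ℝ where
  toFun x := μ * orient a b (firstCoords 2 1 x) + ν * x 2
  linear := (μ * (b 0 - a 0)) • LinearMap.proj 1 - (μ * (b 1 - a 1)) • LinearMap.proj 0 +
    ν • LinearMap.proj 2
  map_vadd' x v := by
    have h₀ : Fin.castAdd 1 (0 : Fin 2) = 0 := rfl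
    have h₁ : Fin.castAdd 1 (1 : Fin 2) = 1 := rfl
    simp only [orient, firstCoords, h₀, h₁, vadd_eq_add, Pi.add_apply, LinearMap.add_apply,
      LinearMap.sub_apply, LinearMap.smul_apply, LinearMap.proj_apply, smul_eq_mul]
    ring

/-- The forms defining `heptagonLift`. -/
noncomputable def heptagonLiftForms (q : Fin 7 → Fin 2 → ℝ) :
    Fin 6 → (Fin (2 + 1) → ℝ) →ᵃ[ℝ] ℝ :=
  ![liftedForm (q 0) (q 0) 0 1,
    liftedForm (q 3) (q 4) 1 (-1),
    liftedForm (q 0) (q 1) (bracket q 2 3 4) (-bracket q 0 1 2),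
    liftedForm (q 6) (q 0) (bracket q 3 4 5) (-bracket q 0 5 6),
    liftedForm (q 1) (q 3) (bracket q 2 3 4) (bracket q 1 2 3),
    liftedForm (q 4) (q 6) (bracket q 3 4 5) (bracket q 4 5 6)]

/-- A polytope in `ℝ³` with six facets projecting onto a heptagon with liftable order: of its
vertices, `q 2` and `q 5` are lifted to height `[2 3 4]` and `[3 4 5]`, the other five stay at
height zero. -/
def heptagonLift (q : Fin 7 → Fin 2 → ℝ) : Set (Fin (2 + 1) → ℝ) :=
  {x | ∀ i, 0 ≤ heptagonLiftForms q i x}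

theorem mem_heptagonLift_iff {x : Fin (2 + 1) → ℝ} :
    x ∈ heptagonLift q ↔ 0 ≤ x 2 ∧
      x 2 ≤ orient (q 3) (q 4) (firstCoords 2 1 x) ∧
      bracket q 0 1 2 * x 2 ≤ bracket q 2 3 4 * orient (q 0) (q 1) (firstCoords 2 1 x) ∧
      bracket q 0 5 6 * x 2 ≤ bracket q 3 4 5 * orient (q 6) (q 0) (firstCoords 2 1 x) ∧
      0 ≤ bracket q 2 3 4 * orient (q 1) (q 3) (firstCoords 2 1 x) + bracket q 1 2 3 * x 2 ∧
      0 ≤ bracket q 3 4 5 * orient (q 4) (q 6) (firstCoords 2 1 x) + bracket q 4 5 6 * x 2 := by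
  have hform : ∀ a b μ ν, liftedForm a b μ ν x = μ * orient a b (firstCoords 2 1 x) + ν * x 2 :=
    fun _ _ _ _ => rfl
  simp only [heptagonLift, heptagonLiftForms, Set.mem_ofPred_eq, Fin.forall_fin_succ,
    Matrix.cons_val_zero, Matrix.cons_val_succ, hform, zero_mul, zero_add, one_mul, neg_mul,
    ← sub_eq_add_neg, sub_nonneg, IsEmpty.forall_iff, and_true]

theorem orient_mul_orient_next (a b c d x : Fin 2 → ℝ) :
    orient a b d * orient b c x = orient b c d * orient a b x + orient a b c * orient b d x := by
  unfold orient; ring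

theorem orient_mul_orient_prev (a b c d x : Fin 2 → ℝ) :
    orient a c d * orient b c x = orient a b c * orient c d x + orient b c d * orient a c x := by
  unfold orient; ring

theorem IsCounterclockwise.firstCoords_mem_convexHull (hq : IsCounterclockwise q)
    {x : Fin (2 + 1) → ℝ} (hx : x ∈ heptagonLift q) :
    firstCoords 2 1 x ∈ convexHull ℝ (Set.range q) := by
  obtain ⟨h0, h34, h01, h60, h13, h46⟩ := mem_heptagonLift_iff.1 hx
  set y := firstCoords 2 1 x
  have h012 : 0 < bracket q 0 1 2 := hq (by decide) (by decide)
  have h056 : 0 < bracket q 0 5 6 := hq (by decide) (by decide)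
  have h123 : 0 < bracket q 1 2 3 := hq (by decide) (by decide)
  have h234 : 0 < bracket q 2 3 4 := hq (by decide) (by decide)
  have h345 : 0 < bracket q 3 4 5 := hq (by decide) (by decide)
  have h456 : 0 < bracket q 4 5 6 := hq (by decide) (by decide)
  have h013 : 0 < bracket q 0 1 3 := hq (by decide) (by decide)
  have h134 : 0 < bracket q 1 3 4 := hq (by decide) (by decide)
  have h346 : 0 < bracket q 3 4 6 := hq (by decide) (by decide)
  have h046 : 0 < bracket q 0 4 6 := hq (by decide) (by decide)
  have e01 : 0 ≤ orient (q 0) (q 1) y :=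
    nonneg_of_mul_nonneg_right ((mul_nonneg h012.le h0).trans h01) h234
  have e12 : 0 ≤ orient (q 1) (q 2) y := by
    refine nonneg_of_mul_nonneg_right (a := bracket q 2 3 4 * bracket q 0 1 3) ?_ (by positivity)
    linear_combination bracket q 1 2 3 * h01 + bracket q 0 1 2 * h13 -
      bracket q 2 3 4 * orient_mul_orient_next (q 0) (q 1) (q 2) (q 3) y
  have e23 : 0 ≤ orient (q 2) (q 3) y := by
    refine nonneg_of_mul_nonneg_right ?_ h134
    linear_combination bracket q 1 2 3 * h34 + h13 -
      orient_mul_orient_prev (q 1) (q 2) (q 3) (q 4) y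
  have e45 : 0 ≤ orient (q 4) (q 5) y := by
    refine nonneg_of_mul_nonneg_right ?_ h346
    linear_combination bracket q 4 5 6 * h34 + h46 -
      orient_mul_orient_next (q 3) (q 4) (q 5) (q 6) y
  have e56 : 0 ≤ orient (q 5) (q 6) y := by
    have hplücker := orient_mul_orient_prev (q 4) (q 5) (q 6) (q 0) y
    rw [orient_rotate (q 0), orient_rotate (q 0)] at hplücker
    refine nonneg_of_mul_nonneg_right (a := bracket q 3 4 5 * bracket q 0 4 6) ?_ (by positivity)
    linear_combination bracket q 4 5 6 * h60 + bracket q 0 5 6 * h46 - bracket q 3 4 5 * hplücker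
  have e60 : 0 ≤ orient (q 6) (q 0) y :=
    nonneg_of_mul_nonneg_right ((mul_nonneg h056.le h0).trans h60) h345
  refine hq.mem_convexHull fun i => ?_
  fin_cases i
  exacts [e01, e12, e23, h0.trans h34, e45, e56, e60]

theorem mem_image_heptagonLift {y : Fin 2 → ℝ} {h : ℝ} (h0 : 0 ≤ h)
    (h34 : h ≤ orient (q 3) (q 4) y)
    (h01 : bracket q 0 1 2 * h ≤ bracket q 2 3 4 * orient (q 0) (q 1) y)
    (h60 : bracket q 0 5 6 * h ≤ bracket q 3 4 5 * orient (q 6) (q 0) y)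
    (h13 : 0 ≤ bracket q 2 3 4 * orient (q 1) (q 3) y + bracket q 1 2 3 * h)
    (h46 : 0 ≤ bracket q 3 4 5 * orient (q 4) (q 6) y + bracket q 4 5 6 * h) :
    y ∈ firstCoords 2 1 '' heptagonLift q := by
  have hy : firstCoords 2 1 ![y 0, y 1, h] = y := by
    ext l
    fin_cases l <;> rfl
  refine ⟨![y 0, y 1, h], ?_, hy⟩
  rw [mem_heptagonLift_iff, hy]
  exact ⟨h0, h34, h01, h60, h13, h46⟩

theorem IsCounterclockwise.mem_image_heptagonLift_of_ne (hq : IsCounterclockwise q) {i : Fin 7}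
    (hi₂ : i ≠ 2) (hi₅ : i ≠ 5) : q i ∈ firstCoords 2 1 '' heptagonLift q := by
  have h234 : 0 ≤ bracket q 2 3 4 := hq.bracket_nonneg (by decide)
  have h345 : 0 ≤ bracket q 3 4 5 := hq.bracket_nonneg (by decide)
  have h34 : 0 ≤ bracket q 3 4 i := hq.bracket_nonneg (by lia)
  have h01 : 0 ≤ bracket q 0 1 i := hq.bracket_nonneg (by lia)
  have h60 : 0 ≤ bracket q 6 0 i := hq.bracket_nonneg (by lia)
  have h13 : 0 ≤ bracket q 1 3 i := hq.bracket_nonneg (by lia)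
  have h46 : 0 ≤ bracket q 4 6 i := hq.bracket_nonneg (by lia)
  refine mem_image_heptagonLift le_rfl h34 ?_ ?_ ?_ ?_ <;> rw [mul_zero] <;> positivity

/-- The two inequalities defining `IsLiftable` say that the lifts of `q 2` and `q 5` satisfy
the inequalities for the edges `q 6 q 0` and `q 0 q 1`, respectively. -/
theorem IsCounterclockwise.mem_image_heptagonLift (hq : IsCounterclockwise q)
    (hlift : IsLiftable q) (i : Fin 7) : q i ∈ firstCoords 2 1 '' heptagonLift q := by
  by_cases hi₂ : i = 2
  · have h132 : orient (q 1) (q 3) (q 2) = -bracket q 1 2 3 := orient_swap _ _ _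
    have h234 : 0 ≤ bracket q 2 3 4 := hq.bracket_nonneg (by decide)
    have h345 : 0 ≤ bracket q 3 4 5 := hq.bracket_nonneg (by decide)
    have h462 : 0 ≤ bracket q 4 6 2 := hq.bracket_nonneg (by decide)
    have h456 : 0 ≤ bracket q 4 5 6 := hq.bracket_nonneg (by decide)
    subst hi₂
    refine _root_.mem_image_heptagonLift h234 (orient_rotate _ _ _).ge (mul_comm _ _).le ?_ ?_
      (by positivity)
    · rw [mul_comm (bracket q 3 4 5), ← orient_rotate]
      exact hlift.1
    · rw [h132]
      linarith
  by_cases hi₅ : i = 5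
  · have h465 : orient (q 4) (q 6) (q 5) = -bracket q 4 5 6 := orient_swap _ _ _
    have h345 : 0 ≤ bracket q 3 4 5 := hq.bracket_nonneg (by decide)
    have h234 : 0 ≤ bracket q 2 3 4 := hq.bracket_nonneg (by decide)
    have h135 : 0 ≤ bracket q 1 3 5 := hq.bracket_nonneg (by decide)
    have h123 : 0 ≤ bracket q 1 2 3 := hq.bracket_nonneg (by decide)
    subst hi₅
    refine _root_.mem_image_heptagonLift h345 le_rfl ?_ ?_ (by positivity) ?_
    · rw [mul_comm (bracket q 2 3 4)]
      exact hlift.2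
    · rw [mul_comm, ← orient_rotate]
    · rw [h465]
      linarith
  exact hq.mem_image_heptagonLift_of_ne hi₂ hi₅

theorem IsCounterclockwise.image_heptagonLift (hq : IsCounterclockwise q)
    (hlift : IsLiftable q) : firstCoords 2 1 '' heptagonLift q = convexHull ℝ (Set.range q) := by
  refine Set.Subset.antisymm (Set.image_subset_iff.2 fun x => hq.firstCoords_mem_convexHull) ?_
  have hlin : IsLinearMap ℝ (firstCoords 2 1) := ⟨fun _ _ => rfl, fun _ _ => rfl⟩
  exact convexHull_min (Set.range_subset_iff.2 (hq.mem_image_heptagonLift hlift))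
    ((convex_setOf_forall_nonneg _).is_linear_image hlin)

theorem IsCounterclockwise.isBounded_heptagonLift (hq : IsCounterclockwise q) :
    Bornology.IsBounded (heptagonLift q) := by
  have hcomp : IsCompact (convexHull ℝ (Set.range q)) := (Set.finite_range q).isCompact_convexHull ℝ
  have hcont : Continuous (orient (q 3) (q 4)) := by unfold orient; fun_prop
  obtain ⟨C, hC⟩ := hcomp.isBounded.exists_norm_le
  obtain ⟨D, hD⟩ := (hcomp.image hcont).bddAbove
  refine isBounded_iff_forall_norm_le.2 ⟨max C D, fun x hx => ?_⟩
  have hx' := mem_heptagonLift_iff.1 hx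
  have hy := hq.firstCoords_mem_convexHull hx
  have hcoord : ∀ l : Fin 2, ‖x (l.castAdd 1)‖ ≤ max C D := fun l =>
    (norm_le_pi_norm (firstCoords 2 1 x) l).trans ((hC _ hy).trans (le_max_left _ _))
  have hheight : ‖x 2‖ ≤ max C D := by
    rw [Real.norm_of_nonneg hx'.1]
    exact hx'.2.1.trans ((hD ⟨_, hy, rfl⟩).trans (le_max_right _ _))
  refine (pi_norm_le_iff_of_nonneg ((norm_nonneg _).trans hheight)).2 fun i => ?_
  fin_cases i
  exacts [hcoord 0, hcoord 1, hheight]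

end HeptagonLift

theorem IsConvexHeptagon.exists_extension_polytopeSize_le_six {P : Set (Fin 2 → ℝ)}
    (hP : IsConvexHeptagon P) :
    ∃ R : Set (Fin (2 + 1) → ℝ), IsExtension R P ∧ polytopeSize R ≤ 6 := by
  obtain ⟨p, hp, hccw⟩ := exists_isCounterclockwise hP.1.convex hP.2
  obtain ⟨s, hs⟩ := hccw.exists_shift_isLiftable
  have hrange : Set.range (fun i => p (s + i)) = vertices P :=
    ((Equiv.addLeft s).surjective.range_comp p).trans hp
  have hq := hccw.shift s
  refine ⟨heptagonLift fun i => p (s + i),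
    ⟨isPolytope_setOf_forall_nonneg hq.isBounded_heptagonLift, ?_⟩, ?_⟩
  · rw [hq.image_heptagonLift hs, hrange, hP.1.convexHull_vertices]
  · exact (polytopeSize_setOf_forall_nonneg_le _).trans (by simp)

/-! ### Facets cut out a polytope -/

theorem exists_forall_nonneg_add_mul {α : Type*} {V : Set α} (hV : V.Finite) {f g : α → ℝ}
    (hf : ∀ v ∈ V, 0 ≤ f v) (hg : ∃ v ∈ V, g v < 0) :
    ∃ r ≥ 0, (∀ v ∈ V, 0 ≤ f v + r * g v) ∧ ∃ w ∈ V, g w < 0 ∧ f w + r * g w = 0 := by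
  obtain ⟨w, ⟨hw, hgw⟩, hmin⟩ := Set.exists_min_image {v ∈ V | g v < 0} (fun v => f v / -g v)
    (hV.subset fun v hv => hv.1) hg
  have hr : 0 ≤ f w / -g w := div_nonneg (hf w hw) (by linarith)
  refine ⟨f w / -g w, hr, fun v hv => ?_, w, hw, hgw,
    by rw [div_neg, neg_mul, div_mul_cancel₀ _ hgw.ne, add_neg_cancel]⟩
  obtain hgv | hgv := lt_or_ge (g v) 0
  · have := (le_div_iff₀ (by linarith)).1 (hmin v ⟨hv, hgv⟩)
    linarith
  · exact add_nonneg (hf v hv) (mul_nonneg hr hgv)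

section AffineMap

variable {E : Type*} [AddCommGroup E]

theorem exists_affineMap_eq_zero_of_not_vectorSpan_le {k : Type*} [Field k] [Module k E]
    {S V : Set E} {t : E} (ht : t ∈ S) (hSV : ¬ vectorSpan k V ≤ vectorSpan k S) :
    ∃ g : E →ᵃ[k] k, (∀ x ∈ S, g x = 0) ∧ ∃ x ∈ V, g x ≠ 0 := by
  obtain ⟨u, huV, huS⟩ := SetLike.not_le_iff_exists.1 hSV
  obtain ⟨l, hlu, hlS⟩ := Submodule.exists_le_ker_of_notMem huS
  refine ⟨l.toAffineMap - AffineMap.const k E (l t), fun x hx => ?_, ?_⟩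
  · simpa using hlS (vsub_mem_vectorSpan k hx ht)
  · by_contra! h
    have hVl : vectorSpan k V ≤ l.ker := by
      rw [vectorSpan, Submodule.span_le]
      rintro _ ⟨x, hx, y, hy, rfl⟩
      simpa [sub_eq_zero] using (h x hx).trans (h y hy).symm
    exact hlu (hVl huV)

theorem vectorSpan_convexHull [Module ℝ E] (V : Set E) :
    vectorSpan ℝ (convexHull ℝ V) = vectorSpan ℝ V := by
  rw [← direction_affineSpan, affineSpan_convexHull, direction_affineSpan]

end AffineMap

-- Tilt a separating hyperplane about its contact points and `x` until it meets a further vertex.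
theorem exists_affineMap_separating_of_lt_finrank {E : Type*} [NormedAddCommGroup E]
    [NormedSpace ℝ E] [FiniteDimensional ℝ E] {V : Set E} (hV : V.Finite) (hne : V.Nonempty) {x : E}
    (hx : x ∉ convexHull ℝ V) {k : ℕ} (hk : k < Module.finrank ℝ (vectorSpan ℝ V)) :
    ∃ f : E →ᵃ[ℝ] ℝ, (∀ v ∈ V, 0 ≤ f v) ∧ f x < 0 ∧ {v ∈ V | f v = 0}.Nonempty ∧
      k ≤ Module.finrank ℝ (vectorSpan ℝ {v ∈ V | f v = 0}) := by
  induction k with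
  | zero =>
    obtain ⟨l, c, hl, hlx⟩ := geometric_hahn_banach_closed_point (convex_convexHull ℝ V)
      (hV.isCompact_convexHull ℝ).isClosed hx
    obtain ⟨v, hv, hmax⟩ := Set.exists_max_image V l hV hne
    have hvx : l v < l x := (hl v (subset_convexHull ℝ V hv)).trans hlx
    exact ⟨AffineMap.const ℝ E (l v) - l.toLinearMap.toAffineMap, by simpa using hmax,
      by simpa using hvx, ⟨v, hv, by simp⟩, Nat.zero_le _⟩
  | succ k ih =>
    obtain ⟨f, hf, hfx, ⟨t, ht⟩, hrank⟩ := ih (by lia)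
    set T := {v ∈ V | f v = 0}
    obtain hlt | hle := lt_or_ge k (Module.finrank ℝ (vectorSpan ℝ T))
    · exact ⟨f, hf, hfx, ⟨t, ht⟩, hlt⟩
    obtain ⟨g, hgT, hgx, hgV⟩ : ∃ g : E →ᵃ[ℝ] ℝ, (∀ v ∈ T, g v = 0) ∧ g x = 0 ∧
        ∃ v ∈ V, g v < 0 := by
      have hspan : ¬ vectorSpan ℝ V ≤ vectorSpan ℝ (insert x T) := fun h => by
        have := Submodule.finrank_mono h
        have := finrank_vectorSpan_insert_le_set ℝ T x
        lia
      obtain ⟨g, hg, v, hv, hgv⟩ :=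
        exists_affineMap_eq_zero_of_not_vectorSpan_le (Set.mem_insert_of_mem x ht) hspan
      rw [Set.forall_mem_insert] at hg
      obtain h | h := hgv.lt_or_gt
      · exact ⟨g, hg.2, hg.1, v, hv, h⟩
      · exact ⟨-g, fun v hv => by simp [hg.2 v hv], by simp [hg.1], v, hv, by simpa using h⟩
    obtain ⟨r, -, hr, w, hw, hgw, hrw⟩ := exists_forall_nonneg_add_mul hV hf hgV
    have hsub : T ⊆ {v ∈ V | (f + r • g) v = 0} := fun v hv => ⟨hv.1, by simp [hv.2, hgT v hv]⟩
    have hlt := Submodule.finrank_lt_finrank_of_lt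
      (vectorSpan_lt_of_eq_zero hsub hgT ht ⟨hw, by simpa using hrw⟩ hgw.ne)
    exact ⟨f + r • g, by simpa using hr, by simpa [hgx] using hfx, ⟨w, hw, by simpa using hrw⟩,
      by lia⟩

section Facet

variable {n : ℕ} {Q F : Set (Fin n → ℝ)}

theorem isExposed_setOf_eq_zero {f : (Fin n → ℝ) →ᵃ[ℝ] ℝ} (hf : ∀ y ∈ Q, 0 ≤ f y) :
    IsExposed ℝ Q {y ∈ Q | f y = 0} := by
  rintro ⟨t, htQ, ht⟩
  have hl : ∀ y, f.linear y = f y - f 0 := congrFun f.decomp'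
  refine ⟨-f.linear.toContinuousLinearMap, Set.ext fun y => and_congr_right fun hy => ?_⟩
  simp only [neg_apply, LinearMap.coe_toContinuousLinearMap', neg_le_neg_iff, hl,
    sub_le_sub_iff_right]
  exact ⟨fun h z hz => h ▸ hf z hz, fun h => (ht ▸ h t htQ).antisymm (hf y hy)⟩

theorem IsFacet.exists_affineMap (hF : IsFacet Q F) :
    ∃ s : (Fin n → ℝ) →ᵃ[ℝ] ℝ, (∀ y ∈ Q, 0 ≤ s y) ∧ F = {y ∈ Q | s y = 0} := by
  obtain ⟨l, rfl⟩ := hF.2.1 hF.1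
  obtain ⟨t, ht⟩ := hF.1
  refine ⟨AffineMap.const ℝ _ (l t) - l.toLinearMap.toAffineMap, fun y hy => by
    simpa using ht.2 y hy, Set.ext fun y => and_congr_right fun hy => ?_⟩
  change _ ↔ l t - l y = 0
  rw [sub_eq_zero]
  exact ⟨fun h => (h t ht.1).antisymm (ht.2 y hy), fun h => h ▸ ht.2⟩

theorem IsPolytope.exists_isFacet_of_notMem (hQ : IsPolytope Q) {x : Fin n → ℝ} (hx : x ∉ Q)
    (hxQ : x ∈ affineSpan ℝ Q) :
    ∃ f : (Fin n → ℝ) →ᵃ[ℝ] ℝ, (∀ y ∈ Q, 0 ≤ f y) ∧ f x < 0 ∧ IsFacet Q {y ∈ Q | f y = 0} := by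
  have hneQ : Q.Nonempty := (affineSpan_nonempty ℝ).1 ⟨x, hxQ⟩
  obtain ⟨V, hV, hQV⟩ := hQ
  have hspan : vectorSpan ℝ Q = vectorSpan ℝ V := by rw [hQV, vectorSpan_convexHull]
  have hVQ : V ⊆ Q := hQV ▸ subset_convexHull ℝ V
  have hd : 0 < Module.finrank ℝ (vectorSpan ℝ V) := by
    rw [← hspan, Nat.pos_iff_ne_zero, Ne, Submodule.finrank_eq_zero]
    intro h
    obtain ⟨y, hy⟩ := hneQ
    have hxy := AffineSubspace.vsub_mem_direction hxQ (subset_affineSpan ℝ Q hy)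
    rw [direction_affineSpan, h, Submodule.mem_bot, vsub_eq_zero_iff_eq] at hxy
    exact hx (hxy ▸ hy)
  obtain ⟨f, hf, hfx, ⟨t, ht⟩, hrank⟩ := exists_affineMap_separating_of_lt_finrank hV
    (convexHull_nonempty_iff.1 (hQV ▸ hneQ)) (hQV ▸ hx) (Nat.sub_lt hd one_pos)
  have hfQ : ∀ y ∈ Q, 0 ≤ f y := by
    rw [hQV]
    exact convexHull_min (t := {y | 0 ≤ f y}) hf ((convex_Ici (0 : ℝ)).affine_preimage f)
  obtain ⟨y, hy, hfy⟩ : ∃ y ∈ Q, f y ≠ 0 := by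
    by_contra! h
    exact hfx.ne (AffineMap.eqOn_affineSpan (f := f) (g := AffineMap.const ℝ _ 0) h hxQ)
  have hle := Submodule.finrank_mono
    (vectorSpan_mono ℝ fun v hv => ⟨hVQ hv.1, hv.2⟩ :
      vectorSpan ℝ {v ∈ V | f v = 0} ≤ vectorSpan ℝ {y ∈ Q | f y = 0})
  have hlt := Submodule.finrank_lt_finrank_of_lt
    (vectorSpan_lt_of_eq_zero (Set.sep_subset Q _) (fun v hv => hv.2) ⟨hVQ ht.1, ht.2⟩ hy hfy)
  rw [← hspan] at hrank hd
  exact ⟨f, hfQ, hfx, ⟨t, hVQ ht.1, ht.2⟩, isExposed_setOf_eq_zero hfQ, by lia⟩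

theorem IsFacet.eqOn_zero (hF : IsFacet Q F) {g : (Fin n → ℝ) →ᵃ[ℝ] ℝ} (hg : ∀ x ∈ F, g x = 0)
    {y : Fin n → ℝ} (hy : y ∈ Q) (hyF : y ∉ F) (hgy : g y = 0) : ∀ x ∈ Q, g x = 0 := by
  by_contra! h
  obtain ⟨z, hz, hgz⟩ := h
  obtain ⟨s, -, hs⟩ := hF.exists_affineMap
  obtain ⟨t, ht⟩ := hF.1
  have hsF : ∀ x ∈ F, s x = 0 := fun x hx => (hs ▸ hx).2
  have hsy : s y ≠ 0 := fun h => hyF (hs ▸ ⟨hy, h⟩)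
  have htg : t ∈ {x ∈ Q | g x = 0} := ⟨hF.2.1.subset ht, hg t ht⟩
  have hlt₁ := Submodule.finrank_lt_finrank_of_lt
    (vectorSpan_lt_of_eq_zero (Q := {x ∈ Q | g x = 0})
      (fun x hx => ⟨hF.2.1.subset hx, hg x hx⟩) hsF ht ⟨hy, hgy⟩ hsy)
  have hlt₂ := Submodule.finrank_lt_finrank_of_lt
    (vectorSpan_lt_of_eq_zero (Set.sep_subset Q _) (fun x hx => hx.2) htg hz hgz)
  have := hF.2.2
  lia

theorem IsPolytope.exists_mem_iff (hQ : IsPolytope Q) :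
    ∃ s : {F // IsFacet Q F} → (Fin n → ℝ) →ᵃ[ℝ] ℝ,
      ∀ x, x ∈ Q ↔ x ∈ affineSpan ℝ Q ∧ ∀ F, 0 ≤ s F x := by
  choose s hs hsF using fun F : {F // IsFacet Q F} => F.2.exists_affineMap
  refine ⟨s, fun x => ⟨fun hx => ⟨subset_affineSpan ℝ Q hx, fun F => hs F x hx⟩, ?_⟩⟩
  rintro ⟨hxQ, hx⟩
  by_contra hnot
  obtain ⟨f, hf, hfx, hfac⟩ := hQ.exists_isFacet_of_notMem hnot hxQ
  set F : {F // IsFacet Q F} := ⟨_, hfac⟩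
  obtain ⟨y, hy, hyF⟩ := Set.exists_of_ssubset (F.2.2.1.subset.ssubset_of_ne F.2.ne)
  have hfy : 0 < f y := (hf y hy).lt_of_ne fun h => hyF ⟨hy, h.symm⟩
  have hsy : 0 < s F y := (hs F y hy).lt_of_ne fun h => hyF (hsF F ▸ ⟨hy, h.symm⟩)
  have hprop : ∀ z ∈ Q, (f y • s F - s F y • f) z = 0 := by
    refine F.2.eqOn_zero (fun z hz => ?_) hy hyF (by simp [mul_comm])
    have hsz : s F z = 0 := (hsF F ▸ hz : z ∈ {y ∈ Q | s F y = 0}).2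
    simp [hsz, hz.2]
  have hpropx : (f y • s F - s F y • f) x = 0 :=
    AffineMap.eqOn_affineSpan (g := AffineMap.const ℝ _ 0) hprop hxQ
  have heq : f y * s F x = s F y * f x := by simpa [sub_eq_zero] using hpropx
  exact absurd (heq ▸ mul_nonneg hfy.le (hx F)) (mul_neg_of_pos_of_neg hsy hfx).not_ge

end Facet

/-! ### Lifting the cone over a polytope -/

/-- The nonnegative part of the subspace `K` is mapped by `π` onto the cone over `P`, that is, the
cone spanned by `P × {1}`, and only the origin is mapped to the origin. -/
structure IsConeLift {ι F : Type*} [AddCommGroup F] [Module ℝ F] (P : Set F)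
    (K : Submodule ℝ (ι → ℝ)) (π : (ι → ℝ) →ₗ[ℝ] F × ℝ) : Prop where
  cone : ∀ s ∈ K, 0 ≤ s → s ≠ 0 → ∃ c : ℝ, 0 < c ∧ ∃ p ∈ P, π s = c • (p, (1 : ℝ))
  lift : ∀ p ∈ P, ∃ s ∈ K, 0 ≤ s ∧ π s = (p, 1)

/-- The vector `s` spans an extreme ray of the nonnegative part of `K`. Extremality is encoded
through supports: every vector of `K` vanishing wherever `s` does is a multiple of `s`. -/
structure IsExtremeRay {ι : Type*} (K : Submodule ℝ (ι → ℝ)) (s : ι → ℝ) : Prop where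
  mem : s ∈ K
  nonneg : 0 ≤ s
  ne_zero : s ≠ 0
  eq_smul : ∀ u ∈ K, (∀ i, s i = 0 → u i = 0) → ∃ c : ℝ, u = c • s

/-- Every extreme ray of the nonnegative part of `K` lies over a vertex of `P`. For the subspace
presenting an extension of `P`, this says that all its vertices are projected onto vertices. -/
def NoHiddenRay {ι F : Type*} [AddCommGroup F] [Module ℝ F] (P : Set F)
    (K : Submodule ℝ (ι → ℝ)) (π : (ι → ℝ) →ₗ[ℝ] F × ℝ) : Prop :=
  ∀ s, IsExtremeRay K s → ∃ c : ℝ, 0 < c ∧ ∃ v ∈ P.extremePoints ℝ, π s = c • (v, (1 : ℝ))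

/-- The linear map on `V × k` extending an affine map `A` on the slice `V × {1}`. -/
def homogenization {k V W : Type*} [CommRing k] [AddCommGroup V] [Module k V] [AddCommGroup W]
    [Module k W] (A : V →ᵃ[k] W) : V × k →ₗ[k] W :=
  A.linear.coprod (LinearMap.toSpanSingleton k W (A 0))

theorem homogenization_smul {k V W : Type*} [CommRing k] [AddCommGroup V] [Module k V]
    [AddCommGroup W] [Module k W] (A : V →ᵃ[k] W) (x : V) (t : k) :
    homogenization A (t • x, t) = t • A x := by
  have hA : A x = A.linear x + A 0 := congrFun A.decomp x
  simp [homogenization, hA]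

section BoundedPolyhedron

variable {ι V F : Type*} [NormedAddCommGroup V] [NormedSpace ℝ V] [AddCommGroup F] [Module ℝ F]
  {s : V →ᵃ[ℝ] ι → ℝ}

theorem eq_zero_of_linear_nonneg (hb : Bornology.IsBounded {x | 0 ≤ s x}) {q u : V} (hq : 0 ≤ s q)
    (hu : 0 ≤ s.linear u) : u = 0 := by
  by_contra hu0
  obtain ⟨C, hC⟩ := hb.exists_norm_le
  have hC0 : 0 ≤ C := (norm_nonneg q).trans (hC q hq)
  set r : ℝ := (C + ‖q‖ + 1) / ‖u‖
  have hr : 0 ≤ r := by positivity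
  have hray : 0 ≤ s (r • u + q) := by
    have h : s (r • u + q) = r • s.linear u + s q := by simpa using s.map_vadd q (r • u)
    exact h ▸ add_nonneg (smul_nonneg hr hu) hq
  have hnorm : ‖r • u‖ = C + ‖q‖ + 1 := by
    rw [norm_smul, Real.norm_of_nonneg hr, div_mul_cancel₀ _ (norm_ne_zero_iff.2 hu0)]
  have htri : ‖r • u‖ ≤ ‖r • u + q‖ + ‖q‖ := by simpa using norm_sub_le (r • u + q) q
  linarith [hC _ hray]

theorem exists_eq_smul_of_homogenization_nonneg (hb : Bornology.IsBounded {x | 0 ≤ s x})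
    (hnt : {x | 0 ≤ s x}.Nontrivial) {z : V × ℝ} (hz : 0 ≤ homogenization s z) (hz0 : z ≠ 0) :
    ∃ t > 0, ∃ x, 0 ≤ s x ∧ z = (t • x, t) := by
  obtain ⟨u, t⟩ := z
  have ht : 0 < t := by
    by_contra! ht
    have hu : ∀ q, 0 ≤ s q → u = t • q := fun q hq => by
      refine sub_eq_zero.1 (eq_zero_of_linear_nonneg hb hq ?_)
      have h : s.linear (u - t • q) = homogenization s (u, t) - homogenization s (t • q, t) := by
        rw [← map_sub]
        simp [homogenization]
      rw [h, homogenization_smul, sub_nonneg]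
      exact (smul_nonpos_of_nonpos_of_nonneg ht hq).trans hz
    obtain ⟨q, hq, q', hq', hqq'⟩ := hnt
    have ht0 : t = 0 := by
      by_contra ht0
      exact hqq' (smul_right_injective V ht0 ((hu q hq).symm.trans (hu q' hq')))
    exact hz0 (by simp [hu q hq, ht0])
  have hut : u = t • t⁻¹ • u := by rw [smul_inv_smul₀ ht.ne']
  rw [hut, homogenization_smul] at hz
  exact ⟨t, ht, t⁻¹ • u, (smul_nonneg_iff_nonneg_of_pos_left ht).1 hz, by rw [← hut]⟩

theorem homogenization_injective (hb : Bornology.IsBounded {x | 0 ≤ s x})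
    (hnt : {x | 0 ≤ s x}.Nontrivial) : Function.Injective (homogenization s) := by
  refine (injective_iff_map_eq_zero _).2 fun z hz => ?_
  by_contra hz0
  obtain ⟨t, ht, x, -, rfl⟩ := exists_eq_smul_of_homogenization_nonneg hb hnt hz.ge hz0
  obtain ⟨t', ht', x', -, h⟩ := exists_eq_smul_of_homogenization_nonneg hb hnt
    (by rw [map_neg, hz, neg_zero]) (neg_ne_zero.2 hz0)
  have : -t = t' := congrArg Prod.snd h
  linarith

theorem IsExtremeRay.exists_mem_extremePoints (hb : Bornology.IsBounded {x | 0 ≤ s x})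
    (hnt : {x | 0 ≤ s x}.Nontrivial) {z : V × ℝ}
    (hz : IsExtremeRay (LinearMap.range (homogenization s)) (homogenization s z)) :
    ∃ t > 0, ∃ x ∈ {x | 0 ≤ s x}.extremePoints ℝ, z = (t • x, t) := by
  obtain ⟨t, ht, x, hx, rfl⟩ := exists_eq_smul_of_homogenization_nonneg hb hnt hz.nonneg
    (by rintro rfl; exact hz.ne_zero (map_zero _))
  refine ⟨t, ht, x, ⟨hx, fun y hy w hw hxyw => ?_⟩, rfl⟩
  have hsupp : ∀ i, s x i = 0 → s y i = 0 := fun i hi => by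
    obtain ⟨a, b, ha, hb, -, hab⟩ : s x ∈ openSegment ℝ (s y) (s w) :=
      image_openSegment ℝ s y w ▸ Set.mem_image_of_mem s hxyw
    have habi : a * s y i + b * s w i = 0 := by simpa [hi] using congrFun hab i
    have hyi : 0 ≤ a * s y i := mul_nonneg ha.le (hy i)
    have hwi : 0 ≤ b * s w i := mul_nonneg hb.le (hw i)
    exact (mul_eq_zero.1 (by linarith : a * s y i = 0)).resolve_left ha.ne'
  obtain ⟨a, ha⟩ := hz.eq_smul (homogenization s ((1 : ℝ) • y, 1)) ⟨_, rfl⟩ fun i hi => by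
    rw [homogenization_smul, Pi.smul_apply, smul_eq_mul] at hi
    rw [homogenization_smul, one_smul, hsupp i ((mul_eq_zero.1 hi).resolve_left ht.ne')]
  rw [← map_smul] at ha
  obtain ⟨h1, h2⟩ := Prod.ext_iff.1 (homogenization_injective hb hnt ha)
  simp only [Prod.smul_fst, Prod.smul_snd, smul_eq_mul, one_smul] at h1 h2
  rw [h1, smul_smul, ← h2, one_smul]

theorem exists_isConeLift_of_isBounded (hb : Bornology.IsBounded {x | 0 ≤ s x})
    (hnt : {x | 0 ≤ s x}.Nontrivial) {P : Set F} {f : V →ᵃ[ℝ] F} (hP : f '' {x | 0 ≤ s x} = P) :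
    ∃ (K : Submodule ℝ (ι → ℝ)) (π : (ι → ℝ) →ₗ[ℝ] F × ℝ), IsConeLift P K π ∧
      ((∀ x ∈ {x | 0 ≤ s x}.extremePoints ℝ, f x ∈ P.extremePoints ℝ) → NoHiddenRay P K π) := by
  obtain ⟨ρ, hρ⟩ := LinearMap.exists_leftInverse_of_injective (homogenization s)
    (LinearMap.ker_eq_bot.2 (homogenization_injective hb hnt))
  set π := homogenization (f.prod (AffineMap.const ℝ V (1 : ℝ))) ∘ₗ ρ
  have hπ : ∀ x t, π (homogenization s (t • x, t)) = t • (f x, (1 : ℝ)) := fun x t => by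
    have hρx : ρ (homogenization s (t • x, t)) = (t • x, t) := LinearMap.congr_fun hρ _
    rw [LinearMap.comp_apply, hρx, homogenization_smul]
    rfl
  refine ⟨LinearMap.range (homogenization s), π, ⟨?_, fun p hp => ?_⟩, ?_⟩
  · rintro _ ⟨z, rfl⟩ hz hz0
    obtain ⟨t, ht, x, hx, rfl⟩ := exists_eq_smul_of_homogenization_nonneg hb hnt hz
      (by rintro rfl; exact hz0 (map_zero _))
    exact ⟨t, ht, f x, hP ▸ ⟨x, hx, rfl⟩, hπ x t⟩
  · obtain ⟨x, hx, rfl⟩ := hP ▸ hp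
    exact ⟨_, ⟨((1 : ℝ) • x, 1), rfl⟩, by rwa [homogenization_smul, one_smul],
      by rw [hπ, one_smul]⟩
  · rintro hf _ hs
    obtain ⟨z, rfl⟩ := hs.mem
    obtain ⟨t, ht, x, hx, rfl⟩ := hs.exists_mem_extremePoints hb hnt
    exact ⟨t, ht, f x, hf x hx, hπ x t⟩

end BoundedPolyhedron

theorem map_mem_extremePoints_of_injective {E F : Type*} [AddCommGroup E] [Module ℝ E]
    [AddCommGroup F] [Module ℝ F] {j : E →ᵃ[ℝ] F} (hj : Function.Injective j) {D : Set E}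
    {Q : Set F} (hD : j '' D = Q) {x : E} (hx : x ∈ D.extremePoints ℝ) :
    j x ∈ Q.extremePoints ℝ := by
  subst hD
  refine ⟨Set.mem_image_of_mem j hx.1, ?_⟩
  rintro _ ⟨y, hy, rfl⟩ _ ⟨z, hz, rfl⟩ h
  rw [← image_openSegment, hj.mem_set_image] at h
  rw [hx.2 hy hz h]

theorem IsExtension.exists_isConeLift {d k : ℕ} {P : Set (Fin d → ℝ)}
    {Q : Set (Fin (d + k) → ℝ)} (hQ : IsExtension Q P) (hP : P.Nontrivial) :
    ∃ (K : Submodule ℝ ({F // IsFacet Q F} → ℝ))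
      (π : ({F // IsFacet Q F} → ℝ) →ₗ[ℝ] (Fin d → ℝ) × ℝ), IsConeLift P K π ∧
      ((∀ w ∈ vertices Q, firstCoords d k w ∈ vertices P) → NoHiddenRay P K π) := by
  obtain ⟨hQ, rfl⟩ := hQ
  obtain ⟨s, hs⟩ := hQ.exists_mem_iff
  obtain ⟨q, hq⟩ : Q.Nonempty := hP.nonempty.of_image
  set j : vectorSpan ℝ Q →ᵃ[ℝ] (Fin (d + k) → ℝ) :=
    (vectorSpan ℝ Q).subtype.toAffineMap + AffineMap.const ℝ _ q
  have hj : Isometry j := fun x y => by simp [j, Subtype.edist_eq]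
  set S := (AffineMap.pi s).comp j
  have hjS : j '' {x | 0 ≤ S x} = Q := by
    refine subset_antisymm (Set.image_subset_iff.2 fun x hx => ?_) fun x hx => ?_
    · exact (hs _).2 ⟨vadd_mem_affineSpan_of_mem_affineSpan_of_mem_vectorSpan
        (subset_affineSpan ℝ Q hq) x.2, hx⟩
    · have hjx : j ⟨x - q, vsub_mem_vectorSpan ℝ hx hq⟩ = x := by simp [j]
      exact ⟨_, fun F => (((hs x).1 hx).2 F).trans_eq (congrArg (s F) hjx).symm, hjx⟩
  have hb : Bornology.IsBounded {x | 0 ≤ S x} :=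
    hj.antilipschitz.isBounded_preimage hQ.isCompact.isBounded |>.subset
      (Set.image_subset_iff.1 hjS.subset)
  have hf : ((LinearMap.funLeft ℝ ℝ (Fin.castAdd k)).toAffineMap.comp j) '' {x | 0 ≤ S x} =
      firstCoords d k '' Q :=
    (Set.image_comp (firstCoords d k) j _).trans (congrArg _ hjS)
  obtain ⟨K, π, hK, hidden⟩ :=
    exists_isConeLift_of_isBounded hb (Set.nontrivial_of_image _ _ (hf ▸ hP)) hf
  exact ⟨K, π, hK, fun hvert => hidden fun x hx =>
    hvert (j x) (map_mem_extremePoints_of_injective hj.injective hjS hx)⟩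

theorem exists_pos_smul_le {ι : Type*} [Finite ι] {s s' : ι → ℝ} (hs : 0 ≤ s)
    (h : ∀ i, s i = 0 → s' i = 0) : ∃ ε : ℝ, 0 < ε ∧ ε • s' ≤ s := by
  obtain ⟨δ, hδ, hpos⟩ := exists_one_lt_forall_lineMap_nonneg
    (s := fun i => (LinearMap.proj (R := ℝ) (φ := fun _ : ι => ℝ) i).toAffineMap) hs h
  have hδ0 : 0 < δ := one_pos.trans hδ
  refine ⟨(δ - 1) / δ, div_pos (sub_pos.2 hδ) hδ0, fun i => ?_⟩
  have := hpos i
  simp only [AffineMap.lineMap_apply_module, LinearMap.coe_toAffineMap, LinearMap.coe_proj,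
    Function.eval, Pi.add_apply, Pi.smul_apply, smul_eq_mul] at this ⊢
  rw [div_mul_eq_mul_div, div_le_iff₀ hδ0]
  linarith

section ConeLift

variable {ι F : Type*} [AddCommGroup F] [Module ℝ F] {P : Set F} {K : Submodule ℝ (ι → ℝ)}
  {π : (ι → ℝ) →ₗ[ℝ] F × ℝ} {s s' : ι → ℝ} {v v' : F} {c c' : ℝ}

theorem eq_of_mem_extremePoints_of_combination {p q : F} {a b : ℝ} (hv : v ∈ P.extremePoints ℝ)
    (hp : p ∈ P) (hq : q ∈ P) (ha : 0 < a) (hb : 0 < b)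
    (h : a • (p, (1 : ℝ)) + b • (q, (1 : ℝ)) = c • (v, (1 : ℝ))) : p = v := by
  obtain ⟨h1, h2⟩ := Prod.ext_iff.1 h
  simp only [Prod.fst_add, Prod.snd_add, Prod.smul_fst, Prod.smul_snd, smul_eq_mul,
    mul_one] at h1 h2
  have hc : 0 < c := h2 ▸ add_pos ha hb
  refine hv.2 hp hq ⟨a / c, b / c, by positivity, by positivity, by field_simp; exact h2, ?_⟩
  rw [div_eq_inv_mul, div_eq_inv_mul, mul_smul, mul_smul, ← smul_add, h1, inv_smul_smul₀ hc.ne']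

theorem IsConeLift.eq_smul_of_support_subset [Finite ι] (hK : IsConeLift P K π)
    (hv : v ∈ P.extremePoints ℝ) (hs : s ∈ K) (hs0 : 0 ≤ s) (hπ : π s = c • (v, (1 : ℝ)))
    (hs' : s' ∈ K) (hs'0 : 0 ≤ s') (hne : s' ≠ 0) (hsub : ∀ i, s i = 0 → s' i = 0) :
    ∃ d : ℝ, 0 < d ∧ π s' = d • (v, (1 : ℝ)) := by
  obtain ⟨ε, hε, hle⟩ := exists_pos_smul_le hs0 hsub
  obtain ⟨d, hd, p, hp, hdp⟩ := hK.cone s' hs' hs'0 hne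
  refine ⟨d, hd, ?_⟩
  suffices p = v by rw [hdp, this]
  have hmem : 2 • s - ε • s' ∈ K := K.sub_mem (K.smul_of_tower_mem 2 hs) (K.smul_mem _ hs')
  have hge : s ≤ 2 • s - ε • s' := by
    rw [two_smul, add_sub_assoc]
    exact le_add_of_nonneg_right (sub_nonneg.2 hle)
  have hne2 : 2 • s - ε • s' ≠ 0 := fun h => by
    have hs : s = 0 := le_antisymm (h ▸ hge) hs0
    exact hne (funext fun i => hsub i (congrFun hs i))
  obtain ⟨a, ha, q, hq, haq⟩ := hK.cone _ hmem (hs0.trans hge) hne2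
  refine eq_of_mem_extremePoints_of_combination (c := 2 * c) hv hp hq (mul_pos hε hd) ha ?_
  rw [mul_smul, mul_smul, ← hdp, ← haq, ← hπ, ← map_smul, ← map_smul, ← map_add]
  congr 1
  module

theorem IsConeLift.exists_isExtremeRay [Finite ι] (hK : IsConeLift P K π)
    (hv : v ∈ P.extremePoints ℝ) : ∃ s, IsExtremeRay K s ∧ π s = (v, 1) := by
  obtain ⟨s, ⟨hs, hs0, hπ⟩, hmin⟩ := exists_minimalFor_of_wellFoundedLT
    (fun s => s ∈ K ∧ 0 ≤ s ∧ π s = (v, 1)) Function.support (hK.lift v hv.1)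
  have hne : s ≠ 0 := by
    rintro rfl
    exact zero_ne_one (congrArg Prod.snd ((map_zero π).symm.trans hπ))
  refine ⟨s, ⟨hs, hs0, hne, fun u hu hsu => ?_⟩, hπ⟩
  by_contra! hnot
  wlog hneg : ∃ i, u i < 0 generalizing u
  · refine this (-u) (K.neg_mem hu) (by simpa using hsu)
      (fun c h => hnot (-c) (by rw [neg_smul, ← h, neg_neg])) ?_
    by_contra! h
    refine hnot 0 (funext fun i => ?_)
    simpa using le_antisymm (by simpa using h i) (by simpa using not_exists.1 hneg i)
  obtain ⟨r, hr, hpos, j, -, huj, hj⟩ := exists_forall_nonneg_add_mul (Set.toFinite Set.univ)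
    (fun i _ => hs0 i) (by simpa using hneg)
  have hmem : s + r • u ∈ K := K.add_mem hs (K.smul_mem r hu)
  have hsub : ∀ i, s i = 0 → (s + r • u) i = 0 := fun i hi => by simp [hi, hsu i hi]
  have hne' : s + r • u ≠ 0 := fun h => by
    obtain rfl | hr0 := eq_or_ne r 0
    · exact hne (by simpa using h)
    · refine hnot (-r⁻¹) ?_
      rw [eq_neg_of_add_eq_zero_left h, neg_smul_neg, inv_smul_smul₀ hr0]
  obtain ⟨d, hd, hπd⟩ := hK.eq_smul_of_support_subset hv hs hs0 (by rw [hπ, one_smul]) hmem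
    (fun i => hpos i trivial) hne' hsub
  have hle := hmin (j := d⁻¹ • (s + r • u)) ⟨K.smul_mem _ hmem,
    smul_nonneg (inv_nonneg.2 hd.le) fun i => hpos i trivial,
    by rw [map_smul, hπd, inv_smul_smul₀ hd.ne']⟩ fun i hi his => hi (by simp [hsub i his])
  exact hle (fun h => huj.ne (hsu j h)) (by simp [hj])

theorem IsExtremeRay.image_unique (hs : IsExtremeRay K s) (hs' : s' ∈ K)
    (h : ∀ i, s i = 0 → s' i = 0) (hc' : 0 < c') (hv : π s = c • (v, (1 : ℝ)))
    (hv' : π s' = c' • (v', (1 : ℝ))) : v = v' := by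
  obtain ⟨a, ha⟩ := hs.eq_smul s' hs' h
  rw [ha, map_smul, hv, smul_smul] at hv'
  obtain ⟨h1, h2⟩ := Prod.ext_iff.1 hv'
  simp only [Prod.smul_fst, Prod.smul_snd, smul_eq_mul, mul_one] at h1 h2
  rw [h2] at h1
  exact smul_right_injective _ hc'.ne' h1

end ConeLift

/-! ### Lines through vertices in homogeneous coordinates -/

theorem eq_zero_of_combination_eq_zero {a b c : Fin 2 → ℝ} (h : orient a b c ≠ 0) {x y z : ℝ}
    (hxyz : x • (a, (1 : ℝ)) + y • (b, (1 : ℝ)) + z • (c, (1 : ℝ)) = 0) :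
    x = 0 ∧ y = 0 ∧ z = 0 := by
  obtain ⟨h1, h2⟩ := Prod.ext_iff.1 hxyz
  have h10 := congrFun h1 0
  have h11 := congrFun h1 1
  simp only [Prod.smul_mk, Prod.mk_add_mk, Pi.add_apply, Pi.smul_apply, smul_eq_mul, mul_one,
    Prod.fst_zero, Prod.snd_zero, Pi.zero_apply] at h2 h10 h11
  have hx : x * orient a b c = 0 := by
    unfold orient
    linear_combination (b 1 - c 1) * h10 + (c 0 - b 0) * h11 + (b 0 * c 1 - b 1 * c 0) * h2
  have hy : y * orient a b c = 0 := by
    unfold orient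
    linear_combination (c 1 - a 1) * h10 + (a 0 - c 0) * h11 + (c 0 * a 1 - c 1 * a 0) * h2
  have hz : z * orient a b c = 0 := by
    unfold orient
    linear_combination (a 1 - b 1) * h10 + (b 0 - a 0) * h11 + (a 0 * b 1 - a 1 * b 0) * h2
  exact ⟨(mul_eq_zero.1 hx).resolve_right h, (mul_eq_zero.1 hy).resolve_right h,
    (mul_eq_zero.1 hz).resolve_right h⟩

section Combination

variable {F : Type*} [AddCommGroup F] [Module ℝ F] {a b c d p : F} {x y z t h : ℝ} {w : F × ℝ}

theorem mem_line_of_combination (hh : h ≠ 0)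
    (hp : x • (a, (1 : ℝ)) + y • (b, (1 : ℝ)) = h • (p, (1 : ℝ))) : p ∈ line[ℝ, a, b] := by
  simp only [Prod.smul_mk, Prod.mk_add_mk, smul_eq_mul, mul_one, Prod.mk.injEq] at hp
  obtain ⟨h1, rfl⟩ := hp
  suffices p = AffineMap.lineMap a b (y / (x + y)) from
    this ▸ AffineMap.lineMap_mem_affineSpan_pair _ _ _
  have hx : 1 - y / (x + y) = x / (x + y) := by field_simp; ring
  rw [AffineMap.lineMap_apply_module, hx, div_eq_inv_mul, div_eq_inv_mul, mul_smul, mul_smul,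
    ← smul_add, h1, inv_smul_smul₀ hh]

theorem vectorSpan_pair_of_combination (hw : w ≠ 0) (hw2 : w.2 = 0)
    (hab : x • (a, (1 : ℝ)) + y • (b, (1 : ℝ)) = w) :
    vectorSpan ℝ {a, b} = Submodule.span ℝ {w.1} := by
  subst hab
  simp only [Prod.smul_mk, Prod.mk_add_mk, smul_eq_mul, mul_one] at hw2 hw ⊢
  obtain rfl : y = -x := by linarith
  have hx : x ≠ 0 := by
    rintro rfl
    simp at hw
  rw [neg_smul, ← sub_eq_add_neg, ← smul_sub, vectorSpan_pair, vsub_eq_sub]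
  exact (Submodule.span_singleton_smul_eq (IsUnit.mk0 x hx) (a - b)).symm

theorem parallel_of_combination (hw : w ≠ 0) (hw2 : w.2 = 0)
    (hab : x • (a, (1 : ℝ)) + y • (b, (1 : ℝ)) = w)
    (hcd : z • (c, (1 : ℝ)) + t • (d, (1 : ℝ)) = w) :
    line[ℝ, a, b].Parallel line[ℝ, c, d] := by
  rw [AffineSubspace.affineSpan_pair_parallel_iff_vectorSpan_eq,
    vectorSpan_pair_of_combination hw hw2 hab, vectorSpan_pair_of_combination hw hw2 hcd]

end Combination

theorem NoParallelLines.exists_mem_line {P : Set (Fin 2 → ℝ)} (hP : NoParallelLines P)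
    {u : Fin 4 → Fin 2 → ℝ} (hinj : Function.Injective u) (hu : ∀ i, u i ∈ vertices P)
    {x y z t : ℝ} {w : (Fin 2 → ℝ) × ℝ} (hw : w ≠ 0)
    (h₁ : x • (u 0, (1 : ℝ)) + y • (u 1, (1 : ℝ)) = w)
    (h₂ : z • (u 2, (1 : ℝ)) + t • (u 3, (1 : ℝ)) = w) :
    ∃ h : ℝ, h ≠ 0 ∧ ∃ p, w = h • (p, (1 : ℝ)) ∧ p ∈ line[ℝ, u 0, u 1] ∧
      p ∈ line[ℝ, u 2, u 3] := by
  have hw2 : w.2 ≠ 0 := fun hw2 => hP ⟨u, hinj, hu, parallel_of_combination hw hw2 h₁ h₂⟩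
  have hwp : w = w.2 • (w.2⁻¹ • w.1, (1 : ℝ)) := by simp [hw2]
  exact ⟨w.2, hw2, _, hwp, mem_line_of_combination hw2 (h₁.trans hwp),
    mem_line_of_combination hw2 (h₂.trans hwp)⟩

theorem injOn_erase_of_card_le_card_image_add_one {α β : Type*} [DecidableEq α] [DecidableEq β]
    {f : α → β} {s : Finset α} (hcard : s.card ≤ (s.image f).card + 1) {x y : α} (hx : x ∈ s)
    (hy : y ∈ s) (hne : x ≠ y) (hxy : f x = f y) : Set.InjOn f (s.erase y : Finset α) := by
  have himg : s.image f = (s.erase y).image f := by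
    refine (Finset.image_subset_image (Finset.erase_subset _ _)).antisymm' fun u hu => ?_
    obtain ⟨z, hz, rfl⟩ := Finset.mem_image.1 hu
    by_cases hzy : z = y
    · exact Finset.mem_image.2 ⟨x, Finset.mem_erase.2 ⟨hne, hx⟩, by rw [hzy, hxy]⟩
    · exact Finset.mem_image_of_mem f (Finset.mem_erase.2 ⟨hzy, hz⟩)
  refine Finset.card_image_iff.1 (Finset.card_image_le.antisymm ?_)
  rw [← himg, Finset.card_erase_of_mem hy]
  lia

section ConcurrentPairs

variable {P : Set (Fin 2 → ℝ)} {v : Fin 3 × Bool → Fin 2 → ℝ} {w : (Fin 2 → ℝ) × ℝ}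
  {α : Fin 3 × Bool → ℝ}

theorem InGeneralPosition.not_injective_of_concurrent (hP : InGeneralPosition P)
    (hconv : Convex ℝ P) (hv : ∀ x, v x ∈ vertices P) (hα : ∀ x, α x ≠ 0)
    (hw : ∀ i, α (i, false) • (v (i, false), (1 : ℝ)) + α (i, true) • (v (i, true), (1 : ℝ)) = w) :
    ¬ Function.Injective v := by
  intro hinj
  have hw0 : w ≠ 0 := fun h0 => by
    have hor := orient_ne_zero_of_mem_extremePoints hconv (hv (0, false)) (hv (0, true))
      (hv (1, false)) (hinj.ne (by decide)) (hinj.ne (by decide)) (hinj.ne (by decide))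
    exact hα (0, false) (eq_zero_of_combination_eq_zero hor (x := α (0, false))
      (y := α (0, true)) (z := 0) (by rw [hw, h0, zero_smul, add_zero])).1
  set e : Fin 6 → Fin 3 × Bool :=
    ![(0, false), (0, true), (1, false), (1, true), (2, false), (2, true)]
  have he : Function.Injective (v ∘ e) := hinj.comp (by decide)
  obtain ⟨h, hh, p, hp, h0, h1⟩ := hP.1.exists_mem_line (u := v ∘ e ∘ Fin.castAdd 2)
    (he.comp (Fin.castAdd_injective 4 2)) (fun _ => hv _) hw0 (hw 0) (hw 1)
  exact hP.2.1 ⟨v ∘ e, he, fun _ => hv _, p, h0, h1, mem_line_of_combination hh ((hw 2).trans hp)⟩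

theorem false_of_concurrent_of_injOn (hconv : Convex ℝ P) (hv : ∀ x, v x ∈ vertices P)
    (hα : ∀ x, α x ≠ 0)
    (hw : ∀ i, α (i, false) • (v (i, false), (1 : ℝ)) + α (i, true) • (v (i, true), (1 : ℝ)) = w)
    {x y : Fin 3 × Bool} (hxy : x ≠ y) (hvxy : v x = v y)
    (hinj : Set.InjOn v (Finset.univ.erase y : Finset (Fin 3 × Bool))) : False := by
  rw [Finset.coe_erase, Finset.coe_univ, ← Set.compl_eq_univ_sdiff] at hinj
  have hw' : ∀ i b, α (i, b) • (v (i, b), (1 : ℝ)) + α (i, !b) • (v (i, !b), (1 : ℝ)) = w := by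
    rintro i (- | -)
    · exact hw i
    · exact (add_comm _ _).trans (hw i)
  have hor : ∀ z₁ z₂ z₃, z₁ ≠ y → z₂ ≠ y → z₃ ≠ y → z₁ ≠ z₂ → z₁ ≠ z₃ → z₂ ≠ z₃ →
      orient (v z₁) (v z₂) (v z₃) ≠ 0 := fun z₁ z₂ z₃ h₁ h₂ h₃ h₁₂ h₁₃ h₂₃ =>
    orient_ne_zero_of_mem_extremePoints hconv (hv _) (hv _) (hv _) (hinj.ne h₁ h₂ h₁₂)
      (hinj.ne h₁ h₃ h₁₃) (hinj.ne h₂ h₃ h₂₃)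
  obtain ⟨i, b⟩ := x
  obtain ⟨j, c⟩ := y
  rcases eq_or_ne i j with rfl | hij
  · obtain rfl : c = !b := by revert hxy; cases b <;> cases c <;> simp
    obtain ⟨k, hk⟩ := exists_ne i
    have h := hw' i b
    rw [← hvxy, ← hw k, ← sub_eq_zero] at h
    refine hα (k, false) (neg_eq_zero.1 (eq_zero_of_combination_eq_zero
      (hor (i, b) (k, false) (k, true) ?_ ?_ ?_ ?_ ?_ ?_) (x := α (i, b) + α (i, !b))
      (z := -α (k, true)) ?_).2.1)
    case refine_7 => rw [← h]; module
    all_goals simp [hk, hk.symm]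
  · have h := hw' i b
    rw [← hw' j c, ← hvxy, ← sub_eq_zero] at h
    refine hα (i, !b) (eq_zero_of_combination_eq_zero
      (hor (i, b) (i, !b) (j, !c) ?_ ?_ ?_ ?_ ?_ ?_) (x := α (i, b) - α (j, c))
      (z := -α (j, !c)) ?_).2.1
    case refine_7 => rw [← h]; module
    all_goals simp [hij]

theorem InGeneralPosition.card_image_le_of_concurrent (hP : InGeneralPosition P)
    (hconv : Convex ℝ P) (hv : ∀ x, v x ∈ vertices P) (hα : ∀ x, α x ≠ 0)
    (hw : ∀ i, α (i, false) • (v (i, false), (1 : ℝ)) + α (i, true) • (v (i, true), (1 : ℝ)) = w) :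
    (Finset.univ.image v).card ≤ 4 := by
  by_contra! hcard
  obtain ⟨x, y, hvxy, hxy⟩ :=
    Function.not_injective_iff.1 (hP.not_injective_of_concurrent hconv hv hα hw)
  exact false_of_concurrent_of_injOn hconv hv hα hw hxy hvxy
    (injOn_erase_of_card_le_card_image_add_one (by simp; lia) (Finset.mem_univ x)
      (Finset.mem_univ y) hxy hvxy)

end ConcurrentPairs

theorem InGeneralPosition.false_of_special_collinearity {P : Set (Fin 2 → ℝ)}
    (hP : InGeneralPosition P) {u : Fin 7 → Fin 2 → ℝ} (hinj : Function.Injective u)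
    (hu : ∀ i, u i ∈ vertices P) {w₀ w₁ w₂ : (Fin 2 → ℝ) × ℝ} (hw₀ : w₀ ≠ 0) (hw₁ : w₁ ≠ 0)
    (hw₂ : w₂ ≠ 0) {α β : Fin 6 → ℝ}
    (h₀ : α 0 • (u 0, (1 : ℝ)) + β 0 • (u 1, (1 : ℝ)) = w₀)
    (h₀' : α 1 • (u 2, (1 : ℝ)) + β 1 • (u 3, (1 : ℝ)) = w₀)
    (h₁ : α 2 • (u 1, (1 : ℝ)) + β 2 • (u 4, (1 : ℝ)) = w₁)
    (h₁' : α 3 • (u 3, (1 : ℝ)) + β 3 • (u 5, (1 : ℝ)) = w₁)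
    (h₂ : α 4 • (u 2, (1 : ℝ)) + β 4 • (u 6, (1 : ℝ)) = w₂)
    (h₂' : α 5 • (u 0, (1 : ℝ)) + β 5 • (u 4, (1 : ℝ)) = w₂)
    {x y : ℝ} (hdep : w₁ = x • w₀ + y • w₂) : False := by
  obtain ⟨k₀, -, p, rfl, hp, hp'⟩ := hP.1.exists_mem_line (u := u ∘ ![0, 1, 2, 3])
    (hinj.comp (by decide)) (fun _ => hu _) hw₀ h₀ h₀'
  obtain ⟨k₁, hk₁, q, rfl, hq, hq'⟩ := hP.1.exists_mem_line (u := u ∘ ![1, 4, 3, 5])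
    (hinj.comp (by decide)) (fun _ => hu _) hw₁ h₁ h₁'
  obtain ⟨k₂, -, r, rfl, hr, hr'⟩ := hP.1.exists_mem_line (u := u ∘ ![2, 6, 0, 4])
    (hinj.comp (by decide)) (fun _ => hu _) hw₂ h₂ h₂'
  refine hP.2.2 ⟨u, hinj, hu, p, q, r, ⟨hp, hp'⟩, ⟨hq, hq'⟩, ⟨hr, hr'⟩, ?_⟩
  have hpqr : q ∈ line[ℝ, p, r] := by
    refine mem_line_of_combination (x := x * k₀) (y := y * k₂) hk₁ ?_
    rw [hdep, mul_smul, mul_smul]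
  rw [Set.insert_comm]
  exact collinear_insert_of_mem_affineSpan_pair hpqr

/-! ### Dependencies of planar vectors -/

section IsIndependent

variable {ι : Type*} {K : Submodule ℝ (ι → ℝ)} {W : Finset ι}

/-- No nonzero vector of `K` is supported on `W`. For the space `K` of linear dependencies of a
family of vectors this is the linear independence of the vectors with index in `W`. -/
def IsIndependent (K : Submodule ℝ (ι → ℝ)) (W : Finset ι) : Prop :=
  ∀ u ∈ K, (∀ i ∉ W, u i = 0) → u = 0

theorem IsIndependent.exists_eq_smul [DecidableEq ι] (hW : IsIndependent K W) {u u' : ι → ℝ} {b : ι}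
    (hu : u ∈ K) (hu0 : u ≠ 0) (hsupp : ∀ i ∉ insert b W, u i = 0) (hu' : u' ∈ K)
    (hsupp' : ∀ i ∉ insert b W, u' i = 0) : ∃ c : ℝ, u' = c • u := by
  simp only [Finset.mem_insert, not_or] at hsupp hsupp'
  have hb : u b ≠ 0 := fun hb => hu0 <| hW u hu fun i hi => by
    by_cases hib : i = b
    exacts [hib ▸ hb, hsupp i ⟨hib, hi⟩]
  refine ⟨u' b / u b, sub_eq_zero.1 (hW _ (K.sub_mem hu' (K.smul_mem _ hu)) fun i hi => ?_)⟩
  by_cases hib : i = b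
  · simp [hib, hb]
  · simp [hsupp i ⟨hib, hi⟩, hsupp' i ⟨hib, hi⟩]

theorem IsIndependent.isExtremeRay [DecidableEq ι] (hW : IsIndependent K W) {s : ι → ℝ} {b : ι}
    (hs : s ∈ K) (h0 : 0 ≤ s) (hsupp : ∀ i, s i ≠ 0 ↔ i ∈ insert b W) : IsExtremeRay K s where
  mem := hs
  nonneg := h0
  ne_zero := fun h => (hsupp b).2 (Finset.mem_insert_self b W) (congrFun h b)
  eq_smul u hu hsub := by
    have hz : ∀ i ∉ insert b W, s i = 0 := fun i hi => by_contra fun h => hi ((hsupp i).1 h)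
    exact hW.exists_eq_smul hs (fun h => (hsupp b).2 (Finset.mem_insert_self b W) (congrFun h b))
      hz hu fun i hi => hsub i (hz i hi)

end IsIndependent

section depSpace

variable {ι : Type*} [Fintype ι] {lam t s : ι → ℝ}

/-- The linear dependencies of the vectors `lam i • (1, t i)`. -/
noncomputable def depSpace (lam t : ι → ℝ) : Submodule ℝ (ι → ℝ) :=
  LinearMap.ker (Fintype.linearCombination ℝ fun i => lam i • ((1 : ℝ), t i))

theorem mem_depSpace :
    s ∈ depSpace lam t ↔ ∑ i, lam i * s i = 0 ∧ ∑ i, lam i * s i * t i = 0 := by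
  simp [depSpace, Fintype.linearCombination_apply, Prod.ext_iff, Prod.fst_sum, Prod.snd_sum,
    mul_comm (lam _), mul_assoc]

theorem isIndependent_depSpace_singleton {i : ι} (hi : lam i ≠ 0) :
    IsIndependent (depSpace lam t) {i} := by
  intro u hu h
  simp only [Finset.mem_singleton] at h
  have hsum := (mem_depSpace.1 hu).1
  rw [Fintype.sum_eq_single i fun l hl => by rw [h l hl, mul_zero]] at hsum
  ext l
  by_cases hl : l = i
  · exact hl ▸ (mul_eq_zero.1 hsum).resolve_left hi
  · exact h l hl

theorem isIndependent_depSpace_pair [DecidableEq ι] {i j : ι} (hi : lam i ≠ 0) (hj : lam j ≠ 0)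
    (hij : t i ≠ t j) : IsIndependent (depSpace lam t) {i, j} := by
  intro u hu h
  simp only [Finset.mem_insert, Finset.mem_singleton, not_or] at h
  have hne : i ≠ j := fun h => hij (h ▸ rfl)
  obtain ⟨h₁, h₂⟩ := mem_depSpace.1 hu
  rw [Fintype.sum_eq_add i j hne fun l hl => by simp [h l hl]] at h₁ h₂
  have hui : (t i - t j) * lam i * u i = 0 := by linear_combination h₂ - t j * h₁
  replace hui : u i = 0 :=
    (mul_eq_zero.1 hui).resolve_left (mul_ne_zero (sub_ne_zero.2 hij) hi)
  refine isIndependent_depSpace_singleton hj u hu fun l hl => ?_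
  by_cases hli : l = i
  exacts [hli ▸ hui, h l ⟨hli, Finset.notMem_singleton.1 hl⟩]

theorem exists_isExtremeRay_single {i : ι} (h : lam i = 0) :
    ∃ s, IsExtremeRay (depSpace lam t) s ∧ ∀ l, s l ≠ 0 ↔ l ∈ ({i} : Finset ι) := by
  classical
  have hW : IsIndependent (depSpace lam t) ∅ := fun u _ h => funext fun l => h l (by simp)
  have hsupp : ∀ l, (Pi.single i 1 : ι → ℝ) l ≠ 0 ↔ l ∈ ({i} : Finset ι) := by
    simp [Pi.single_apply]
  refine ⟨Pi.single i 1, hW.isExtremeRay (b := i) ?_ ?_ (by simpa using hsupp), hsupp⟩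
  · simp [mem_depSpace, Pi.single_apply, h]
  · exact Pi.single_nonneg.2 zero_le_one

theorem exists_pos_neg_le_of_sum_eq_zero {μ : ι → ℝ} (h : ∑ i, μ i = 0) (h' : ∑ i, μ i * t i = 0)
    (hne : μ ≠ 0) : ∃ a b, 0 < μ a ∧ μ b < 0 ∧ t b ≤ t a := by
  obtain ⟨i, hi⟩ := Function.ne_iff.1 hne
  obtain ⟨a₀, -, ha₀⟩ := Finset.exists_pos_of_sum_zero_of_exists_nonzero μ h ⟨i, by simp, hi⟩
  obtain ⟨a, ha, hmax⟩ := (Finset.univ.filter (0 < μ ·)).exists_max_image t ⟨a₀, by simpa⟩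
  simp only [Finset.mem_filter, Finset.mem_univ, true_and] at ha hmax
  by_contra! hsep
  have hterm : ∀ l, μ l * (t l - t a) ≤ 0 := fun l => by
    rcases lt_trichotomy (μ l) 0 with hl | hl | hl
    · nlinarith [hsep a l ha hl]
    · simp [hl]
    · nlinarith [hmax l hl]
  have hzero : ∑ l, μ l * (t l - t a) = 0 := by
    simp only [mul_sub, Finset.sum_sub_distrib, ← Finset.sum_mul, h, h']
    ring
  obtain ⟨b, -, hb⟩ := Finset.exists_pos_of_sum_zero_of_exists_nonzero (s := Finset.univ) (-μ)
    (by simp [h]) ⟨i, Finset.mem_univ i, neg_ne_zero.2 hi⟩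
  have hb' : μ b < 0 := neg_pos.1 hb
  have := (Finset.sum_eq_zero_iff_of_nonpos fun l _ => hterm l).1 hzero b (Finset.mem_univ b)
  nlinarith [hsep a b ha hb']

variable [DecidableEq ι]

/-- The supports of the extreme rays of the nonnegative dependencies: the minimal dependent
subfamilies admitting a positive dependency. -/
inductive IsCircuitSupport (lam t : ι → ℝ) : Finset ι → Prop
  | single (i : ι) (h : lam i = 0) : IsCircuitSupport lam t {i}
  | pair (i j : ι) (h : lam i * lam j < 0) (ht : t i = t j) : IsCircuitSupport lam t {i, j}
  | triple (i j k : ι) (h : lam i * lam j < 0) (h' : lam j * lam k < 0) (ht : t i < t j)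
    (ht' : t j < t k) : IsCircuitSupport lam t {i, j, k}

theorem exists_isExtremeRay_pair {i j : ι} (h : lam i * lam j < 0) (ht : t i = t j) :
    ∃ s, IsExtremeRay (depSpace lam t) s ∧ ∀ l, s l ≠ 0 ↔ l ∈ ({i, j} : Finset ι) := by
  have hi : lam i ≠ 0 := left_ne_zero_of_mul h.ne
  have hj : lam j ≠ 0 := right_ne_zero_of_mul h.ne
  have hne : i ≠ j := by rintro rfl; exact (mul_self_nonneg _).not_gt h
  have hsupp : ∀ l, (Pi.single i |lam j| + Pi.single j |lam i| : ι → ℝ) l ≠ 0 ↔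
      l ∈ ({i, j} : Finset ι) := by
    intro l
    rcases eq_or_ne l i with rfl | hli
    · simp [hne, hj]
    · rcases eq_or_ne l j with rfl | hlj <;> simp [*]
  have hsum : lam i * |lam j| + lam j * |lam i| = 0 := by
    rcases mul_neg_iff.1 h with ⟨h₁, h₂⟩ | ⟨h₁, h₂⟩
    · rw [abs_of_neg h₂, abs_of_pos h₁]; ring
    · rw [abs_of_pos h₂, abs_of_neg h₁]; ring
  refine ⟨_, (isIndependent_depSpace_singleton hj).isExtremeRay ?_ ?_ hsupp, hsupp⟩
  · have hsum' : lam i * |lam j| * t i + lam j * |lam i| * t j = 0 := by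
      linear_combination t j * hsum + lam i * |lam j| * ht
    simpa [mem_depSpace, Pi.single_apply, mul_add, add_mul, Finset.sum_add_distrib] using
      ⟨hsum, hsum'⟩
  · exact add_nonneg (Pi.single_nonneg.2 (abs_nonneg _)) (Pi.single_nonneg.2 (abs_nonneg _))

theorem exists_isExtremeRay_triple {i j k : ι} (h : lam i * lam j < 0) (h' : lam j * lam k < 0)
    (ht : t i < t j) (ht' : t j < t k) :
    ∃ s, IsExtremeRay (depSpace lam t) s ∧ ∀ l, s l ≠ 0 ↔ l ∈ ({i, j, k} : Finset ι) := by
  have hi : lam i ≠ 0 := left_ne_zero_of_mul h.ne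
  have hj : lam j ≠ 0 := right_ne_zero_of_mul h.ne
  have hk : lam k ≠ 0 := right_ne_zero_of_mul h'.ne
  have hij : i ≠ j := by rintro rfl; exact ht.false
  have hjk : j ≠ k := by rintro rfl; exact ht'.false
  have hik : i ≠ k := by rintro rfl; exact (ht.trans ht').false
  let x := (t k - t j) / |lam i|
  let y := (t k - t i) / |lam j|
  let z := (t j - t i) / |lam k|
  have hsum : lam i * x + lam j * y + lam k * z = 0 ∧
      lam i * x * t i + lam j * y * t j + lam k * z * t k = 0 := by
    simp only [x, y, z]
    rcases mul_neg_iff.1 h with ⟨h₁, h₂⟩ | ⟨h₁, h₂⟩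
    · rw [abs_of_pos h₁, abs_of_neg h₂, abs_of_pos (pos_of_mul_neg_right h' h₂.le)]
      constructor <;> field_simp <;> ring
    · rw [abs_of_neg h₁, abs_of_pos h₂, abs_of_neg (neg_of_mul_neg_right h' h₂.le)]
      constructor <;> field_simp <;> ring
  have hx : 0 < x := div_pos (sub_pos.2 ht') (abs_pos.2 hi)
  have hy : 0 < y := div_pos (sub_pos.2 (ht.trans ht')) (abs_pos.2 hj)
  have hz : 0 < z := div_pos (sub_pos.2 ht) (abs_pos.2 hk)
  clear_value x y z
  let s : ι → ℝ := Pi.single i x + Pi.single j y + Pi.single k z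
  have hsupp : ∀ l, s l ≠ 0 ↔ l ∈ ({i, j, k} : Finset ι) := by
    intro l
    rcases eq_or_ne l i with rfl | hli
    · simp [s, hij, hik, hx.ne']
    · rcases eq_or_ne l j with rfl | hlj
      · simp [s, hli, hjk, hy.ne']
      · rcases eq_or_ne l k with rfl | hlk <;> simp [s, *, hz.ne']
  refine ⟨s, (isIndependent_depSpace_pair hj hk ht'.ne).isExtremeRay ?_ ?_ hsupp, hsupp⟩
  · simpa [s, mem_depSpace, Pi.single_apply, mul_add, add_mul, Finset.sum_add_distrib] using hsum
  · exact add_nonneg (add_nonneg (Pi.single_nonneg.2 hx.le) (Pi.single_nonneg.2 hy.le))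
      (Pi.single_nonneg.2 hz.le)

theorem IsCircuitSupport.exists_isExtremeRay {S : Finset ι} (hS : IsCircuitSupport lam t S) :
    ∃ s, IsExtremeRay (depSpace lam t) s ∧ ∀ i, s i ≠ 0 ↔ i ∈ S := by
  cases hS with
  | single i h => exact exists_isExtremeRay_single h
  | pair i j h ht => exact exists_isExtremeRay_pair h ht
  | triple i j k h h' ht ht' => exact exists_isExtremeRay_triple h h' ht ht'

theorem exists_isCircuitSupport_of_mem_depSpace (hs : s ∈ depSpace lam t) (h0 : 0 ≤ s)
    (hne : s ≠ 0) : ∃ S, IsCircuitSupport lam t S ∧ ∀ i ∈ S, s i ≠ 0 := by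
  obtain ⟨i, hi⟩ := Function.ne_iff.1 hne
  by_cases hlam : lam i = 0
  · exact ⟨{i}, .single i hlam, by simpa using hi⟩
  obtain ⟨h, h'⟩ := mem_depSpace.1 hs
  have hμ : (fun i => lam i * s i) ≠ 0 := Function.ne_iff.2 ⟨i, mul_ne_zero hlam hi⟩
  obtain ⟨a, b, ha, hb, hab⟩ := exists_pos_neg_le_of_sum_eq_zero h h' hμ
  obtain ⟨a', b', ha', hb', hab'⟩ := exists_pos_neg_le_of_sum_eq_zero (t := -t) h
    (by simpa using h') hμ
  simp only [Pi.neg_apply, neg_le_neg_iff] at hab'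
  have hsa := right_ne_zero_of_mul ha.ne'
  have hsa' := right_ne_zero_of_mul ha'.ne'
  have hsb := right_ne_zero_of_mul hb.ne
  have hsb' := right_ne_zero_of_mul hb'.ne
  replace ha := pos_of_mul_pos_left ha (h0 a)
  replace ha' := pos_of_mul_pos_left ha' (h0 a')
  replace hb := neg_of_mul_neg_left hb (h0 b)
  replace hb' := neg_of_mul_neg_left hb' (h0 b')
  rcases hab.eq_or_lt with heq | hab
  · exact ⟨{a, b}, .pair a b (mul_neg_of_pos_of_neg ha hb) heq.symm, by simp [hsa, hsb]⟩
  rcases hab'.eq_or_lt with heq | hab'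
  · exact ⟨{a', b'}, .pair a' b' (mul_neg_of_pos_of_neg ha' hb') heq, by simp [hsa', hsb']⟩
  rcases lt_trichotomy (t a) (t b') with hlt | heq | hlt
  · exact ⟨{b, a, b'}, .triple b a b' (mul_neg_of_neg_of_pos hb ha)
      (mul_neg_of_pos_of_neg ha hb') hab hlt, by simp [hsa, hsb, hsb']⟩
  · exact ⟨{a, b'}, .pair a b' (mul_neg_of_pos_of_neg ha hb') heq, by simp [hsa, hsb']⟩
  · exact ⟨{a', b', a}, .triple a' b' a (mul_neg_of_pos_of_neg ha' hb')
      (mul_neg_of_neg_of_pos hb' ha) hab' hlt, by simp [hsa, hsa', hsb']⟩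

theorem IsExtremeRay.exists_isCircuitSupport (hs : IsExtremeRay (depSpace lam t) s) :
    ∃ S, IsCircuitSupport lam t S ∧ ∀ i, s i ≠ 0 ↔ i ∈ S := by
  obtain ⟨S, hS, hsub⟩ := exists_isCircuitSupport_of_mem_depSpace hs.mem hs.nonneg hs.ne_zero
  obtain ⟨w, hw, hsupp⟩ := hS.exists_isExtremeRay
  obtain ⟨c, rfl⟩ := hs.eq_smul w hw.mem fun i hi =>
    by_contra fun hwi => hsub i ((hsupp i).1 hwi) hi
  have hc : c ≠ 0 := left_ne_zero_of_smul hw.ne_zero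
  exact ⟨S, hS, fun i => by simp [← hsupp i, hc]⟩

end depSpace

/-! ### The possible circuits of six sorted coefficients -/

/-- Six coefficients `lam i` and six points `t i`, up to the information that determines the
circuit supports: the sign of `lam i` and the rank of `t i`. -/
abbrev SignRankSequence : Type := Fin 6 → SignType × ℕ

namespace SignRankSequence

/-- The condition of `IsCircuitSupport`, read off from signs and ranks, for a strictly increasing
list of indices. -/
def IsCircuit (c : SignRankSequence) : List (Fin 6) → Prop
  | [i] => (c i).1 = 0
  | [i, j] => (c i).1 * (c j).1 = -1 ∧ (c i).2 = (c j).2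
  | [i, j, k] => (c i).1 * (c j).1 = -1 ∧ (c j).1 * (c k).1 = -1 ∧ (c i).2 < (c j).2 ∧
      (c j).2 < (c k).2
  | _ => False

instance (c : SignRankSequence) : DecidablePred c.IsCircuit
  | [] => .isFalse id
  | [_] => inferInstanceAs (Decidable (_ = _))
  | [_, _] => inferInstanceAs (Decidable (_ ∧ _))
  | [_, _, _] => inferInstanceAs (Decidable (_ ∧ _))
  | _ :: _ :: _ :: _ :: _ => .isFalse id

/-- The circuits of a sequence, as strictly increasing lists of indices. -/
def circuits (c : SignRankSequence) : List (List (Fin 6)) :=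
  (List.finRange 6).sublists.filter c.IsCircuit

/-- The possible successors of an entry in a sequence coming from an `IsSortedConfig`. -/
def successors : SignType × ℕ → List (SignType × ℕ)
  | (0, r) => [(0, r)]
  | (_, r) => [(0, r + 1), (1, r), (1, r + 1), (-1, r), (-1, r + 1)]

/-- The pairs `(W, D)` at which prisms are looked for. -/
def prismLabels : List (List (Fin 6) × (Fin 3 → Fin 6)) :=
  [([3, 4], ![0, 1, 2]), ([2, 4], ![0, 1, 3]), ([2, 3], ![0, 1, 4]), ([0, 1], ![2, 3, 4]),
   ([1, 4], ![0, 2, 3]), ([1, 3], ![0, 2, 4]), ([0, 2], ![1, 3, 4]), ([1, 2], ![0, 3, 4]),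
   ([0, 3], ![1, 2, 4]), ([0, 4], ![1, 2, 3]), ([2, 4, 5], ![0, 1, 3]), ([1, 4, 5], ![0, 2, 3]),
   ([0, 1, 3], ![2, 4, 5]), ([0, 2, 5], ![1, 3, 4]), ([0, 3, 4], ![1, 2, 5]),
   ([1, 3, 4], ![0, 2, 5]), ([4, 5], ![0, 1, 2]), ([3, 5], ![0, 2, 4]), ([2, 5], ![0, 1, 3]),
   ([1, 5], ![0, 2, 3]), ([0, 1, 4], ![2, 3, 5]), ([1, 2, 4], ![0, 3, 5]), ([1, 2, 5], ![0, 3, 4]),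
   ([0, 3, 5], ![1, 2, 4]), ([0, 5], ![1, 3, 4])]

/-- Each of three indices `D l` lies in two of the circuits `L` contained in `W ∪ {D l}`. Moreover,
`W` without one of its elements is a proper subset of a circuit, so that `W` supports at most one
dependency up to multiples. When the nonnegative dependencies form the cone over a triangular
prism, the three pairs of circuits are the parallel edges, concurrent in the direction
supported on `W`. -/
def HasPrism (L : List (List (Fin 6))) : Prop :=
  ∃ x ∈ prismLabels, (∃ i ∈ x.1, ∃ C ∈ L, x.1.erase i ⊆ C ∧ ¬ C ⊆ x.1.erase i) ∧
    ∀ l, 2 ≤ L.countP fun C => x.2 l ∈ C ∧ C ⊆ x.2 l :: x.1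

instance (L : List (List (Fin 6))) : Decidable (HasPrism L) :=
  inferInstanceAs (Decidable (∃ _ ∈ prismLabels, _))

/-- The list `S` is one of the circuits `L`, up to the order of its elements. -/
def HasSupport (L : List (List (Fin 6))) (S : List (Fin 6)) : Prop :=
  ∃ C ∈ L, C ⊆ S ∧ S ⊆ C

instance (L : List (List (Fin 6))) (S : List (Fin 6)) : Decidable (HasSupport L S) :=
  inferInstanceAs (Decidable (∃ _ ∈ L, _))

/-- The enumerations of the six indices for which cubes are looked for. -/
def cubeLabels : List (Fin 6 → Fin 6) :=
  [![1, 0, 2, 3, 4, 5], ![0, 5, 1, 2, 3, 4], ![3, 5, 4, 2, 1, 0], ![3, 2, 4, 5, 0, 1],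
   ![1, 3, 2, 0, 5, 4], ![0, 2, 1, 5, 3, 4], ![5, 0, 4, 3, 2, 1], ![4, 0, 5, 3, 1, 2],
   ![2, 4, 3, 1, 5, 0], ![3, 4, 2, 1, 0, 5]]

/-- The circuits `L` contain those of the cone over a combinatorial cube with pairs of opposite
facets `e 0, e 1` and `e 2, e 3` and `e 4, e 5`, where the edge joining `{e 0, e 2, e 4}` to
`{e 0, e 2, e 5}` may be contracted to a vertex `{e 0, e 2}`. -/
def HasCube (L : List (List (Fin 6))) : Prop :=
  ∃ e ∈ cubeLabels, HasSupport L [e 1, e 2, e 4] ∧ HasSupport L [e 1, e 2, e 5] ∧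
    HasSupport L [e 1, e 3, e 4] ∧ HasSupport L [e 1, e 3, e 5] ∧ HasSupport L [e 0, e 3, e 4] ∧
    HasSupport L [e 0, e 3, e 5] ∧ (L.length ≤ 7 ∧ HasSupport L [e 0, e 2] ∨
      L.length ≤ 8 ∧ HasSupport L [e 0, e 2, e 4] ∧ HasSupport L [e 0, e 2, e 5])

instance (L : List (List (Fin 6))) : Decidable (HasCube L) :=
  inferInstanceAs (Decidable (∃ _ ∈ cubeLabels, _))

/-- The splittings of the six indices into two triples. -/
def tripleSplittings : List ((Fin 3 → Fin 6) × (Fin 3 → Fin 6)) :=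
  [(![0, 1, 2], ![3, 4, 5]), (![0, 1, 3], ![2, 4, 5]), (![0, 1, 4], ![2, 3, 5]),
   (![0, 1, 5], ![2, 3, 4]), (![0, 2, 3], ![1, 4, 5]), (![0, 2, 4], ![1, 3, 5]),
   (![0, 2, 5], ![1, 3, 4]), (![0, 3, 4], ![1, 2, 5]), (![0, 3, 5], ![1, 2, 4]),
   (![0, 4, 5], ![1, 2, 3])]

/-- The circuits `L` contain those of the cone over a product of two triangles. -/
def HasGrid (L : List (List (Fin 6))) : Prop :=
  ∃ x ∈ tripleSplittings, ∀ i j, HasSupport L [x.1 i, x.2 j]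

instance (L : List (List (Fin 6))) : Decidable (HasGrid L) :=
  inferInstanceAs (Decidable (∃ _ ∈ tripleSplittings, _))

/-- The sequence `c` has at most six circuits or one of the shapes excluded for a heptagon; and at
most seven circuits if it ends with the sign zero. -/
def IsClassified (c : SignRankSequence) : Prop :=
  (c.circuits.length ≤ 6 ∨ c.circuits.length ≤ 8 ∧ HasPrism c.circuits ∨ HasCube c.circuits ∨
    c.circuits.length ≤ 9 ∧ HasGrid c.circuits) ∧ ((c 5).1 = 0 → c.circuits.length ≤ 7)

instance (c : SignRankSequence) : Decidable c.IsClassified :=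
  inferInstanceAs (Decidable (_ ∧ _))

theorem isClassified_of_mem_successors : ∀ x₀ ∈ [(0, 0), (1, 0)], ∀ x₁ ∈ successors x₀,
    ∀ x₂ ∈ successors x₁, ∀ x₃ ∈ successors x₂, ∀ x₄ ∈ successors x₃, ∀ x₅ ∈ successors x₄,
    IsClassified ![x₀, x₁, x₂, x₃, x₄, x₅] := by
  decide +kernel

end SignRankSequence

section valueRank

variable {ι α : Type*} [Fintype ι] [LinearOrder α] {t : ι → α} {i j : ι}

/-- The number of values of `t` below `t i`. -/
def valueRank (t : ι → α) (i : ι) : ℕ :=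
  ((Finset.univ.image t).filter (· < t i)).card

theorem valueRank_lt_valueRank_iff : valueRank t i < valueRank t j ↔ t i < t j := by
  refine ⟨fun h => lt_of_not_ge fun hle => h.not_ge (Finset.card_le_card fun v hv => ?_),
    fun h => Finset.card_lt_card ⟨fun v hv => ?_, fun hsub => ?_⟩⟩
  · rw [Finset.mem_filter] at hv ⊢
    exact ⟨hv.1, hv.2.trans_le hle⟩
  · rw [Finset.mem_filter] at hv ⊢
    exact ⟨hv.1, hv.2.trans h⟩
  · have hi : t i ∈ (Finset.univ.image t).filter (· < t j) := by simpa using h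
    exact (Finset.mem_filter.1 (hsub hi)).2.false

theorem valueRank_eq_valueRank_iff : valueRank t i = valueRank t j ↔ t i = t j := by
  simp only [eq_iff_le_not_lt, ← not_lt, valueRank_lt_valueRank_iff]

theorem valueRank_zero {n : ℕ} {t : Fin (n + 1) → α} (ht : Monotone t) : valueRank t 0 = 0 := by
  rw [valueRank, Finset.card_eq_zero, Finset.filter_eq_empty_iff]
  simp only [Finset.mem_image, Finset.mem_univ, true_and, forall_exists_index,
    forall_apply_eq_imp_iff, not_lt]
  exact fun i => ht (Fin.zero_le i)

theorem valueRank_succ_of_lt {n : ℕ} {t : Fin (n + 1) → α} (ht : Monotone t) {i : Fin n}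
    (h : t i.castSucc < t i.succ) : valueRank t i.succ = valueRank t i.castSucc + 1 := by
  have hfilter : (Finset.univ.image t).filter (· < t i.succ) =
      insert (t i.castSucc) ((Finset.univ.image t).filter (· < t i.castSucc)) := by
    ext v
    simp only [Finset.mem_filter, Finset.mem_image, Finset.mem_univ, true_and, Finset.mem_insert]
    constructor
    · rintro ⟨⟨l, rfl⟩, hl⟩
      have hle : t l ≤ t i.castSucc := ht (Fin.le_castSucc_iff.2 (ht.reflect_lt hl))
      exact hle.eq_or_lt.imp_right fun hlt => ⟨⟨l, rfl⟩, hlt⟩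
    · rintro (rfl | ⟨hv, hlt⟩)
      exacts [⟨⟨_, rfl⟩, h⟩, ⟨hv, hlt.trans h⟩]
  rw [valueRank, hfilter, Finset.card_insert_of_notMem (by simp), valueRank]

end valueRank

/-- Coefficients `lam i` and increasing points `t i` in the normal form to which the
classification applies: `lam 0` is nonnegative and the vanishing coefficients come last, all
attached to one point, larger than the others. -/
structure IsSortedConfig (lam t : Fin 6 → ℝ) : Prop where
  mono : Monotone t
  nonneg : 0 ≤ lam 0
  zero_succ : ∀ i : Fin 5, lam i.castSucc = 0 → lam i.succ = 0 ∧ t i.castSucc = t i.succ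
  lt_of_zero : ∀ i : Fin 5, lam i.castSucc ≠ 0 → lam i.succ = 0 → t i.castSucc < t i.succ

section signRank

variable {lam t : Fin 6 → ℝ}

/-- The signs of the `lam i` and the ranks of the `t i`. -/
noncomputable def signRank (lam t : Fin 6 → ℝ) : SignRankSequence :=
  fun i => (SignType.sign (lam i), valueRank t i)

open SignRankSequence

theorem IsSortedConfig.signRank_zero_mem (h : IsSortedConfig lam t) :
    signRank lam t 0 ∈ [((0 : SignType), 0), (1, 0)] := by
  rcases h.nonneg.eq_or_lt with h0 | h0
  · simp [signRank, valueRank_zero h.mono, ← h0]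
  · simp [signRank, valueRank_zero h.mono, h0]

theorem IsSortedConfig.signRank_succ_mem (h : IsSortedConfig lam t) (i : Fin 5) :
    signRank lam t i.succ ∈ successors (signRank lam t i.castSucc) := by
  by_cases h0 : lam i.castSucc = 0
  · obtain ⟨h1, h2⟩ := h.zero_succ i h0
    simp [signRank, successors, h0, h1, valueRank_eq_valueRank_iff.2 h2]
  have hsucc : ∀ r, successors (SignType.sign (lam i.castSucc), r) =
      [(0, r + 1), (1, r), (1, r + 1), (-1, r), (-1, r + 1)] := by
    intro r
    rcases lt_or_gt_of_ne h0 with h0 | h0 <;> simp [h0, successors]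
  rw [signRank, signRank, hsucc]
  rcases (h.mono i.castSucc_lt_succ.le).eq_or_lt with ht | ht
  · rw [← valueRank_eq_valueRank_iff.2 ht]
    rcases lt_trichotomy (lam i.succ) 0 with h1 | h1 | h1
    · simp [h1]
    · exact absurd ht (h.lt_of_zero i h0 h1).ne
    · simp [h1]
  · rw [valueRank_succ_of_lt h.mono ht]
    rcases lt_trichotomy (lam i.succ) 0 with h1 | h1 | h1 <;> simp [h1]

theorem IsSortedConfig.isClassified (h : IsSortedConfig lam t) : (signRank lam t).IsClassified := by
  have := isClassified_of_mem_successors _ h.signRank_zero_mem _ (h.signRank_succ_mem 0) _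
    (h.signRank_succ_mem 1) _ (h.signRank_succ_mem 2) _ (h.signRank_succ_mem 3) _
    (h.signRank_succ_mem 4)
  convert this using 1
  ext1 i
  fin_cases i <;> rfl

theorem sign_mul_sign_eq_neg_one_iff {x y : ℝ} :
    SignType.sign x * SignType.sign y = -1 ↔ x * y < 0 := by
  rw [← sign_mul, sign_eq_neg_one_iff]

theorem isCircuitSupport_toFinset_of_mem_circuits {C : List (Fin 6)}
    (hC : C ∈ (signRank lam t).circuits) : IsCircuitSupport lam t C.toFinset := by
  have hcirc : (signRank lam t).IsCircuit C := by simpa using (List.mem_filter.1 hC).2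
  match C, hcirc with
  | [i], h => exact .single i (sign_eq_zero_iff.1 h)
  | [i, j], ⟨h, ht⟩ =>
    simpa using IsCircuitSupport.pair i j (sign_mul_sign_eq_neg_one_iff.1 h)
      (valueRank_eq_valueRank_iff.1 ht)
  | [i, j, k], ⟨h, h', ht, ht'⟩ =>
    simpa using IsCircuitSupport.triple i j k (sign_mul_sign_eq_neg_one_iff.1 h)
      (sign_mul_sign_eq_neg_one_iff.1 h') (valueRank_lt_valueRank_iff.1 ht)
      (valueRank_lt_valueRank_iff.1 ht')

theorem mem_circuits_of_sortedLT {c : SignRankSequence} {C : List (Fin 6)} (hC : C.SortedLT)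
    (h : c.IsCircuit C) : C ∈ c.circuits := by
  have hsub : C.Subperm (List.finRange 6) := hC.nodup.subperm fun i _ => List.mem_finRange i
  simpa [circuits, h] using
    List.sublist_of_subperm_of_sortedLE hsub hC.sortedLE (List.sortedLT_finRange 6).sortedLE

theorem exists_mem_circuits_of_isCircuitSupport (ht : Monotone t) {S : Finset (Fin 6)}
    (hS : IsCircuitSupport lam t S) : ∃ C ∈ (signRank lam t).circuits, C.toFinset = S := by
  have hpair : ∀ i j, i < j → lam i * lam j < 0 → t i = t j → [i, j] ∈ (signRank lam t).circuits :=
    fun i j hij h ht => mem_circuits_of_sortedLT (by simpa [List.sortedLT_iff_pairwise])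
      ⟨sign_mul_sign_eq_neg_one_iff.2 h, valueRank_eq_valueRank_iff.2 ht⟩
  cases hS with
  | single i h => exact ⟨[i], mem_circuits_of_sortedLT (by simp [List.sortedLT_iff_pairwise])
      (sign_eq_zero_iff.2 h), by simp⟩
  | pair i j h ht =>
    rcases lt_trichotomy i j with hij | rfl | hij
    · exact ⟨[i, j], hpair i j hij h ht, by simp⟩
    · exact absurd h (mul_self_nonneg _).not_gt
    · exact ⟨[j, i], hpair j i hij (mul_comm (lam i) _ ▸ h) ht.symm, by simp [Finset.pair_comm]⟩
  | triple i j k h h' h₁ h₂ =>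
    have hij := ht.reflect_lt h₁
    have hjk := ht.reflect_lt h₂
    exact ⟨[i, j, k], mem_circuits_of_sortedLT
      (by simp [List.sortedLT_iff_pairwise, hij, hjk, hij.trans hjk])
      ⟨sign_mul_sign_eq_neg_one_iff.2 h, sign_mul_sign_eq_neg_one_iff.2 h',
        valueRank_lt_valueRank_iff.2 h₁, valueRank_lt_valueRank_iff.2 h₂⟩, by simp⟩

theorem nodup_circuits (c : SignRankSequence) : c.circuits.Nodup :=
  (List.nodup_sublists.2 (List.nodup_finRange 6)).filter _

theorem injOn_toFinset_circuits (c : SignRankSequence) :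
    Set.InjOn List.toFinset {C | C ∈ c.circuits} := by
  have hsorted : ∀ C ∈ c.circuits, C.SortedLT := fun C hC =>
    ((List.sortedLT_finRange 6).pairwise.sublist
      (List.mem_sublists.1 (List.mem_filter.1 hC).1)).sortedLT
  intro C hC C' hC' h
  exact (List.perm_of_nodup_nodup_toFinset_eq (hsorted C hC).nodup (hsorted C' hC').nodup
    h).eq_of_sortedLE (hsorted C hC).sortedLE (hsorted C' hC').sortedLE

/-- The supports of the extreme rays of the nonnegative dependencies, for a monotone `t`. -/
noncomputable def circuitSupports (lam t : Fin 6 → ℝ) : Finset (Finset (Fin 6)) :=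
  (signRank lam t).circuits.toFinset.image List.toFinset

theorem mem_circuitSupports (ht : Monotone t) {S : Finset (Fin 6)} :
    S ∈ circuitSupports lam t ↔ IsCircuitSupport lam t S := by
  simp only [circuitSupports, Finset.mem_image, List.mem_toFinset]
  refine ⟨?_, exists_mem_circuits_of_isCircuitSupport ht⟩
  rintro ⟨C, hC, rfl⟩
  exact isCircuitSupport_toFinset_of_mem_circuits hC

end signRank

/-! ### Extreme rays over the vertices of a heptagon -/

section relabel

variable {ι ι' F : Type*} [AddCommGroup F] [Module ℝ F] {P : Set F} {K : Submodule ℝ (ι → ℝ)}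
  {π : (ι → ℝ) →ₗ[ℝ] F × ℝ}

theorem isExtremeRay_comap_iff (e : ι' ≃ ι) {s : ι' → ℝ} :
    IsExtremeRay (K.comap (LinearMap.funLeft ℝ ℝ e.symm)) s ↔ IsExtremeRay K (s ∘ e.symm) := by
  have hcomp : ∀ u : ι → ℝ, (u ∘ e) ∘ e.symm = u := fun u => by ext; simp
  have hinj : Function.Injective fun u : ι' → ℝ => u ∘ e.symm :=
    e.symm.surjective.injective_comp_right
  refine ⟨fun h => ⟨h.mem, fun i => h.nonneg _, fun h0 => h.ne_zero (hinj h0), fun u hu hsu => ?_⟩,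
    fun h => ⟨h.mem, fun i => by simpa using h.nonneg (e i), fun h0 => h.ne_zero (by simp [h0]),
      fun u hu hsu => ?_⟩⟩
  · obtain ⟨c, hc⟩ := h.eq_smul (u ∘ e) (by rwa [← hcomp u] at hu) fun i hi => hsu _ (by simpa)
    exact ⟨c, by rw [← hcomp u, hc]; rfl⟩
  · obtain ⟨c, hc⟩ := h.eq_smul (u ∘ e.symm) hu fun i hi => hsu _ hi
    exact ⟨c, hinj hc⟩

theorem IsConeLift.comap (e : ι' ≃ ι) (hK : IsConeLift P K π) :
    IsConeLift P (K.comap (LinearMap.funLeft ℝ ℝ e.symm)) (π ∘ₗ LinearMap.funLeft ℝ ℝ e.symm) where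
  cone s hs hs0 hne := hK.cone (s ∘ e.symm) hs (fun i => hs0 _) fun h0 =>
    hne (e.symm.surjective.injective_comp_right h0)
  lift p hp := by
    obtain ⟨s, hs, hs0, hπ⟩ := hK.lift p hp
    have hcomp : (s ∘ e) ∘ e.symm = s := by ext; simp
    exact ⟨s ∘ e, (congrArg (· ∈ K) hcomp).mpr hs, fun i => hs0 _, (congrArg π hcomp).trans hπ⟩

theorem NoHiddenRay.comap (e : ι' ≃ ι) (h : NoHiddenRay P K π) :
    NoHiddenRay P (K.comap (LinearMap.funLeft ℝ ℝ e.symm)) (π ∘ₗ LinearMap.funLeft ℝ ℝ e.symm) :=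
  fun s hs => h (s ∘ e.symm) ((isExtremeRay_comap_iff e).1 hs)

end relabel

/-- A choice of extreme rays `ρ S` of the nonnegative part of `K` with supports `S ∈ L`, normalized
so that they lie over vertices `φ S` of `P`, and accounting for all vertices. -/
structure IsRayMap {ι F : Type*} [AddCommGroup F] [Module ℝ F] (P : Set F)
    (K : Submodule ℝ (ι → ℝ)) (π : (ι → ℝ) →ₗ[ℝ] F × ℝ) (L : Finset (Finset ι))
    (ρ : Finset ι → ι → ℝ) (φ : Finset ι → F) : Prop where
  ray : ∀ S ∈ L, IsExtremeRay K (ρ S)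
  support : ∀ S ∈ L, ∀ i, ρ S i ≠ 0 ↔ i ∈ S
  map_ray : ∀ S ∈ L, π (ρ S) = (φ S, 1)
  mem_extremePoints : ∀ S ∈ L, φ S ∈ P.extremePoints ℝ
  surj : ∀ v ∈ P.extremePoints ℝ, ∃ S ∈ L, φ S = v

/-- The members `S` and `S'` of `L` share the index `b` and are otherwise contained in `W`. A
combination of two vectors with supports `S` and `S'` that vanishes at `b` is supported on `W`. -/
structure IsEliminable {ι : Type*} [DecidableEq ι] (L : Finset (Finset ι)) (W : Finset ι) (b : ι)
    (S S' : Finset ι) : Prop where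
  left_mem : S ∈ L
  right_mem : S' ∈ L
  mem_left : b ∈ S
  mem_right : b ∈ S'
  left_subset : S ⊆ insert b W
  right_subset : S' ⊆ insert b W

namespace IsRayMap

section General

variable {ι ι' F : Type*} [AddCommGroup F] [Module ℝ F] {P : Set F} {K : Submodule ℝ (ι → ℝ)}
  {π : (ι → ℝ) →ₗ[ℝ] F × ℝ} {L : Finset (Finset ι)} {ρ : Finset ι → ι → ℝ} {φ : Finset ι → F}
  {S S' T : Finset ι}

theorem comap (e : ι' ≃ ι) (h : IsRayMap P K π L ρ φ) :
    IsRayMap P (K.comap (LinearMap.funLeft ℝ ℝ e.symm)) (π ∘ₗ LinearMap.funLeft ℝ ℝ e.symm)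
      (L.map e.symm.finsetCongr.toEmbedding) (fun S => ρ (e.finsetCongr S) ∘ e)
      (φ ∘ e.finsetCongr) := by
  have hcomp : ∀ u : ι → ℝ, (u ∘ e) ∘ e.symm = u := fun u => by ext; simp
  have hL : ∀ {S}, S ∈ L.map e.symm.finsetCongr.toEmbedding → e.finsetCongr S ∈ L := fun hS => by
    simpa [Finset.mem_map_equiv] using hS
  refine ⟨fun S hS => (isExtremeRay_comap_iff e).2 ?_, fun S hS i => ?_, fun S hS => ?_,
    fun S hS => h.mem_extremePoints _ (hL hS), fun v hv => ?_⟩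
  · exact (hcomp _).symm ▸ h.ray _ (hL hS)
  · simpa using h.support _ (hL hS) (e i)
  · exact (congrArg π (hcomp _)).trans (h.map_ray _ (hL hS))
  · obtain ⟨S, hS, hSv⟩ := h.surj v hv
    exact ⟨e.symm.finsetCongr S, Finset.mem_map_of_mem _ hS, by simpa [Finset.map_map] using hSv⟩

theorem isIndependent_of_ssubset (h : IsRayMap P K π L ρ φ) (hS : S ∈ L) (hTS : T ⊂ S) :
    IsIndependent K T := by
  intro u hu huT
  obtain ⟨i, hiS, hiT⟩ := Finset.exists_of_ssubset hTS
  obtain ⟨c, rfl⟩ := (h.ray S hS).eq_smul u hu fun l hl =>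
    huT l fun hlT => (h.support S hS l).2 (hTS.1 hlT) hl
  have hc : c = 0 := (mul_eq_zero.1 (huT i hiT)).resolve_right ((h.support S hS i).2 hiS)
  rw [hc, zero_smul]

theorem card_image [DecidableEq F] (h : IsRayMap P K π L ρ φ) :
    (L.image φ).card = (P.extremePoints ℝ).ncard := by
  rw [← Set.ncard_coe_finset]
  congr 1
  ext v
  simp only [Finset.coe_image, Set.mem_image, SetLike.mem_coe]
  exact ⟨fun ⟨S, hS, hv⟩ => hv ▸ h.mem_extremePoints S hS, h.surj v⟩

variable [DecidableEq ι]

theorem eq_of_subset_union [Finite ι] (h : IsRayMap P K π L ρ φ) (hK : IsConeLift P K π)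
    (hS : S ∈ L) (hS' : S' ∈ L) (hT : T ∈ L) (hφ : φ S = φ S') (hsub : T ⊆ S ∪ S') :
    φ T = φ S := by
  obtain ⟨r, r'⟩ := h.ray S hS, h.ray S' hS'
  obtain ⟨d, -, hπ⟩ := hK.eq_smul_of_support_subset (c := 2) (h.mem_extremePoints S hS)
    (K.add_mem r.mem r'.mem) (add_nonneg r.nonneg r'.nonneg)
    (by rw [map_add, h.map_ray S hS, h.map_ray S' hS', ← hφ, two_smul]) (h.ray T hT).mem
    (h.ray T hT).nonneg (h.ray T hT).ne_zero fun i hi => by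
      obtain ⟨hi₁, hi₂⟩ := (add_eq_zero_iff_of_nonneg (r.nonneg i) (r'.nonneg i)).1 hi
      by_contra hiT
      rcases Finset.mem_union.1 (hsub ((h.support T hT i).1 hiT)) with hm | hm
      exacts [(h.support S hS i).2 hm hi₁, (h.support S' hS' i).2 hm hi₂]
  rw [h.map_ray T hT, Prod.smul_mk, Prod.mk.injEq, smul_eq_mul, mul_one] at hπ
  rw [hπ.1, ← hπ.2, one_smul]

theorem exists_eliminate (h : IsRayMap P K π L ρ φ) {W : Finset ι} {b : ι}
    (hE : IsEliminable L W b S S') (hne : S ≠ S') :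
    ∃ u ∈ K, u ≠ 0 ∧ (∀ i ∉ W, u i = 0) ∧
      ∃ α β : ℝ, α ≠ 0 ∧ β ≠ 0 ∧ α • (φ S, (1 : ℝ)) + β • (φ S', (1 : ℝ)) = π u := by
  obtain ⟨hS, hS', hb, hb', hsub, hsub'⟩ := hE
  have hb0 : ρ S b ≠ 0 := (h.support S hS b).2 hb
  have hb0' : ρ S' b ≠ 0 := (h.support S' hS' b).2 hb'
  refine ⟨ρ S' b • ρ S - ρ S b • ρ S', K.sub_mem (K.smul_mem _ (h.ray S hS).mem)
    (K.smul_mem _ (h.ray S' hS').mem), fun h0 => hne ?_, fun i hi => ?_, ρ S' b, -ρ S b, hb0',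
    neg_ne_zero.2 hb0, ?_⟩
  · ext i
    have hi : ρ S' b * ρ S i = ρ S b * ρ S' i := sub_eq_zero.1 (congrFun h0 i)
    rw [← h.support S hS, ← h.support S' hS', ← mul_ne_zero_iff_left hb0', hi,
      mul_ne_zero_iff_left hb0]
  · by_cases hib : i = b
    · simp [hib, mul_comm]
    · have hz : ∀ {T}, T ∈ L → T ⊆ insert b W → ρ T i = 0 := fun hT hTW => by_contra fun h0 =>
        (Finset.mem_insert.1 (hTW ((h.support _ hT i).1 h0))).elim hib hi
      simp [hz hS hsub, hz hS' hsub']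
  · rw [map_sub, map_smul, map_smul, h.map_ray S hS, h.map_ray S' hS', neg_smul, sub_eq_add_neg]

theorem exists_common (h : IsRayMap P K π L ρ φ) {W : Finset ι} (hW : IsIndependent K W)
    {b d k : ι} {T' : Finset ι} (hS : IsEliminable L (insert k W) b S S')
    (hT : IsEliminable L (insert k W) d T T') (hφ : φ S ≠ φ S') (hφ' : φ T ≠ φ T') :
    ∃ w ∈ K, w ≠ 0 ∧ (∀ i ∉ insert k W, w i = 0) ∧ π w ≠ 0 ∧
      (∃ α β : ℝ, α • (φ S, (1 : ℝ)) + β • (φ S', (1 : ℝ)) = π w) ∧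
      ∃ α β : ℝ, α • (φ T, (1 : ℝ)) + β • (φ T', (1 : ℝ)) = π w := by
  obtain ⟨u, hu, hu0, huW, α, β, hα, -, hαβ⟩ := h.exists_eliminate hS fun h => hφ (h ▸ rfl)
  obtain ⟨u', hu', hu0', huW', α', β', -, -, hαβ'⟩ := h.exists_eliminate hT fun h => hφ' (h ▸ rfl)
  obtain ⟨c, rfl⟩ := hW.exists_eq_smul hu' hu0' huW' hu huW
  refine ⟨_, hu, hu0, huW, fun h0 => hφ ?_, ⟨α, β, hαβ⟩, c * α', c * β', ?_⟩
  · rw [h0, Prod.smul_mk, Prod.smul_mk, Prod.mk_add_mk, Prod.mk_eq_zero] at hαβ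
    simp only [smul_eq_mul, mul_one] at hαβ
    rw [eq_neg_of_add_eq_zero_right hαβ.2, neg_smul, ← sub_eq_add_neg, ← smul_sub] at hαβ
    exact sub_eq_zero.1 ((smul_eq_zero.1 hαβ.1).resolve_left hα)
  · rw [map_smul, ← hαβ', smul_add, smul_smul, smul_smul]

end General

end IsRayMap

theorem exists_four_lt_card_image {α β : Type*} [DecidableEq α] [Fintype β] {f : Fin 3 × β → α}
    (hf : 6 < (Finset.univ.image f).card) :
    ∃ i, 4 < (Finset.univ.image fun x : β × Bool => f (i + bif x.2 then 1 else 2, x.1)).card := by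
  by_contra! hle
  set g := fun i => Finset.univ.image fun x : β × Bool => f (i + bif x.2 then 1 else 2, x.1)
  have hother : ∀ i j : Fin 3, i ≠ j → ∃ b : Bool, j = i + bif b then 1 else 2 := by decide
  have hmem : ∀ {i j} y, i ≠ j → f (j, y) ∈ g i := fun {i j} y hij => by
    obtain ⟨b, rfl⟩ := hother i j hij
    exact Finset.mem_image_of_mem _ (Finset.mem_univ (y, b))
  have hdisj : ((Finset.univ : Finset (Fin 3)) : Set (Fin 3)).PairwiseDisjoint
      fun i => Finset.univ.image f \ g i := by
    intro i _ j _ hij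
    refine Finset.disjoint_left.2 fun v hvi hvj => ?_
    simp only [Finset.mem_sdiff, Finset.mem_image, Finset.mem_univ, true_and] at hvi hvj
    obtain ⟨⟨⟨l, y⟩, rfl⟩, hi⟩ := hvi
    by_cases hil : i = l
    exacts [hvj.2 (hmem y (hil ▸ hij.symm)), hi (hmem y hil)]
  have hsum := Finset.card_le_card (Finset.biUnion_subset.2 fun i (_ : i ∈ Finset.univ) =>
    Finset.sdiff_subset (s := Finset.univ.image f) (t := g i))
  rw [Finset.card_biUnion hdisj, Fin.sum_univ_three] at hsum
  have hlarge : ∀ i, (Finset.univ.image f).card ≤ (Finset.univ.image f \ g i).card + 4 := fun i =>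
    (Finset.card_le_card_sdiff_add_card (t := g i)).trans (Nat.add_le_add_left (hle i) _)
  have := hlarge 0
  have := hlarge 1
  have := hlarge 2
  lia

namespace IsRayMap

variable {ι : Type*} [DecidableEq ι] {P : Set (Fin 2 → ℝ)} {K : Submodule ℝ (ι → ℝ)}
  {π : (ι → ℝ) →ₗ[ℝ] (Fin 2 → ℝ) × ℝ} {L : Finset (Finset ι)} {ρ : Finset ι → ι → ℝ}
  {φ : Finset ι → Fin 2 → ℝ} {W : Finset ι} {k : ι}

section Prism

theorem card_image_le_of_prism (h : IsRayMap P K π L ρ φ) (hgen : InGeneralPosition P)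
    (hconv : Convex ℝ P) (hW : IsIndependent K W) {D : Fin 3 → ι} {C : Fin 3 × Bool → Finset ι}
    (hC : ∀ i, IsEliminable L (insert k W) (D i) (C (i, false)) (C (i, true)))
    (hne : ∀ i, C (i, false) ≠ C (i, true)) : (Finset.univ.image (φ ∘ C)).card ≤ 4 := by
  choose u hu hu0 huW α β hα hβ hαβ using fun i => h.exists_eliminate (hC i) (hne i)
  choose c hc using fun i => hW.exists_eq_smul (hu i) (hu0 i) (huW i) (hu 0) (huW 0)
  have hc0 : ∀ i, c i ≠ 0 := fun i h0 => hu0 0 (by rw [hc i, h0, zero_smul])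
  refine hgen.card_image_le_of_concurrent hconv (v := φ ∘ C) (w := π (u 0))
    (α := fun x => c x.1 * bif x.2 then β x.1 else α x.1) ?_ ?_ fun i => ?_
  · rintro ⟨i, - | -⟩
    exacts [h.mem_extremePoints _ (hC i).left_mem, h.mem_extremePoints _ (hC i).right_mem]
  · rintro ⟨i, - | -⟩
    exacts [mul_ne_zero (hc0 i) (hα i), mul_ne_zero (hc0 i) (hβ i)]
  · simp only [cond_true, cond_false, Function.comp_apply, mul_smul, ← smul_add, hαβ, hc i,
      map_smul]

theorem false_of_prism (h : IsRayMap P K π L ρ φ) (hgen : InGeneralPosition P)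
    (hconv : Convex ℝ P) (h7 : (P.extremePoints ℝ).ncard = 7) (hL : L.card ≤ 8)
    (hW : IsIndependent K W) {D : Fin 3 → ι} (hD : D.Injective) (hDW : ∀ i, D i ∉ insert k W)
    {C : Fin 3 × Bool → Finset ι}
    (hC : ∀ i, IsEliminable L (insert k W) (D i) (C (i, false)) (C (i, true)))
    (hne : ∀ i, C (i, false) ≠ C (i, true)) : False := by
  have hmem : ∀ x, C x ∈ L ∧ D x.1 ∈ C x ∧ C x ⊆ insert (D x.1) (insert k W) := by
    rintro ⟨i, - | -⟩
    exacts [⟨(hC i).left_mem, (hC i).mem_left, (hC i).left_subset⟩,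
      ⟨(hC i).right_mem, (hC i).mem_right, (hC i).right_subset⟩]
  have hinj : C.Injective := by
    intro x y hxy
    have hfst : x.1 = y.1 := hD <| by
      have hx : D x.1 ∈ insert (D y.1) (insert k W) := (hmem y).2.2 (hxy ▸ (hmem x).2.1)
      exact (Finset.mem_insert.1 hx).resolve_right (hDW _)
    obtain ⟨i, b⟩ := x
    obtain ⟨j, b'⟩ := y
    obtain rfl : i = j := hfst
    cases b <;> cases b'
    exacts [rfl, (hne i hxy).elim, (hne i hxy.symm).elim, rfl]
  have hsub : Finset.univ.image C ⊆ L := by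
    simpa [Finset.image_subset_iff] using fun i b => (hmem (i, b)).1
  have hcard := Finset.card_sdiff_add_card_eq_card hsub
  rw [Finset.card_image_of_injective _ hinj] at hcard
  have hcover : L.image φ = Finset.univ.image (φ ∘ C) ∪ (L \ Finset.univ.image C).image φ := by
    rw [← Finset.image_image, ← Finset.image_union, Finset.union_sdiff_of_subset hsub]
  have hle := Finset.card_union_le (Finset.univ.image (φ ∘ C)) ((L \ Finset.univ.image C).image φ)
  rw [← hcover, h.card_image, h7] at hle
  have hfour := h.card_image_le_of_prism hgen hconv hW hC hne
  have htwo := Finset.card_image_le (s := L \ Finset.univ.image C) (f := φ)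
  simp only [Finset.card_univ, Fintype.card_prod, Fintype.card_fin, Fintype.card_bool] at hcard
  lia

end Prism

theorem false_of_grid (h : IsRayMap P K π L ρ φ) (hgen : InGeneralPosition P)
    (hconv : Convex ℝ P) (h7 : (P.extremePoints ℝ).ncard = 7) (hL : L.card ≤ 9) {a b : Fin 3 → ι}
    (ha : a.Injective) (hb : b.Injective) (hab : ∀ i j, a i ≠ b j)
    (hC : ∀ i j, {a i, b j} ∈ L) : False := by
  have hinj : Function.Injective fun x : Fin 3 × Fin 3 => ({a x.1, b x.2} : Finset ι) := by
    rintro ⟨i, j⟩ ⟨i', j'⟩ hij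
    have hi : a i ∈ ({a i', b j'} : Finset ι) := by simp [← hij]
    have hj : b j ∈ ({a i', b j'} : Finset ι) := by simp [← hij]
    simp only [Finset.mem_insert, Finset.mem_singleton, hab, (hab _ _).symm, ha.eq_iff, hb.eq_iff,
      or_false, false_or] at hi hj
    rw [hi, hj]
  have hcover : (Finset.univ.image fun x : Fin 3 × Fin 3 => ({a x.1, b x.2} : Finset ι)) = L :=
    Finset.eq_of_subset_of_card_le (Finset.image_subset_iff.2 fun x _ => hC _ _)
      (by rw [Finset.card_image_of_injective _ hinj]; exact hL)
  obtain ⟨i, hi⟩ := exists_four_lt_card_image (f := fun x : Fin 3 × Fin 3 => φ {a x.1, b x.2})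
    (by rw [← Function.comp_def φ, ← Finset.image_image, hcover, h.card_image, h7]; simp)
  have hsingle : IsIndependent K {a (i + 1)} := h.isIndependent_of_ssubset (hC (i + 1) 0)
    (Finset.ssubset_iff_exists_cons_subset.2 ⟨b 0, by simp [(hab _ _).symm], by
      simp [Finset.insert_subset_iff]⟩)
  refine hi.not_ge (h.card_image_le_of_prism hgen hconv hsingle (D := b) (k := a (i + 2))
    (C := fun x => {a (i + bif x.2 then 1 else 2), b x.1})
    (fun j => ⟨hC _ _, hC _ _, by simp, by simp, ?_, ?_⟩) fun j heq => ?_)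
  · simp [Finset.insert_subset_iff]
  · simp [Finset.insert_subset_iff]
  · exact absurd (congrArg Prod.fst (@hinj (i + 2, j) (i + 1, j) heq)) (by simp)

end IsRayMap

theorem IsIndependent.exists_eq_smul_add_smul {ι : Type*} [DecidableEq ι]
    {K : Submodule ℝ (ι → ℝ)} {W : Finset ι} {k l : ι} {p q r : ι → ℝ} (hW : IsIndependent K W)
    (hp : p ∈ K) (hp0 : p ≠ 0) (hpW : ∀ i ∉ insert k W, p i = 0)
    (hr : r ∈ K) (hr0 : r ≠ 0) (hrW : ∀ i ∉ insert l W, r i = 0)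
    (hq : q ∈ K) (hqW : ∀ i ∉ insert k (insert l W), q i = 0)
    (hk : k ∉ insert l W) (hl : l ∉ insert k W) : ∃ x y : ℝ, q = x • p + y • r := by
  have hpk : p k ≠ 0 := fun h0 => hp0 (hW p hp fun i hi => by
    obtain rfl | hik := eq_or_ne i k
    exacts [h0, hpW i (by simp [hik, hi])])
  have hrl : r l ≠ 0 := fun h0 => hr0 (hW r hr fun i hi => by
    obtain rfl | hil := eq_or_ne i l
    exacts [h0, hrW i (by simp [hil, hi])])
  refine ⟨q k / p k, q l / r l, sub_eq_zero.1 (hW _ (K.sub_mem hq (K.add_mem (K.smul_mem _ hp)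
    (K.smul_mem _ hr))) fun i hi => ?_)⟩
  simp only [Pi.sub_apply, Pi.add_apply, Pi.smul_apply, smul_eq_mul]
  obtain rfl | hik := eq_or_ne i k
  · rw [hrW i hk, div_mul_cancel₀ _ hpk, mul_zero, add_zero, sub_self]
  obtain rfl | hil := eq_or_ne i l
  · rw [hpW i hl, div_mul_cancel₀ _ hrl, mul_zero, zero_add, sub_self]
  rw [hqW i (by simp [hik, hil, hi]), hpW i (by simp [hik, hi]), hrW i (by simp [hil, hi])]
  simp

/-- The vertices of a cube with pairs of opposite facets `0, 1`, `2, 3` and `4, 5`, as sets of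
facets. -/
def cubeCells : Finset (Finset (Fin 6)) :=
  {{0, 2, 4}, {0, 2, 5}, {0, 3, 4}, {0, 3, 5}, {1, 2, 4}, {1, 2, 5}, {1, 3, 4}, {1, 3, 5}}

/-- The members of `cubeCells` other than `{0, 2, 5}`, with `V` in place of `{0, 2, 4}`, ordered
like the vertices in the third condition on a heptagon in general position. -/
def sevenCubeCells (V : Finset (Fin 6)) : Fin 7 → Finset (Fin 6) :=
  ![{1, 2, 4}, {1, 2, 5}, {1, 3, 4}, {1, 3, 5}, V, {0, 3, 5}, {0, 3, 4}]

-- If `X` and `Y` are not adjacent, a third vertex lies on the smallest face containing both, and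
-- the symmetries of the cube act transitively on its oriented edges.
theorem cubeCells_cases : ∀ X ∈ cubeCells, ∀ Y ∈ cubeCells, X ≠ Y →
    (∃ Z ∈ cubeCells, Z ≠ X ∧ Z ≠ Y ∧ Z ⊆ X ∪ Y) ∨
    ∃ e : Equiv.Perm (Fin 6), e.finsetCongr {0, 2, 4} = X ∧ e.finsetCongr {0, 2, 5} = Y ∧
      ∀ Z ∈ cubeCells, e.finsetCongr Z ∈ cubeCells := by
  decide +kernel

namespace IsRayMap

variable {P : Set (Fin 2 → ℝ)} {K : Submodule ℝ (Fin 6 → ℝ)}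
  {π : (Fin 6 → ℝ) →ₗ[ℝ] (Fin 2 → ℝ) × ℝ} {L : Finset (Finset (Fin 6))}
  {ρ : Finset (Fin 6) → Fin 6 → ℝ} {φ : Finset (Fin 6) → Fin 2 → ℝ} {V V' : Finset (Fin 6)}

theorem false_of_cube (h : IsRayMap P K π L ρ φ) (hgen : InGeneralPosition P)
    (hL : ∀ i, sevenCubeCells V i ∈ L) (hV' : V' ∈ L) (h2 : 2 ∈ V) (h2' : 2 ∈ V')
    (hV : V ⊆ {0, 2, 4}) (hV'sub : V' ⊆ {0, 2, 5}) (hφ : φ V = φ V')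
    (hinj : Function.Injective fun i => φ (sevenCubeCells V i)) : False := by
  have hcell : _ ∧ _ ∧ _ ∧ _ ∧ _ ∧ _ ∧ _ := ⟨hL 0, hL 1, hL 2, hL 3, hL 4, hL 5, hL 6⟩
  simp only [sevenCubeCells, Matrix.cons_val] at hcell
  obtain ⟨h₁, h₂, h₃, h₄, h₅, h₆, h₇⟩ := hcell
  have hne : ∀ i j : Fin 7, i ≠ j → _ := fun i j hij => hinj.ne hij
  have h14 : IsIndependent K {1, 4} := h.isIndependent_of_ssubset h₁ (by decide)
  have h15 : IsIndependent K {1, 5} := h.isIndependent_of_ssubset h₂ (by decide)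
  obtain ⟨p, hp, hp0, hpW, hπp, ⟨α₀, β₀, e₀⟩, α₁, β₁, e₁⟩ := h.exists_common h14 (k := 5)
    ⟨h₁, h₂, by decide, by decide, by decide, by decide⟩
    ⟨h₃, h₄, by decide, by decide, by decide, by decide⟩ (b := 2) (d := 3)
    (hne 0 1 (by decide)) (hne 2 3 (by decide))
  obtain ⟨q, hq, -, hqW, hπq, ⟨α₂, β₂, e₂⟩, α₃, β₃, e₃⟩ := h.exists_common h15 (k := 0)
    ⟨h₂, hV', by decide, h2', by decide, hV'sub.trans (by decide)⟩
    ⟨h₄, h₆, by decide, by decide, by decide, by decide⟩ (b := 2) (d := 3)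
    (hφ ▸ hne 1 4 (by decide)) (hne 3 5 (by decide))
  obtain ⟨r, hr, hr0, hrW, hπr, ⟨α₄, β₄, e₄⟩, α₅, β₅, e₅⟩ := h.exists_common h14 (k := 0)
    ⟨h₃, h₇, by decide, by decide, by decide, by decide⟩
    ⟨h₁, h₅, by decide, h2, by decide, hV.trans (by decide)⟩ (b := 3) (d := 2)
    (hne 2 6 (by decide)) (hne 0 4 (by decide))
  obtain ⟨x, y, hdep⟩ := h14.exists_eq_smul_add_smul hp hp0 hpW hr hr0 hrW hq
    (fun i hi => hqW i fun hi' => hi (by revert hi'; revert i; decide)) (by decide) (by decide)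
  rw [← hφ] at e₂
  exact hgen.false_of_special_collinearity hinj (fun i => h.mem_extremePoints _ (hL i)) hπp hπq hπr
    (α := ![α₀, α₁, α₂, α₃, α₄, α₅]) (β := ![β₀, β₁, β₂, β₃, β₄, β₅]) e₀ e₁ e₂ e₃ e₄ e₅
    (x := x) (y := y) (by rw [hdep, map_add, map_smul, map_smul])

theorem false_of_contracted_cube (h : IsRayMap P K π L ρ φ) (hgen : InGeneralPosition P)
    (h7 : (P.extremePoints ℝ).ncard = 7) (hcard : L.card ≤ 7)
    (hL : ∀ i, sevenCubeCells {0, 2} i ∈ L) : False := by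
  have hinj : Set.InjOn φ L :=
    Finset.card_image_iff.1 (le_antisymm Finset.card_image_le (by rwa [h.card_image, h7]))
  exact h.false_of_cube hgen hL (hL 4) (by decide) (by decide) (by decide) (by decide) rfl
    fun i j hij => (by decide : (sevenCubeCells {0, 2}).Injective) (hinj (hL i) (hL j) hij)

theorem false_of_full_cube (h : IsRayMap P K π L ρ φ) (hK : IsConeLift P K π)
    (hgen : InGeneralPosition P) (h7 : (P.extremePoints ℝ).ncard = 7) (hcard : L.card ≤ 8)
    (hL : cubeCells ⊆ L) : False := by
  obtain ⟨X, hX, Y, hY, hne, hXY⟩ := Finset.exists_ne_map_eq_of_card_lt_of_maps_to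
    (s := cubeCells) (t := L.image φ) (by rw [h.card_image, h7]; decide)
    fun X hX => Finset.mem_image_of_mem φ (hL hX)
  have hinj : Set.InjOn φ (L.erase Y : Finset _) := injOn_erase_of_card_le_card_image_add_one
    (by rwa [h.card_image, h7]) (hL hX) (hL hY) hne hXY
  rcases cubeCells_cases X hX Y hY hne with ⟨Z, hZ, hZX, hZY, hsub⟩ | ⟨e, rfl, rfl, he⟩
  · exact hZX (hinj (Finset.mem_erase.2 ⟨hZY, hL hZ⟩) (Finset.mem_erase.2 ⟨hne, hL hX⟩)
      (h.eq_of_subset_union hK (hL hX) (hL hY) (hL hZ) hXY hsub))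
  · have hmem : ∀ Z ∈ cubeCells, Z ∈ L.map e.symm.finsetCongr.toEmbedding := fun Z hZ => by
      simpa [Finset.mem_map_equiv] using hL (he Z hZ)
    have hcells : ∀ i, sevenCubeCells {0, 2, 4} i ∈ cubeCells ∧
      sevenCubeCells {0, 2, 4} i ≠ {0, 2, 5} := by decide
    refine (h.comap e).false_of_cube hgen (fun i => hmem _ (hcells i).1)
      (hmem {0, 2, 5} (by decide)) (by decide) (by decide) (by decide) (by decide) hXY
      fun i j hij => (by decide : (sevenCubeCells {0, 2, 4}).Injective) ?_
    have herase : ∀ i, e.finsetCongr (sevenCubeCells {0, 2, 4} i) ∈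
        L.erase (e.finsetCongr {0, 2, 5}) := fun i =>
      Finset.mem_erase.2 ⟨e.finsetCongr.injective.ne (hcells i).2, hL (he _ (hcells i).1)⟩
    exact e.finsetCongr.injective (hinj (herase i) (herase j) hij)

end IsRayMap

theorem SignRankSequence.HasSupport.toFinset_mem {A : List (List (Fin 6))} {S : List (Fin 6)}
    (h : HasSupport A S) : S.toFinset ∈ A.toFinset.image List.toFinset := by
  obtain ⟨C, hC, hCS, hSC⟩ := h
  exact Finset.mem_image.2 ⟨C, List.mem_toFinset.2 hC,
    Finset.ext fun i => by simpa using ⟨@hCS i, @hSC i⟩⟩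

theorem card_image_toFinset_le {α : Type*} [DecidableEq α] (A : List (List α)) :
    (A.toFinset.image List.toFinset).card ≤ A.length :=
  Finset.card_image_le.trans A.toFinset_card_le

theorem exists_isEliminable_of_two_le_countP {α : Type*} [DecidableEq α] {A : List (List α)}
    (hnd : A.Nodup) (hinj : Set.InjOn List.toFinset {C | C ∈ A}) {W : List α} {D : α}
    (h : 2 ≤ A.countP fun C => D ∈ C ∧ C ⊆ D :: W) :
    ∃ S S', S ≠ S' ∧ IsEliminable (A.toFinset.image List.toFinset) W.toFinset D S S' := by
  rw [List.countP_eq_length_filter, ← List.toFinset_card_of_nodup (hnd.filter _)] at h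
  obtain ⟨C, hC, C', hC', hne⟩ := Finset.one_lt_card.1 h
  simp only [List.mem_toFinset, List.mem_filter, decide_eq_true_eq] at hC hC'
  have hmem : ∀ {B}, B ∈ A → B.toFinset ∈ A.toFinset.image List.toFinset := fun hB =>
    Finset.mem_image_of_mem _ (List.mem_toFinset.2 hB)
  have hsub : ∀ {B : List α}, B ⊆ D :: W → B.toFinset ⊆ insert D W.toFinset := fun hB i hi => by
    simpa using hB (List.mem_toFinset.1 hi)
  exact ⟨C.toFinset, C'.toFinset, fun heq => hne (hinj hC.1 hC'.1 heq), hmem hC.1, hmem hC'.1,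
    List.mem_toFinset.2 hC.2.1, List.mem_toFinset.2 hC'.2.1, hsub hC.2.2, hsub hC'.2.2⟩

theorem prismLabels_injective_notMem : ∀ x ∈ SignRankSequence.prismLabels,
    x.2.Injective ∧ ∀ l, x.2 l ∉ x.1.toFinset := by
  intro x hx
  fin_cases hx <;> decide

theorem cubeLabels_injective : ∀ e ∈ SignRankSequence.cubeLabels, Function.Injective e := by
  intro e he
  fin_cases he <;> decide

theorem tripleSplittings_injective : ∀ x ∈ SignRankSequence.tripleSplittings,
    x.1.Injective ∧ x.2.Injective ∧ ∀ i j, x.1 i ≠ x.2 j := by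
  intro x hx
  fin_cases hx <;> decide

namespace IsRayMap

open SignRankSequence

variable {P : Set (Fin 2 → ℝ)} {K : Submodule ℝ (Fin 6 → ℝ)}
  {π : (Fin 6 → ℝ) →ₗ[ℝ] (Fin 2 → ℝ) × ℝ} {A : List (List (Fin 6))}
  {ρ : Finset (Fin 6) → Fin 6 → ℝ} {φ : Finset (Fin 6) → Fin 2 → ℝ}

theorem false_of_hasPrism (h : IsRayMap P K π (A.toFinset.image List.toFinset) ρ φ)
    (hgen : InGeneralPosition P) (hconv : Convex ℝ P) (h7 : (P.extremePoints ℝ).ncard = 7)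
    (hnd : A.Nodup) (hinj : Set.InjOn List.toFinset {C | C ∈ A}) (hlen : A.length ≤ 8)
    (hA : HasPrism A) : False := by
  obtain ⟨⟨W, D⟩, hx, ⟨k, hk, B, hB, hBW, hWB⟩, hD⟩ := hA
  obtain ⟨hDinj, hDW⟩ := prismLabels_injective_notMem _ hx
  have hW : W.toFinset = insert k (W.erase k).toFinset := by
    rw [List.toFinset_eq_of_perm _ _ (List.perm_cons_erase hk), List.toFinset_cons]
  have hindep : IsIndependent K (W.erase k).toFinset :=
    h.isIndependent_of_ssubset (Finset.mem_image_of_mem _ (List.mem_toFinset.2 hB))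
      ⟨fun i hi => List.mem_toFinset.2 (hBW (List.mem_toFinset.1 hi)), fun hsub => hWB fun i hi =>
        List.mem_toFinset.1 (hsub (List.mem_toFinset.2 hi))⟩
  choose S S' hne hS using fun l => exists_isEliminable_of_two_le_countP hnd hinj (hD l)
  simp only [hW] at hS hDW
  exact h.false_of_prism hgen hconv h7 ((card_image_toFinset_le A).trans hlen) hindep hDinj hDW
    (C := fun x => bif x.2 then S' x.1 else S x.1) hS hne

theorem false_of_hasGrid (h : IsRayMap P K π (A.toFinset.image List.toFinset) ρ φ)
    (hgen : InGeneralPosition P) (hconv : Convex ℝ P) (h7 : (P.extremePoints ℝ).ncard = 7)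
    (hlen : A.length ≤ 9) (hA : HasGrid A) : False := by
  obtain ⟨x, hx, hx'⟩ := hA
  obtain ⟨ha, hb, hab⟩ := tripleSplittings_injective x hx
  exact h.false_of_grid hgen hconv h7 ((card_image_toFinset_le A).trans hlen) ha hb hab
    fun i j => by simpa using (hx' i j).toFinset_mem

theorem false_of_hasCube (h : IsRayMap P K π (A.toFinset.image List.toFinset) ρ φ)
    (hK : IsConeLift P K π) (hgen : InGeneralPosition P) (h7 : (P.extremePoints ℝ).ncard = 7)
    (hA : HasCube A) : False := by
  obtain ⟨e, he, h124, h125, h134, h135, h034, h035, hA⟩ := hA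
  set σ := Equiv.ofBijective e (Finite.injective_iff_bijective.1 (cubeLabels_injective _ he))
  set L := A.toFinset.image List.toFinset
  have hpair : ∀ {i j}, HasSupport A [e i, e j] → {σ i, σ j} ∈ L := fun hS => by
    simpa [L, σ] using hS.toFinset_mem
  have htriple : ∀ {i j k}, HasSupport A [e i, e j, e k] → {σ i, σ j, σ k} ∈ L := fun hS => by
    simpa [L, σ] using hS.toFinset_mem
  have hcard : ∀ {n}, A.length ≤ n → (L.map σ.symm.finsetCongr.toEmbedding).card ≤ n := fun hn => by
    rw [Finset.card_map]; exact (card_image_toFinset_le A).trans hn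
  rcases hA with ⟨hlen, h02⟩ | ⟨hlen, h024, h025⟩
  · refine (h.comap σ).false_of_contracted_cube hgen h7 (hcard hlen) ?_
    simpa [sevenCubeCells, Fin.forall_fin_succ] using
      ⟨htriple h124, htriple h125, htriple h134, htriple h135, hpair h02, htriple h035,
        htriple h034⟩
  · refine (h.comap σ).false_of_full_cube (hK.comap σ) hgen h7 (hcard hlen) ?_
    simpa [cubeCells, Finset.insert_subset_iff] using ⟨htriple h024, htriple h025, htriple h034,
      htriple h035, htriple h124, htriple h125, htriple h134, htriple h135⟩

end IsRayMap

theorem IsExtremeRay.smul {ι : Type*} {K : Submodule ℝ (ι → ℝ)} {s : ι → ℝ} {c : ℝ}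
    (hs : IsExtremeRay K s) (hc : 0 < c) : IsExtremeRay K (c • s) where
  mem := K.smul_mem c hs.mem
  nonneg := smul_nonneg hc.le hs.nonneg
  ne_zero := smul_ne_zero hc.ne' hs.ne_zero
  eq_smul u hu h := by
    obtain ⟨d, rfl⟩ := hs.eq_smul u hu fun i hi => h i (by simp [hi])
    exact ⟨d / c, by rw [smul_smul, div_mul_cancel₀ _ hc.ne']⟩

theorem exists_isRayMap {ι F : Type*} [Finite ι] [AddCommGroup F] [Module ℝ F] {P : Set F}
    {K : Submodule ℝ (ι → ℝ)} {π : (ι → ℝ) →ₗ[ℝ] F × ℝ} {L : Finset (Finset ι)}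
    (hK : IsConeLift P K π) (hno : NoHiddenRay P K π)
    (hL : ∀ S ∈ L, ∃ s, IsExtremeRay K s ∧ ∀ i, s i ≠ 0 ↔ i ∈ S)
    (hL' : ∀ s, IsExtremeRay K s → ∃ S ∈ L, ∀ i, s i ≠ 0 ↔ i ∈ S) :
    ∃ ρ φ, IsRayMap P K π L ρ φ := by
  have hray : ∀ S, ∃ s v, S ∈ L → IsExtremeRay K s ∧ (∀ i, s i ≠ 0 ↔ i ∈ S) ∧ π s = (v, 1) ∧
      v ∈ P.extremePoints ℝ := by
    intro S
    by_cases hS : S ∈ L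
    · obtain ⟨s, hs, hsS⟩ := hL S hS
      obtain ⟨c, hc, v, hv, hπ⟩ := hno s hs
      exact ⟨c⁻¹ • s, v, fun _ => ⟨hs.smul (inv_pos.2 hc), fun i => by simp [hc.ne', ← hsS i],
        by rw [map_smul, hπ, smul_smul, inv_mul_cancel₀ hc.ne', one_smul], hv⟩⟩
    · exact ⟨0, 0, fun h => absurd h hS⟩
  choose ρ φ hρ using hray
  refine ⟨ρ, φ, fun S hS => (hρ S hS).1, fun S hS => (hρ S hS).2.1, fun S hS => (hρ S hS).2.2.1,
    fun S hS => (hρ S hS).2.2.2, fun v hv => ?_⟩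
  obtain ⟨s, hs, hπ⟩ := hK.exists_isExtremeRay hv
  obtain ⟨S, hS, hsS⟩ := hL' s hs
  obtain ⟨hρS, hsupp, hπS, -⟩ := hρ S hS
  refine ⟨S, hS, (hs.image_unique hρS.mem (fun i hi => ?_) one_pos (c := 1) (by rw [hπ, one_smul])
    (by rw [hπS, one_smul])).symm⟩
  by_contra h0
  exact (hsS i).2 ((hsupp i).1 h0) hi

section IsSortedConfig

variable {lam t : Fin 6 → ℝ}

theorem exists_isRayMap_circuitSupports {F : Type*} [AddCommGroup F] [Module ℝ F] {P : Set F}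
    {π : (Fin 6 → ℝ) →ₗ[ℝ] F × ℝ} (hK : IsConeLift P (depSpace lam t) π)
    (hno : NoHiddenRay P (depSpace lam t) π) (ht : Monotone t) :
    ∃ ρ φ, IsRayMap P (depSpace lam t) π (circuitSupports lam t) ρ φ :=
  exists_isRayMap hK hno (fun _ hS => ((mem_circuitSupports ht).1 hS).exists_isExtremeRay)
    fun _ hs =>
      let ⟨S, hS, hsS⟩ := hs.exists_isCircuitSupport
      ⟨S, (mem_circuitSupports ht).2 hS, hsS⟩

theorem false_of_isSortedConfig {P : Set (Fin 2 → ℝ)} {π : (Fin 6 → ℝ) →ₗ[ℝ] (Fin 2 → ℝ) × ℝ}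
    (hs : IsSortedConfig lam t) (hK : IsConeLift P (depSpace lam t) π)
    (hno : NoHiddenRay P (depSpace lam t) π) (hconv : Convex ℝ P)
    (h7 : (P.extremePoints ℝ).ncard = 7) (hgen : InGeneralPosition P) : False := by
  obtain ⟨ρ, φ, h⟩ := exists_isRayMap_circuitSupports hK hno hs.mono
  have hnd := nodup_circuits (signRank lam t)
  have hinj := injOn_toFinset_circuits (signRank lam t)
  rcases hs.isClassified.1 with h6 | ⟨h8, hprism⟩ | hcube | ⟨h9, hgrid⟩
  · have hcard := (h.card_image.symm.le.trans Finset.card_image_le).trans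
      ((card_image_toFinset_le _).trans h6)
    rw [h7] at hcard
    contradiction
  · exact h.false_of_hasPrism hgen hconv h7 hnd hinj h8 hprism
  · exact h.false_of_hasCube hK hgen h7 hcube
  · exact h.false_of_hasGrid hgen hconv h7 h9 hgrid

theorem IsSortedConfig.eq_zero_of_le (hs : IsSortedConfig lam t) {i j : Fin 6} (hi : lam i = 0)
    (hij : i ≤ j) : lam j = 0 := by
  induction j using Fin.induction with
  | zero => rwa [← le_antisymm hij (Fin.zero_le i)]
  | succ k ih =>
    rcases hij.lt_or_eq with h | rfl
    exacts [(hs.zero_succ k (ih (Fin.le_castSucc_iff.2 h))).1, hi]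

theorem card_circuitSupports_erase_le (hs : IsSortedConfig lam t) {z : Fin 6} (hz : lam z = 0) :
    ((circuitSupports lam t).erase {z}).card ≤ 6 := by
  have h5 : lam 5 = 0 := hs.eq_zero_of_le hz (Fin.le_last z)
  rw [Finset.card_erase_of_mem ((mem_circuitSupports hs.mono).2 (.single z hz))]
  exact Nat.sub_le_of_le_add ((card_image_toFinset_le _).trans
    (hs.isClassified.2 (sign_eq_zero_iff.2 h5)))

end IsSortedConfig

/-! ### The dimension of the lifted cone -/

/-- The linear form on homogeneous coordinates with value `orient a b x` at `(x, 1)`. -/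
def orientForm (a b : Fin 2 → ℝ) : (Fin 2 → ℝ) × ℝ →ₗ[ℝ] ℝ where
  toFun w := (b 0 - a 0) * (w.1 1 - w.2 * a 1) - (b 1 - a 1) * (w.1 0 - w.2 * a 0)
  map_add' w w' := by simp; ring
  map_smul' r w := by simp; ring

@[simp]
theorem orientForm_apply_mk_one (a b x : Fin 2 → ℝ) : orientForm a b (x, 1) = orient a b x := by
  simp [orientForm, orient]

theorem orient_nonneg_of_mem_convexHull {S : Set (Fin 2 → ℝ)} {a b x : Fin 2 → ℝ}
    (hS : ∀ y ∈ S, 0 ≤ orient a b y) (hx : x ∈ convexHull ℝ S) : 0 ≤ orient a b x := by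
  refine convexHull_min (t := {y | 0 ≤ orient a b y}) hS (fun y hy z hz c d hc hd hcd => ?_) hx
  have hcomb : (c • y + d • z, (1 : ℝ)) = c • (y, (1 : ℝ)) + d • (z, (1 : ℝ)) := by simp [hcd]
  rw [Set.mem_ofPred_eq, ← orientForm_apply_mk_one, hcomb, map_add, map_smul, map_smul,
    orientForm_apply_mk_one, orientForm_apply_mk_one]
  exact add_nonneg (mul_nonneg hc hy) (mul_nonneg hd hz)

section IsConeLift

variable {ι : Type*}

theorem IsConeLift.exists_eq_zero_of_apply_eq_zero {F : Type*} [AddCommGroup F] [Module ℝ F]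
    [Finite ι] {P : Set F} {K : Submodule ℝ (ι → ℝ)} {π : (ι → ℝ) →ₗ[ℝ] F × ℝ}
    (hK : IsConeLift P K π) {f : F × ℝ →ₗ[ℝ] ℝ} (hf : ∀ x ∈ P, 0 ≤ f (x, 1)) {s u : ι → ℝ}
    (hs : s ∈ K) (hs0 : 0 ≤ s) (hfs : f (π s) = 0) (hu : u ∈ K) (hfu : 0 < f (π u)) :
    ∃ i, s i = 0 ∧ u i ≠ 0 := by
  by_contra! hsub
  obtain ⟨ε, hε, hle⟩ := exists_pos_smul_le hs0 hsub
  have hneg : f (π (s - ε • u)) < 0 := by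
    simpa [hfs] using mul_pos hε hfu
  have hne : s - ε • u ≠ 0 := fun h0 => by simp [h0] at hneg
  obtain ⟨c, hc, x, hx, hπ⟩ :=
    hK.cone _ (K.sub_mem hs (K.smul_mem ε hu)) (sub_nonneg.2 hle) hne
  rw [hπ, map_smul] at hneg
  exact hneg.not_ge (mul_nonneg hc.le (hf x hx))

variable {n : ℕ} {p : Fin (n + 3) → Fin 2 → ℝ} {K : Submodule ℝ (ι → ℝ)}
  {π : (ι → ℝ) →ₗ[ℝ] (Fin 2 → ℝ) × ℝ}

theorem IsCounterclockwise.orient_edge_pos (hp : IsCounterclockwise p) {j k : Fin (n + 3)}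
    (hj : k ≠ j) (hj' : k ≠ j + 1) : 0 < orient (p j) (p (j + 1)) (p k) := by
  have h1 : k - j ≠ 1 := fun h => hj' (by rw [← h, add_sub_cancel])
  simpa using hp.shift j Fin.zero_lt_one
    (lt_of_le_of_ne (Fin.one_le_of_ne_zero (sub_ne_zero.2 hj)) h1.symm)

theorem linearIndependent_of_orient_ne_zero {s : Fin 3 → ι → ℝ} {v : Fin 3 → Fin 2 → ℝ}
    (hπ : ∀ i, π (s i) = (v i, 1)) (hv : orient (v 0) (v 1) (v 2) ≠ 0) :
    LinearIndependent ℝ s := by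
  rw [Fintype.linearIndependent_iff]
  intro g hg
  have h := congrArg π hg
  rw [map_sum, map_zero, Fin.sum_univ_three, map_smul, map_smul, map_smul, hπ, hπ, hπ] at h
  obtain ⟨h0, h1, h2⟩ := eq_zero_of_combination_eq_zero hv h
  exact Fin.forall_fin_succ.2 ⟨h0, Fin.forall_fin_two.2 ⟨h1, h2⟩⟩

theorem IsConeLift.exists_edge_index [Finite ι] (hK : IsConeLift (convexHull ℝ (Set.range p)) K π)
    (hp : IsCounterclockwise p) {s : Fin (n + 3) → ι → ℝ} (hsK : ∀ j, s j ∈ K)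
    (hs : ∀ j, 0 ≤ s j) (hπ : ∀ j, π (s j) = (p j, 1)) (j : Fin (n + 3)) :
    ∃ i, s j i = 0 ∧ s (j + 1) i = 0 ∧ ∃ k, s k i ≠ 0 := by
  obtain ⟨k, hkj, hkj'⟩ := Fin.exists_ne_and_ne_of_two_lt j (j + 1) (by lia)
  have hedge : ∀ x ∈ convexHull ℝ (Set.range p), 0 ≤ orientForm (p j) (p (j + 1)) (x, 1) := by
    intro x hx
    rw [orientForm_apply_mk_one]
    refine orient_nonneg_of_mem_convexHull (Set.forall_mem_range.2 fun l => ?_) hx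
    obtain rfl | hlj := eq_or_ne l j
    · simp
    obtain rfl | hlj' := eq_or_ne l (j + 1)
    · simp
    exact (hp.orient_edge_pos hlj hlj').le
  obtain ⟨i, hi, hik⟩ := hK.exists_eq_zero_of_apply_eq_zero hedge
    (K.add_mem (hsK j) (hsK (j + 1))) (add_nonneg (hs j) (hs (j + 1)))
    (by rw [map_add, map_add, hπ, hπ]; simp) (hsK k)
    (by simpa [hπ] using hp.orient_edge_pos hkj hkj')
  obtain ⟨hi₁, hi₂⟩ := (add_eq_zero_iff_of_nonneg (hs j i) (hs (j + 1) i)).1 hi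
  exact ⟨i, hi₁, hi₂, k, hik⟩

theorem IsConeLift.four_le_finrank [Fintype ι]
    (hK : IsConeLift (convexHull ℝ (Set.range p)) K π) (hp : IsCounterclockwise p)
    (hcard : Fintype.card ι < n + 3) : 4 ≤ Module.finrank ℝ K := by
  by_contra! hrank
  choose s hsK hs hπ using fun j => hK.lift (p j) (subset_convexHull ℝ _ ⟨j, rfl⟩)
  choose g hg hg' k hk using hK.exists_edge_index hp hsK hs hπ
  obtain ⟨j, j', hne, hgj⟩ := Fintype.exists_ne_map_eq_of_card_lt g (by simpa using hcard)
  obtain ⟨l, hlj, hlj', hl⟩ : ∃ l, l ≠ j ∧ l ≠ j + 1 ∧ s l (g j) = 0 := by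
    by_cases hj' : j' = j + 1
    · have h2 : (1 + 1 : Fin (n + 3)) ≠ 0 := by
        simp [Fin.ext_iff, Fin.val_add, Nat.mod_eq_of_lt]
      exact ⟨j' + 1, by simpa [hj', add_assoc] using h2, by simp [hj'], hgj ▸ hg' j'⟩
    · exact ⟨j', hne.symm, hj', hgj ▸ hg j'⟩
  have hindep := linearIndependent_of_orient_ne_zero (s := ![s j, s (j + 1), s l])
    (v := ![p j, p (j + 1), p l]) (π := π) (by simp [Fin.forall_fin_succ, hπ])
    (hp.orient_edge_pos hlj hlj').ne'
  have hspan : Submodule.span ℝ (Set.range ![s j, s (j + 1), s l]) = K := by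
    refine Submodule.eq_of_le_of_finrank_le (Submodule.span_le.2 ?_) ?_
    · rw [Set.range_subset_iff]
      simp [Fin.forall_fin_succ, hsK]
    · rw [finrank_span_eq_card hindep, Fintype.card_fin]
      exact Nat.le_of_lt_succ hrank
  have hker : K ≤ LinearMap.ker (LinearMap.proj (g j) : (ι → ℝ) →ₗ[ℝ] ℝ) := by
    rw [← hspan, Submodule.span_le, Set.range_subset_iff]
    simp [Fin.forall_fin_succ, hg, hg', hl]
  exact hk j (hker (hsK _))

end IsConeLift

/-! ### Two equations in normal form -/

theorem exists_linearMap_ker_eq {k V : Type*} [Field k] [AddCommGroup V] [Module k V]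
    [FiniteDimensional k V] {K : Submodule k V} {m : ℕ}
    (hK : Module.finrank k V ≤ Module.finrank k K + m) :
    ∃ g : V →ₗ[k] (Fin m → k), LinearMap.ker g = K := by
  have hquot : Module.finrank k (V ⧸ K) ≤ Module.finrank k (Fin m → k) := by
    rw [Module.finrank_fin_fun]
    have := K.finrank_quotient_add_finrank
    lia
  obtain ⟨f, hf⟩ := finrank_le_iff_exists_linearMap.1 hquot
  exact ⟨f ∘ₗ K.mkQ, by rw [LinearMap.ker_comp_of_ker_eq_bot _ (LinearMap.ker_eq_bot.2 hf),
    K.ker_mkQ]⟩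

section depSpace

variable {ι ι' : Type*} [Fintype ι] [Fintype ι']

-- A generic combination of the two equations vanishes only at indices missing from both, and the
-- ratios of the second equation to it are the points; indices missing from both go far right.
theorem exists_depSpace_eq_ker (g : (ι → ℝ) →ₗ[ℝ] (Fin 2 → ℝ)) :
    ∃ lam t : ι → ℝ, depSpace lam t = LinearMap.ker g ∧
      ∀ i j, lam i = 0 → (lam j = 0 → t i = t j) ∧ (lam j ≠ 0 → t j < t i) := by
  classical
  obtain ⟨α, β, hg⟩ : ∃ α β : ι → ℝ, ∀ s, g s = 0 ↔ ∑ i, α i * s i = 0 ∧ ∑ i, β i * s i = 0 :=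
    ⟨g.toMatrix' 0, g.toMatrix' 1, fun s => by
      rw [← g.toMatrix'_mulVec s, funext_iff, Fin.forall_fin_two]; rfl⟩
  obtain ⟨τ, hτ⟩ := exists_generic_combination α β
  set lam : ι → ℝ := fun i => α i + τ * β i
  obtain ⟨B, hB⟩ := (Set.finite_range fun i => β i / lam i).bddAbove
  set t : ι → ℝ := fun i => if lam i = 0 then B + 1 else β i / lam i
  have hmul : ∀ i, lam i * t i = β i := fun i => by
    by_cases hi : lam i = 0
    · rw [hi, zero_mul, (hτ i hi).2]
    · simp only [t, if_neg hi, mul_div_cancel₀ _ hi]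
  refine ⟨lam, t, ?_, fun i j hi => ⟨fun hj => by simp [t, hi, hj], fun hj => ?_⟩⟩
  · ext s
    have hlam : ∑ i, lam i * s i = ∑ i, α i * s i + τ * ∑ i, β i * s i := by
      simp only [lam, add_mul, Finset.sum_add_distrib, Finset.mul_sum, mul_assoc]
    have hlamt : ∑ i, lam i * s i * t i = ∑ i, β i * s i :=
      Finset.sum_congr rfl fun i _ => by rw [← hmul i]; ring
    rw [mem_depSpace, LinearMap.mem_ker, hg, hlam, hlamt]
    exact and_congr_left fun h => by rw [h, mul_zero, add_zero]
  · simpa [t, hi, hj] using (hB (Set.mem_range_self j)).trans_lt (lt_add_one B)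

theorem depSpace_smul_comp {ε : ℝ} (hε : ε ≠ 0) (e : ι' ≃ ι) (lam t : ι → ℝ) :
    depSpace (ε • lam ∘ e) (t ∘ e) = (depSpace lam t).comap (LinearMap.funLeft ℝ ℝ e.symm) := by
  ext s
  rw [Submodule.mem_comap, mem_depSpace, mem_depSpace, ← e.sum_comp, ← e.sum_comp]
  simp [mul_assoc, ← Finset.mul_sum, hε, LinearMap.funLeft_apply]

end depSpace

theorem exists_isSortedConfig_comp {lam t : Fin 6 → ℝ}
    (h : ∀ i j, lam i = 0 → (lam j = 0 → t i = t j) ∧ (lam j ≠ 0 → t j < t i)) :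
    ∃ (σ : Equiv.Perm (Fin 6)) (ε : ℝ), ε ≠ 0 ∧ IsSortedConfig (ε • lam ∘ σ) (t ∘ σ) := by
  have hmono : Monotone (t ∘ Tuple.sort t) := Tuple.monotone_sort t
  set σ := Tuple.sort t
  obtain ⟨ε, hε, hε0⟩ : ∃ ε : ℝ, ε ≠ 0 ∧ 0 ≤ ε * lam (σ 0) := by
    rcases le_total 0 (lam (σ 0)) with h0 | h0
    · exact ⟨1, one_ne_zero, by rwa [one_mul]⟩
    · exact ⟨-1, neg_ne_zero.2 one_ne_zero, by rwa [neg_one_mul, neg_nonneg]⟩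
  have hzero : ∀ i, (ε • lam ∘ σ) i = 0 ↔ lam (σ i) = 0 := fun i => by simp [hε]
  refine ⟨σ, ε, hε, hmono, hε0, fun i hi => ?_, fun i hi hi' => ?_⟩
  · rw [hzero] at hi ⊢
    have hsucc : lam (σ i.succ) = 0 := by
      by_contra hne
      exact ((h _ _ hi).2 hne).not_ge (hmono i.castSucc_lt_succ.le)
    exact ⟨hsucc, (h _ _ hi).1 hsucc⟩
  · exact (h _ _ ((hzero _).1 hi')).2 (mt (hzero _).2 hi)

theorem exists_isSortedConfig {ι : Type*} [Fintype ι] {K : Submodule ℝ (ι → ℝ)}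
    (h6 : Fintype.card ι ≤ 6) (hK : Fintype.card ι ≤ Module.finrank ℝ K + 2) :
    ∃ (e : ι ↪ Fin 6) (lam t : Fin 6 → ℝ), IsSortedConfig lam t ∧
      depSpace lam t = K.comap (LinearMap.funLeft ℝ ℝ e) := by
  obtain ⟨f⟩ := Function.Embedding.nonempty_of_card_le (h6.trans_eq (Fintype.card_fin 6).symm)
  obtain ⟨g, rfl⟩ := exists_linearMap_ker_eq ((Module.finrank_fintype_fun_eq_card ℝ).trans_le hK)
  obtain ⟨lam, t, hdep, hlt⟩ := exists_depSpace_eq_ker (g ∘ₗ LinearMap.funLeft ℝ ℝ f)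
  obtain ⟨σ, ε, hε, hs⟩ := exists_isSortedConfig_comp hlt
  refine ⟨f.trans σ.symm.toEmbedding, _, _, hs, ?_⟩
  rw [depSpace_smul_comp hε, hdep]
  rfl

/-! ### Hidden vertices -/

theorem IsExtremeRay.extend {ι ι' : Type*} {K : Submodule ℝ (ι → ℝ)} {s : ι → ℝ} {e : ι → ι'}
    (he : Function.Injective e) (hs : IsExtremeRay K s) :
    IsExtremeRay (K.comap (LinearMap.funLeft ℝ ℝ e)) (Function.extend e s (0 : ι' → ℝ)) := by
  have hcomp : Function.extend e s (0 : ι' → ℝ) ∘ e = s := Function.extend_comp he s 0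
  have hmem : Function.extend e s (0 : ι' → ℝ) ∘ e ∈ K := hcomp.symm ▸ hs.mem
  refine ⟨hmem, fun i => ?_, fun h0 => hs.ne_zero ?_,
    fun u hu hsu => ?_⟩
  · by_cases hi : ∃ a, e a = i
    · obtain ⟨a, rfl⟩ := hi
      exact (hs.nonneg a).trans_eq (he.extend_apply s 0 a).symm
    · exact (Function.extend_apply' s _ i hi).ge
  · rw [← hcomp, h0]
    rfl
  · obtain ⟨c, hc⟩ := hs.eq_smul _ hu fun a ha => hsu _ ((he.extend_apply s 0 a).trans ha)
    refine ⟨c, funext fun i => ?_⟩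
    by_cases hi : ∃ a, e a = i
    · obtain ⟨a, rfl⟩ := hi
      exact (congrFun hc a).trans (by simp [he.extend_apply])
    · have h0 : Function.extend e s (0 : ι' → ℝ) i = 0 := Function.extend_apply' s _ i hi
      rw [hsu i h0, Pi.smul_apply, h0, smul_zero]

theorem IsConeLift.ncard_extremePoints_le {ι ι' F : Type*} [Finite ι] [AddCommGroup F] [Module ℝ F]
    {P : Set F} {K : Submodule ℝ (ι → ℝ)} {π : (ι → ℝ) →ₗ[ℝ] F × ℝ} (hK : IsConeLift P K π)
    {e : ι → ι'} {L : Finset (Finset ι')}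
    (hL : ∀ s, IsExtremeRay K s → ∃ S ∈ L, ∀ i, s i ≠ 0 ↔ e i ∈ S) :
    (P.extremePoints ℝ).ncard ≤ L.card := by
  choose! s hs hπ using fun v (hv : v ∈ P.extremePoints ℝ) => hK.exists_isExtremeRay hv
  choose! S hS hsupp using fun v (hv : v ∈ P.extremePoints ℝ) => hL _ (hs v hv)
  rw [← Set.ncard_coe_finset]
  refine Set.ncard_le_ncard_of_injOn S hS fun v hv v' hv' heq => ?_
  refine (hs v hv).image_unique (hs v' hv').mem (fun i hi => ?_) one_pos (c := 1)
    (by rw [hπ v hv, one_smul]) (by rw [hπ v' hv', one_smul])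
  by_contra hi'
  exact (hsupp v hv i).2 (heq ▸ (hsupp v' hv' i).1 hi') hi

section IsConvexHeptagon

variable {ι : Type*} [Fintype ι] {P : Set (Fin 2 → ℝ)} {K : Submodule ℝ (ι → ℝ)}
  {π : (ι → ℝ) →ₗ[ℝ] (Fin 2 → ℝ) × ℝ}

theorem IsConvexHeptagon.nontrivial (hP : IsConvexHeptagon P) : P.Nontrivial :=
  (Set.one_lt_ncard_iff_nontrivial_and_finite.1 (hP.2 ▸ by decide : 1 < (vertices P).ncard)).1.mono
    extremePoints_subset

theorem IsConvexHeptagon.four_le_finrank (hP : IsConvexHeptagon P) (hK : IsConeLift P K π)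
    (h6 : Fintype.card ι ≤ 6) : 4 ≤ Module.finrank ℝ K := by
  obtain ⟨p, hrange, hp⟩ := exists_isCounterclockwise hP.1.convex hP.2
  rw [← hP.1.convexHull_vertices, vertices, ← hrange] at hK
  exact hK.four_le_finrank hp (Nat.lt_succ_of_le h6)

-- Padding with zeros puts the rays over the seven vertices among at most seven rays, one of which
-- is spanned by a new coordinate vector.
theorem IsConvexHeptagon.six_le_card (hP : IsConvexHeptagon P) (hK : IsConeLift P K π) :
    6 ≤ Fintype.card ι := by
  by_contra! hlt
  obtain ⟨e, lam, t, hs, hdep⟩ :=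
    exists_isSortedConfig hlt.le (by linarith [hP.four_le_finrank hK hlt.le])
  obtain ⟨z, hz⟩ : ∃ z, ∀ i, e i ≠ z := by
    by_contra! hsurj
    simpa using hlt.trans_le (Fintype.card_le_of_surjective e hsurj)
  have hlamz : lam z = 0 := by
    have hmem : Pi.single z 1 ∈ depSpace lam t := by
      rw [hdep, Submodule.mem_comap]
      convert K.zero_mem
      ext i
      simp [LinearMap.funLeft_apply, hz i]
    simpa [Pi.single_apply] using (mem_depSpace.1 hmem).1
  have hle : (vertices P).ncard ≤ ((circuitSupports lam t).erase {z}).card := by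
    refine hK.ncard_extremePoints_le (e := e) fun s hs' => ?_
    obtain ⟨S, hS, hsupp⟩ := (hdep ▸ hs'.extend e.injective).exists_isCircuitSupport
    refine ⟨S, Finset.mem_erase.2 ⟨?_, (mem_circuitSupports hs.mono).2 hS⟩, fun i => ?_⟩
    · rintro rfl
      exact (hsupp z).2 (Finset.mem_singleton_self z)
        (Function.extend_apply' s _ z fun ⟨i, hi⟩ => hz i hi)
    · rw [← hsupp, e.injective.extend_apply]
  rw [hP.2] at hle
  exact (hle.trans (card_circuitSupports_erase_le hs hlamz)).not_gt (by decide)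

theorem IsConvexHeptagon.not_noHiddenRay (hP : IsConvexHeptagon P) (hgen : InGeneralPosition P)
    (hK : IsConeLift P K π) (h6 : Fintype.card ι = 6) : ¬ NoHiddenRay P K π := by
  intro hno
  obtain ⟨e, lam, t, hs, hdep⟩ :=
    exists_isSortedConfig h6.le (by linarith [hP.four_le_finrank hK h6.le])
  obtain ⟨e, rfl⟩ : ∃ e' : Fin 6 ≃ ι, e'.symm.toEmbedding = e :=
    ⟨(Equiv.ofBijective e ((Fintype.bijective_iff_injective_and_card e).2
      ⟨e.injective, by simp [h6]⟩)).symm, rfl⟩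
  exact false_of_isSortedConfig hs (hdep ▸ hK.comap e) (hdep ▸ hno.comap e) hP.1.convex hP.2 hgen

end IsConvexHeptagon

theorem polytopeSize_eq_card {n : ℕ} (Q : Set (Fin n → ℝ)) [Fintype {F // IsFacet Q F}] :
    polytopeSize Q = Fintype.card {F // IsFacet Q F} :=
  ENat.card_eq_coe_fintype_card (α := {F // IsFacet Q F})

theorem IsMinimumSizeExtension.polytopeSize_eq_six {P : Set (Fin 2 → ℝ)} {k : ℕ}
    {Q : Set (Fin (2 + k) → ℝ)} (hQ : IsMinimumSizeExtension Q P) (hP : IsConvexHeptagon P) :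
    polytopeSize Q = 6 := by
  obtain ⟨R, hR, hR6⟩ := hP.exists_extension_polytopeSize_le_six
  have h6 : polytopeSize Q ≤ 6 := (hQ.2 1 R hR).trans hR6
  refine h6.antisymm ?_
  obtain ⟨K, π, hK, -⟩ := hQ.1.exists_isConeLift hP.nontrivial
  have : Fintype {F // IsFacet Q F} := (Set.finite_of_encard_le_coe h6).fintype
  rw [polytopeSize_eq_card]
  exact_mod_cast hP.six_le_card hK

theorem mainTheorem1 (P : Set (Fin 2 → ℝ)) (hP : IsConvexHeptagon P) (hgen : InGeneralPosition P)
    (k : ℕ) (Q : Set (Fin (2 + k) → ℝ)) (hQ : IsMinimumSizeExtension Q P) :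
    polytopeSize Q = 6 ∧ ∃ w ∈ vertices Q, firstCoords 2 k w ∉ vertices P := by
  have hsize : polytopeSize Q = 6 := hQ.polytopeSize_eq_six hP
  refine ⟨hsize, ?_⟩
  by_contra! hvertices
  have : Fintype {F // IsFacet Q F} := (Set.finite_of_encard_eq_coe hsize).fintype
  obtain ⟨K, π, hK, hno⟩ := hQ.1.exists_isConeLift hP.nontrivial
  rw [polytopeSize_eq_card] at hsize
  exact hP.not_noHiddenRay hgen hK (by exact_mod_cast hsize) (hno hvertices)
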